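/- Let $S$ be a closed (compact, connected) Riemann surface of genus $g\ge 2$, equipped with its hyperbolic metric of curvature $-1$, i.e. the conformal metric $\rho_S|dw|$ whose pull-back under a holomorphic universal covering $\pi:\mathbb H\to S$ by the upper half-plane is $|dz|/\operatorname{Im} z$. Let $Q(S)$ be the complex vector space of holomorphic quadratic differentials on $S$ with the norm $\|\varphi\|_{Q(S)}=\sup_{p\in S}\rho_S^{-2}(p)|\varphi(p)|$, and let $\mathbb C^n$ carry the supremum norm. There exist universal constants $\alpha\ge 1$ and $\delta>0$ and, for every $\varepsilon>0$, a constant $K=K(\varepsilon)$ depending only on $\varepsilon$, such that the following holds for every $g\ge 2$ and every closed Riemann surface $S$ of genus $g$ whose injectivity radius is at least $\varepsilon$. There are an integer $n\le Kg$, points $p_1,\dots,p_n\in S$ such that the open hyperbolic balls of radius $\delta$ centred at $p_1,\dots,p_n$ cover $S$, for each $j$ a chart $e_j$ of $S$ around $p_j$, a complex linear subspace $V\subset\mathbb C^n$, and a complex linear isomorphism $F:Q(S)\to V$ such that $$\frac1\alpha\|\varphi-\psi\|_{Q(S)}\le\|F(\varphi)-F(\psi)\|_\infty\le\alpha\|\varphi-\psi\|_{Q(S)}\qquad\text{for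 all }\varphi,\psi\in Q(S),$$ and the $j$-th coordinate of $F(\varphi)$ is the value of $\rho_S^{-2}\varphi$ at $p_j$, expressed in the chart $e_j$. -/

import Mathlib

open Set UpperHalfPlane
open scoped Manifold ContDiff ENNReal NNReal

universe u

noncomputable section

namespace BersSpace

variable {S : Type u} [TopologicalSpace S]

/-- `HasGenus S g`: the (closed, connected, orientable) surface `S` has genus `g`, i.e. its first
homology group, the abelianization of its fundamental group, has rank `2 * g`. -/
def HasGenus (S : Type u) [TopologicalSpace S] (g : ℕ) : Prop :=
  ∀ x : S, Module.finrank ℤ (Additive (Abelianization (FundamentalGroup S x))) = 2 * g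

/-- `π : ℍ → S` is a holomorphic universal covering of the Riemann surface `S` by the hyperbolic
plane (`ℍ` is simply connected). -/
structure IsUniversalCovering [ChartedSpace ℂ S] (π : ℍ → S) : Prop where
  isCoveringMap : IsCoveringMap π
  surjective : Function.Surjective π
  holomorphic : MDifferentiable 𝓘(ℂ) 𝓘(ℂ) π

/-- The hyperbolic distance on `S`: the quotient of the hyperbolic distance of `ℍ` (of curvature
`-1`) under the universal covering `π`. -/
def hypEDist (π : ℍ → S) (p q : S) : ℝ≥0∞ :=
  ⨅ (z : ℍ) (_ : π z = p) (w : ℍ) (_ : π w = q), edist z w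

/-- The open hyperbolic ball of `S` with centre `p` and radius `r`. -/
def hypBall (π : ℍ → S) (p : S) (r : ℝ) : Set S :=
  {q | hypEDist π p q < ENNReal.ofReal r}

/-- The injectivity radius of `S` at `p`: the supremum of the radii `r` for which `π` (that is, the
exponential map of `S` at `p`) is injective on the open ball of radius `r` about a point over
`p`. -/
def injectivityRadiusAt (π : ℍ → S) (p : S) : ℝ≥0∞ :=
  sSup {r : ℝ≥0∞ | ∀ z : ℍ, π z = p → InjOn π (Metric.eball z r)}

/-- The injectivity radius of `S`: the infimum over all points. -/
def injectivityRadius (π : ℍ → S) : ℝ≥0∞ :=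
  ⨅ p : S, injectivityRadiusAt π p

variable [ChartedSpace ℂ S]

/-- The density `ρ` of the hyperbolic metric `ρ |dw|` of `S` at the point `p`, expressed in the
chart `e` (meaningful for `p ∈ e.source`). The metric pulls back under `π` to the hyperbolic metric
`|dz| / Im z` of `ℍ`, so `ρ = 1 / (Im z * |(e ∘ π)'(z)|)` for any point `z` over `p`; the value does
not depend on `z`, since deck transformations are isometries of `ℍ`. -/
def hypDensity (π : ℍ → S) (e : OpenPartialHomeomorph S ℂ) (p : S) : ℝ :=
  let z : ℍ := Function.invFun π p
  1 / (z.im * ‖deriv (fun w : ℂ => e (π (ofComplex w))) (z : ℂ)‖)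

variable (S) in
/-- The complex vector space `Q(S)` of holomorphic quadratic differentials on `S`: a holomorphic
function on the image of each chart, such that `φ_e = (φ_{e'} ∘ T) * (T')²` for every change of
charts `T = e' ∘ e⁻¹`. Values outside the image of a chart are normalized to `0`. -/
def QuadraticDifferential : Submodule ℂ (atlas ℂ S → ℂ → ℂ) where
  carrier := {φ |
    (∀ e : atlas ℂ S, DifferentiableOn ℂ (φ e) e.1.target) ∧
    (∀ e : atlas ℂ S, ∀ w ∉ e.1.target, φ e w = 0) ∧
    ∀ e e' : atlas ℂ S, ∀ w ∈ e.1.target, e.1.symm w ∈ e'.1.source →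
      φ e w = φ e' (e'.1 (e.1.symm w)) * (deriv (fun v => e'.1 (e.1.symm v)) w) ^ 2}
  add_mem' := by
    rintro φ ψ ⟨h1, h2, h3⟩ ⟨k1, k2, k3⟩
    refine ⟨fun e => (h1 e).add (k1 e), fun e w hw => ?_, fun e e' w hw hw' => ?_⟩
    · simp [h2 e w hw, k2 e w hw]
    · simp only [Pi.add_apply]
      rw [h3 e e' w hw hw', k3 e e' w hw hw']
      ring
  zero_mem' := by
    refine ⟨fun e => differentiableOn_const 0, fun e w hw => rfl, fun e e' w hw hw' => ?_⟩
    simp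
  smul_mem' := by
    rintro c φ ⟨h1, h2, h3⟩
    refine ⟨fun e => (h1 e).const_smul c, fun e w hw => ?_, fun e e' w hw hw' => ?_⟩
    · simp [h2 e w hw]
    · simp only [Pi.smul_apply, smul_eq_mul]
      rw [h3 e e' w hw hw']
      ring

/-- The value `ρ⁻² φ` at the point `p`, expressed in the chart `e` (meaningful for
`p ∈ e.source`). Its absolute value does not depend on the chart. -/
def normalizedValue (π : ℍ → S) (φ : QuadraticDifferential S) (e : atlas ℂ S) (p : S) : ℂ :=
  ((hypDensity π e.1 p : ℂ) ^ 2)⁻¹ * φ.1 e (e.1 p)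

/-- The norm `‖φ‖ = sup_{p ∈ S} ρ⁻²(p) |φ(p)|` of `Q(S)`. (It is finite when `S` is compact;
extended values only avoid a convention for suprema of unbounded sets.) -/
def supNorm (π : ℍ → S) (φ : QuadraticDifferential S) : ℝ≥0∞ :=
  ⨆ p : S, ‖normalizedValue π φ ⟨chartAt ℂ p, chart_mem_atlas ℂ p⟩ p‖ₑ

/-- `F`, from `Q(S)` with the distance of the supremum norm to a subspace `V` of `ℂⁿ` with the
supremum norm, is `α`-bi-Lipschitz. -/
def IsBiLipschitz (π : ℍ → S) {n : ℕ} {V : Submodule ℂ (Fin n → ℂ)} (α : ℝ≥0)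
    (F : QuadraticDifferential S → V) : Prop :=
  ∀ φ ψ : QuadraticDifferential S,
    supNorm π (φ - ψ) / α ≤ edist (F φ) (F ψ) ∧ edist (F φ) (F ψ) ≤ α * supNorm π (φ - ψ)

end BersSpace

end

/-! A quadratic differential lifts to a weight 2 form `f` on the upper half-plane for the deck group
Γ, and its norm is the maximum of the Γ-invariant function |f| Im². Cauchy's estimate shows that |f|
Im² is still at least half its maximum within distance log(65/64) of a maximum point
(`le_two_mul_of_dist_lt`). Evaluation at the points of any log(65/64)-net is therefore
2-bi-Lipschitz, and everything reduces to finding a net of at most K(ε) g points. A maximal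
σ-separated family of orbits, with σ = min(ε, log(65/64)), is such a net; its cardinality has to be
bounded linearly in g.

This bound uses neither area nor Gauss–Bonnet, since the genus is given as half the first Betti
number. For a weight a depending only on σ, the Poincaré series of functions peaked at the n
separated points are linearly independent, by diagonal dominance, so that n ≤ dim Form(a)
(`card_le_finrank_form`).

It remains to bound dim Form(a) by topology. Write D(k) for dim Form(k) and N(φ) for the number of
zeros of φ modulo Γ. Prescribing jets at the zeros of a nonzero form φ of weight a gives D(a + j) =
N(φ) + D(j) for j ≥ 2 (`finrank_form_add`), and D(a) ≤ N(φ) + 1 (`finrank_form_le`). Comparing the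
weights a and a + 1 shows that D grows linearly from weight 2 on, with some slope κ, and N(φ) = aκ.
The slope is controlled by periods: functions g for which (g/φ)' dz is an invariant differential
have periods in Hom(Γ, ℂ), and counting their dimension in two ways
(`finrank_form_two_mul_add_one_le`) gives κ + 1 ≤ dim Hom(Γ, ℂ) ≤ 2g. Hence n ≤ D(a) ≤ aκ + 1 ≤ 2ag.
-/

noncomputable section

namespace BersSpace

open Filter Topology Metric
open scoped ComplexConjugate

/-! ### The Schwarz–Pick lemma and holomorphic group actions on the upper half-plane -/

section

lemma normSq_sub_conj_sub_normSq_sub (v w : ℂ) :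
    ‖v - conj w‖ ^ 2 - ‖v - w‖ ^ 2 = 4 * v.im * w.im := by
  simp only [Complex.sq_norm, Complex.normSq_apply, Complex.sub_re, Complex.sub_im,
    Complex.conj_re, Complex.conj_im]
  ring

lemma sub_conj_ne_zero {v w : ℂ} (hv : 0 < v.im) (hw : 0 < w.im) : v - conj w ≠ 0 := by
  intro h
  have := congrArg Complex.im h
  simp at this
  linarith

lemma norm_sub_lt_norm_sub_conj {v w : ℂ} (hw : 0 < w.im) :
    ‖v - w‖ < ‖v - conj w‖ ↔ 0 < v.im := by
  rw [← sq_lt_sq₀ (norm_nonneg _) (norm_nonneg _), ← sub_pos, normSq_sub_conj_sub_normSq_sub]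
  constructor
  · intro h
    by_contra hv
    push Not at hv
    nlinarith
  · intro h; positivity

/-- Schwarz's lemma on the unit disc, transported by Cayley transforms centred at `w` in the source
and at `f w` in the target. -/
theorem schwarzPick {f : ℂ → ℂ} (hf : DifferentiableOn ℂ f upperHalfPlaneSet)
    (hmaps : MapsTo f upperHalfPlaneSet upperHalfPlaneSet) {z w : ℂ} (hz : 0 < z.im)
    (hw : 0 < w.im) :
    ‖f z - f w‖ * ‖z - conj w‖ ≤ ‖z - w‖ * ‖f z - conj (f w)‖ := by
  -- The inverse Cayley transform: it maps the disc to the half-plane and 0 to `w`.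
  set c : ℂ → ℂ := fun ζ => (w - conj w * ζ) / (1 - ζ) with hc
  have h1 : ∀ ζ ∈ ball (0 : ℂ) 1, (1 : ℂ) - ζ ≠ 0 := by
    intro ζ hζ h
    rw [sub_eq_zero] at h
    simp [← h] at hζ
  have hww := sub_conj_ne_zero hw hw
  have hcU : MapsTo c (ball 0 1) upperHalfPlaneSet := by
    intro ζ hζ
    have h2 : c ζ - w = ζ * ((w - conj w) / (1 - ζ)) := by
      rw [hc]; field_simp [h1 ζ hζ]; ring
    have h3 : c ζ - conj w = (w - conj w) / (1 - ζ) := by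
      rw [hc]; field_simp [h1 ζ hζ]; ring
    refine (norm_sub_lt_norm_sub_conj hw).1 ?_
    rw [h2, h3, norm_mul]
    have h4 : 0 < ‖(w - conj w) / (1 - ζ)‖ := norm_pos_iff.2 (div_ne_zero hww (h1 ζ hζ))
    have h5 : ‖ζ‖ < 1 := by simpa using hζ
    nlinarith
  have hcd : DifferentiableOn ℂ c (ball 0 1) := by
    intro ζ hζ
    have := h1 ζ hζ
    exact DifferentiableAt.differentiableWithinAt (by fun_prop (disch := assumption))
  have hfw : 0 < (f w).im := hmaps hw
  set F : ℂ → ℂ := fun ζ => (f (c ζ) - f w) / (f (c ζ) - conj (f w)) with hF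
  have hFd : DifferentiableOn ℂ F (ball 0 1) := by
    have := hf.comp hcd hcU
    refine (this.sub_const _).div (this.sub_const _) fun ζ hζ => ?_
    exact sub_conj_ne_zero (hmaps (hcU hζ)) hfw
  have hFm : MapsTo F (ball 0 1) (closedBall 0 1) := by
    intro ζ hζ
    have h4 := (norm_sub_lt_norm_sub_conj (v := f (c ζ)) hfw).2 (hmaps (hcU hζ))
    simp only [hF, mem_closedBall, dist_zero_right, norm_div]
    exact div_le_one_of_le₀ h4.le (norm_nonneg _)
  have hF0 : F 0 = 0 := by simp [hF, hc]
  have hzw := sub_conj_ne_zero hz hw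
  have hζ : ‖(z - w) / (z - conj w)‖ < 1 := by
    rw [norm_div, div_lt_one (norm_pos_iff.2 hzw)]
    exact (norm_sub_lt_norm_sub_conj hw).2 hz
  have hcz : c ((z - w) / (z - conj w)) = z := by
    have h6 : (1 : ℂ) - (z - w) / (z - conj w) ≠ 0 := h1 _ (by simpa using hζ)
    simp only [hc]
    rw [div_eq_iff h6]
    field_simp
    ring
  have key := Complex.norm_le_norm_of_mapsTo_ball hFd hFm hF0 hζ
  simp only [hF, hcz, norm_div] at key
  have h7 := norm_pos_iff.2 hzw
  have h8 := norm_pos_iff.2 (sub_conj_ne_zero (hmaps hz) hfw)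
  rwa [div_le_div_iff₀ h8 h7] at key

theorem dist_le_of_holomorphic {f : ℍ → ℍ}
    (hf : DifferentiableOn ℂ (fun z => (f (ofComplex z) : ℂ)) upperHalfPlaneSet) (z w : ℍ) :
    dist (f z) (f w) ≤ dist z w := by
  have h := schwarzPick hf (fun z _ => (f (ofComplex z)).im_pos) z.im_pos w.im_pos
  simp only [ofComplex_apply] at h
  -- Schwarz–Pick compares the values of tanh(d/2); the addition formula for sinh turns this
  -- comparison into the sign of a difference of distances.
  have h2 : Real.sinh (dist (f z) (f w) / 2 - dist z w / 2) ≤ 0 := by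
    rw [Real.sinh_sub, sub_nonpos, sinh_half_dist, cosh_half_dist, sinh_half_dist, cosh_half_dist,
      Complex.dist_eq, Complex.dist_eq, Complex.dist_eq, Complex.dist_eq, div_mul_div_comm,
      div_mul_div_comm, mul_comm ‖(f z : ℂ) - conj (f w : ℂ)‖]
    gcongr
  have := Real.sinh_nonpos_iff.1 h2
  linarith

section Action

variable {Γ : Type*} [Group Γ] [MulAction Γ ℍ]

/-- The action of `γ` on the upper half-plane as a function of a complex variable. -/
def act (γ : Γ) (z : ℂ) : ℂ := (γ • ofComplex z : ℍ)

/-- The complex derivative of the action of `γ`. -/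
def jac (γ : Γ) (z : ℂ) : ℂ := deriv (act γ) z

variable (Γ) in
/-- The group `Γ` acts on the upper half-plane holomorphically, cocompactly, and with displacements
bounded below. -/
class IsCocompactAction : Prop where
  differentiableOn_act : ∀ γ : Γ, DifferentiableOn ℂ (act γ) upperHalfPlaneSet
  exists_le_dist : ∃ σ : ℝ, 0 < σ ∧ ∀ γ : Γ, γ ≠ 1 → ∀ z : ℍ, σ ≤ dist (γ • z) z
  exists_isCompact : ∃ K : Set ℍ, IsCompact K ∧ ∀ z : ℍ, ∃ γ : Γ, γ • z ∈ K

lemma act_coe (γ : Γ) (z : ℍ) : act γ (z : ℂ) = (γ • z : ℍ) := by simp [act]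

lemma act_im_pos (γ : Γ) (z : ℂ) : 0 < (act γ z).im := (γ • ofComplex z : ℍ).im_pos

lemma act_mul (γ δ : Γ) (z : ℂ) : act (γ * δ) z = act γ (act δ z) := by
  simp [act, mul_smul]

lemma act_one {z : ℂ} (hz : 0 < z.im) : act (1 : Γ) z = z := by
  simp [act, ofComplex_apply_of_im_pos hz]

lemma act_inv_act (γ : Γ) {z : ℂ} (hz : 0 < z.im) : act γ⁻¹ (act γ z) = z := by
  rw [← act_mul, inv_mul_cancel, act_one hz]

lemma act_act_inv (γ : Γ) {z : ℂ} (hz : 0 < z.im) : act γ (act γ⁻¹ z) = z := by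
  rw [← act_mul, mul_inv_cancel, act_one hz]

lemma mem_nhds_upperHalfPlaneSet {z : ℂ} (hz : 0 < z.im) : upperHalfPlaneSet ∈ 𝓝 z :=
  isOpen_upperHalfPlaneSet.mem_nhds hz

lemma jac_one {z : ℂ} (hz : 0 < z.im) : jac (1 : Γ) z = 1 := by
  have : act (1 : Γ) =ᶠ[𝓝 z] id := by
    filter_upwards [mem_nhds_upperHalfPlaneSet hz] with w hw using act_one hw
  rw [jac, this.deriv_eq, deriv_id]

variable [IsCocompactAction Γ]

lemma differentiableAt_act (γ : Γ) {z : ℂ} (hz : 0 < z.im) : DifferentiableAt ℂ (act γ) z :=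
  (IsCocompactAction.differentiableOn_act γ).differentiableAt (mem_nhds_upperHalfPlaneSet hz)

lemma differentiableOn_jac (γ : Γ) : DifferentiableOn ℂ (jac γ) upperHalfPlaneSet :=
  (IsCocompactAction.differentiableOn_act γ).deriv isOpen_upperHalfPlaneSet

lemma jac_mul (γ δ : Γ) {z : ℂ} (hz : 0 < z.im) :
    jac (γ * δ) z = jac γ (act δ z) * jac δ z := by
  have : act (γ * δ) = act γ ∘ act δ := funext (act_mul γ δ)
  rw [jac, this, deriv_comp _ (differentiableAt_act γ (act_im_pos δ z)) (differentiableAt_act δ hz)]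
  rfl

lemma jac_ne_zero (γ : Γ) {z : ℂ} (hz : 0 < z.im) : jac γ z ≠ 0 := by
  have h := jac_mul γ⁻¹ γ hz
  rw [inv_mul_cancel, jac_one hz] at h
  exact right_ne_zero_of_mul_eq_one h.symm

lemma dist_smul (γ : Γ) (z w : ℍ) : dist (γ • z) (γ • w) = dist z w := by
  have h : ∀ γ : Γ, ∀ z w : ℍ, dist (γ • z) (γ • w) ≤ dist z w := fun γ z w =>
    dist_le_of_holomorphic (f := fun z => γ • z) (IsCocompactAction.differentiableOn_act γ) z w
  refine (h γ z w).antisymm ?_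
  simpa using h γ⁻¹ (γ • z) (γ • w)

/-- The infinitesimal form of `dist_smul`: since sinh²(d/2) is preserved, the squared difference
quotient of γ is a ratio of imaginary parts, and one lets w tend to z. No description of γ as a
Möbius map is needed. -/
lemma norm_jac (γ : Γ) {z : ℂ} (hz : 0 < z.im) : ‖jac γ z‖ = (act γ z).im / z.im := by
  have hd := (differentiableAt_act γ hz).hasDerivAt
  have h1 : Tendsto (fun w => ‖slope (act γ) z w‖ ^ 2) (𝓝[≠] z) (𝓝 (‖jac γ z‖ ^ 2)) :=
    (hd.tendsto_slope.norm).pow 2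
  have h2 : Tendsto (fun w : ℂ => (act γ w).im * (act γ z).im / (w.im * z.im)) (𝓝[≠] z)
      (𝓝 ((act γ z).im * (act γ z).im / (z.im * z.im))) := by
    have : ContinuousAt (fun w : ℂ => (act γ w).im * (act γ z).im / (w.im * z.im)) z := by
      have h3 : ContinuousAt (fun w => (act γ w).im) z :=
        Complex.continuous_im.continuousAt.comp hd.continuousAt
      have h4 : ContinuousAt (fun w : ℂ => w.im) z := Complex.continuous_im.continuousAt
      exact (h3.mul continuousAt_const).div (h4.mul continuousAt_const) (by positivity)
    exact this.tendsto.mono_left nhdsWithin_le_nhds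
  have h3 : (fun w => ‖slope (act γ) z w‖ ^ 2) =ᶠ[𝓝[≠] z]
      (fun w : ℂ => (act γ w).im * (act γ z).im / (w.im * z.im)) := by
    filter_upwards [self_mem_nhdsWithin,
      nhdsWithin_le_nhds (mem_nhds_upperHalfPlaneSet hz)] with w hwz hw
    have h5 := dist_smul γ ⟨w, hw⟩ ⟨z, hz⟩
    have h6 : Real.sinh (dist (γ • (⟨w, hw⟩ : ℍ)) (γ • (⟨z, hz⟩ : ℍ)) / 2) ^ 2 =
      Real.sinh (dist (⟨w, hw⟩ : ℍ) ⟨z, hz⟩ / 2) ^ 2 := by rw [h5]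
    have hw' : 0 < w.im := hw
    rw [sinh_half_dist, sinh_half_dist, ← act_coe, ← act_coe, div_pow, div_pow, mul_pow, mul_pow,
      Real.sq_sqrt (by positivity), Real.sq_sqrt (by positivity), ← coe_im, ← coe_im, ← coe_im,
      ← coe_im, ← act_coe, ← act_coe, Complex.dist_eq, Complex.dist_eq] at h6
    change ‖act γ w - act γ z‖ ^ 2 / (2 ^ 2 * ((act γ w).im * (act γ z).im)) =
      ‖w - z‖ ^ 2 / (2 ^ 2 * (w.im * z.im)) at h6
    have h7 : 0 < ‖w - z‖ := norm_pos_iff.2 (sub_ne_zero.2 hwz)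
    have h8 := act_im_pos γ w
    have h9 := act_im_pos γ z
    rw [slope_def_field, norm_div, div_pow]
    field_simp at h6 ⊢
    linarith
  have h4 := tendsto_nhds_unique (h1.congr' h3) h2
  rw [← div_mul_div_comm, ← sq] at h4
  exact (sq_eq_sq₀ (norm_nonneg _) (div_nonneg (act_im_pos γ z).le hz.le)).1 h4

end Action

/-- The function `1 / cosh² (d / 2)` of the hyperbolic distance. -/
def kern (z w : ℍ) : ℝ := (Real.cosh (dist z w / 2) ^ 2)⁻¹

lemma kern_pos (z w : ℍ) : 0 < kern z w := by
  have := Real.cosh_pos (dist z w / 2)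
  rw [kern]; positivity

lemma kern_comm (z w : ℍ) : kern z w = kern w z := by rw [kern, kern, dist_comm]

lemma kern_eq (z w : ℍ) : kern z w = 4 * z.im * w.im / ‖(z : ℂ) - conj (w : ℂ)‖ ^ 2 := by
  have h := norm_pos_iff.2 (sub_conj_ne_zero z.im_pos w.im_pos)
  have := z.im_pos
  have := w.im_pos
  rw [kern, cosh_half_dist, div_pow, mul_pow, Real.sq_sqrt (by positivity), Complex.dist_eq]
  field_simp
  ring

lemma kern_smul {Γ : Type*} [Group Γ] [MulAction Γ ℍ] [IsCocompactAction Γ] (γ : Γ) (z w : ℍ) :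
    kern (γ • z) (γ • w) = kern z w := by rw [kern, kern, dist_smul]

lemma kern_le_one (z w : ℍ) : kern z w ≤ 1 := by
  rw [kern]
  exact inv_le_one_of_one_le₀ (one_le_pow₀ (Real.one_le_cosh _))

lemma kern_le_of_le_dist {z w : ℍ} {σ : ℝ} (hσ : 0 ≤ σ) (h : σ ≤ dist z w) :
    kern z w ≤ (Real.cosh (σ / 2) ^ 2)⁻¹ := by
  rw [kern]
  have h1 : Real.cosh (σ / 2) ≤ Real.cosh (dist z w / 2) := by
    rw [Real.cosh_le_cosh, abs_of_nonneg (by positivity), abs_of_nonneg (by positivity)]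
    linarith
  have := Real.cosh_pos (σ / 2)
  gcongr

/-- A Harnack inequality, from cosh(s + t) ≤ eˢ cosh t. It makes the domination of Poincaré series
locally uniform. -/
lemma kern_le_exp_mul (z z' w : ℍ) : kern z w ≤ Real.exp (dist z z') * kern z' w := by
  have h1 : Real.cosh (dist z' w / 2) ≤ Real.exp (dist z z' / 2) * Real.cosh (dist z w / 2) := by
    have h2 : Real.cosh (dist z' w / 2) ≤ Real.cosh (dist z z' / 2 + dist z w / 2) := by
      rw [Real.cosh_le_cosh, abs_of_nonneg (by positivity), abs_of_nonneg (by positivity)]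
      have := dist_triangle_left z' w z
      linarith
    refine h2.trans ?_
    rw [Real.cosh_add, ← Real.cosh_add_sinh]
    have h3 : Real.sinh (dist z w / 2) ≤ Real.cosh (dist z w / 2) := (Real.sinh_lt_cosh _).le
    have h4 : 0 ≤ Real.sinh (dist z z' / 2) := Real.sinh_nonneg_iff.2 (by positivity)
    nlinarith
  have h5 : Real.exp (dist z z') = Real.exp (dist z z' / 2) ^ 2 := by
    rw [← Real.exp_nat_mul]; congr 1; push_cast; ring
  have h6 := Real.cosh_pos (dist z' w / 2)
  have h7 := Real.cosh_pos (dist z w / 2)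
  rw [kern, kern, h5, inv_le_iff_one_le_mul₀ (by positivity)]
  have h8 : Real.cosh (dist z' w / 2) ^ 2 ≤
      (Real.exp (dist z z' / 2) * Real.cosh (dist z w / 2)) ^ 2 := by gcongr
  rw [mul_pow] at h8
  field_simp
  linarith

end

/-! ### Sums over separated sets -/

section

/-- The Cayley transform taking `z` to the centre of the unit disc. -/
def cayley (z x : ℍ) : ℂ := ((x : ℂ) - z) / ((x : ℂ) - conj (z : ℂ))

lemma kern_eq_one_sub (z x : ℍ) : kern z x = 1 - ‖cayley z x‖ ^ 2 := by
  have h := norm_pos_iff.2 (sub_conj_ne_zero x.im_pos z.im_pos)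
  have h1 := normSq_sub_conj_sub_normSq_sub (x : ℂ) (z : ℂ)
  rw [kern_comm, kern_eq, cayley, norm_div, div_pow]
  field_simp
  simp only [coe_im] at h1
  linarith

lemma norm_cayley_sub_sq (z x y : ℍ) :
    ‖cayley z x - cayley z y‖ ^ 2 = Real.sinh (dist x y / 2) ^ 2 * (kern z x * kern z y) := by
  have h1 := sub_conj_ne_zero x.im_pos z.im_pos
  have h2 := sub_conj_ne_zero y.im_pos z.im_pos
  have h3 : cayley z x - cayley z y = ((x : ℂ) - y) * ((z : ℂ) - conj (z : ℂ)) /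
      (((x : ℂ) - conj (z : ℂ)) * ((y : ℂ) - conj (z : ℂ))) := by
    rw [cayley, cayley]; field_simp; ring
  have h4 : ‖(z : ℂ) - conj (z : ℂ)‖ = 2 * z.im := by
    rw [Complex.sub_conj]; simp [abs_of_pos z.im_pos]
  have h1' := norm_pos_iff.2 h1
  have h2' := norm_pos_iff.2 h2
  have := x.im_pos
  have := y.im_pos
  rw [h3, norm_div, norm_mul, norm_mul, h4, sinh_half_dist, kern_comm z x, kern_comm z y, kern_eq,
    kern_eq, div_pow, div_pow, mul_pow, mul_pow, mul_pow, mul_pow, Real.sq_sqrt (by positivity),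
    Complex.dist_eq]
  field_simp
  ring

/-- A bound for the sum of the squares of `kern z` over a `σ`-separated set. -/
def sepConst (σ : ℝ) : ℝ := 16 * (1 + (Real.sinh (σ / 2) ^ 2)⁻¹)

lemma sepConst_pos (σ : ℝ) : 0 < sepConst σ := by rw [sepConst]; positivity

/-- A packing argument in the disc model centred at `z`, where `kern z` is 1 - |ζ|²: Euclidean discs
about the images of the points, with radii proportional to `kern`, are disjoint and lie in the disc
of radius 2. Comparing areas gives 4 / c² = `sepConst σ`. -/
theorem sum_kern_sq_le {ι : Type*} {x : ι → ℍ} {σ : ℝ} (hσ : 0 < σ)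
    (hx : ∀ i j, i ≠ j → σ ≤ dist (x i) (x j)) (z : ℍ) (s : Finset ι) :
    ∑ i ∈ s, kern z (x i) ^ 2 ≤ sepConst σ := by
  set S := Real.sinh (σ / 2) with hS
  have hS0 : 0 < S := Real.sinh_pos_iff.2 (by positivity)
  set c : ℝ := (2 * √(1 + (S ^ 2)⁻¹))⁻¹ with hc
  have hsq : √(1 + (S ^ 2)⁻¹) ^ 2 = 1 + (S ^ 2)⁻¹ := Real.sq_sqrt (by positivity)
  have hsq0 : 1 ≤ √(1 + (S ^ 2)⁻¹) := by
    rw [Real.one_le_sqrt]; linarith [inv_pos.2 (pow_pos hS0 2)]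
  have hc0 : 0 < c := by positivity
  have hc1 : c ≤ 1 := inv_le_one_of_one_le₀ (by linarith)
  -- For the values k, k' of `kern` at two of the points, (k + k')² = (k - k')² + 4kk'. The first
  -- term is at most 4D² because 1 - |ζ|² is 2-Lipschitz on the disc, the second at most 4D²/S² by
  -- separation; `c` is chosen to match.
  have hdisj : ∀ i j, i ≠ j → c * kern z (x i) + c * kern z (x j) ≤
      dist (cayley z (x i)) (cayley z (x j)) := by
    intro i j hij
    rw [Complex.dist_eq]
    set D := ‖cayley z (x i) - cayley z (x j)‖ with hD
    have hki := kern_pos z (x i)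
    have hkj := kern_pos z (x j)
    have h1 : S ^ 2 * (kern z (x i) * kern z (x j)) ≤ D ^ 2 := by
      rw [hD, norm_cayley_sub_sq]
      have : S ≤ Real.sinh (dist (x i) (x j) / 2) :=
        Real.sinh_le_sinh.2 (by linarith [hx i j hij])
      gcongr
    have h2 : (kern z (x i) - kern z (x j)) ^ 2 ≤ 4 * D ^ 2 := by
      have ni : ‖cayley z (x i)‖ ≤ 1 := by
        have := kern_eq_one_sub z (x i)
        nlinarith [norm_nonneg (cayley z (x i))]
      have nj : ‖cayley z (x j)‖ ≤ 1 := by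
        have := kern_eq_one_sub z (x j)
        nlinarith [norm_nonneg (cayley z (x j))]
      have h3 : |‖cayley z (x i)‖ - ‖cayley z (x j)‖| ≤ D := abs_norm_sub_norm_le _ _
      have h3' := sq_le_sq' (abs_le.1 h3).1 (abs_le.1 h3).2
      have h4 : kern z (x i) - kern z (x j) = -((‖cayley z (x i)‖ - ‖cayley z (x j)‖) *
          (‖cayley z (x i)‖ + ‖cayley z (x j)‖)) := by
        rw [kern_eq_one_sub, kern_eq_one_sub]; ring
      rw [h4, neg_sq, mul_pow, mul_comm]
      have h5 : (‖cayley z (x i)‖ + ‖cayley z (x j)‖) ^ 2 ≤ 4 := by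
        nlinarith [norm_nonneg (cayley z (x i)), norm_nonneg (cayley z (x j))]
      gcongr
    have h6 : (kern z (x i) + kern z (x j)) ^ 2 ≤ (2 * √(1 + (S ^ 2)⁻¹) * D) ^ 2 := by
      rw [mul_pow, mul_pow, hsq]
      have h7 : kern z (x i) * kern z (x j) ≤ (S ^ 2)⁻¹ * D ^ 2 := by
        rw [inv_mul_eq_div, le_div_iff₀ (by positivity)]; linarith
      nlinarith
    have h8 := (sq_le_sq₀ (by positivity) (by positivity)).1 h6
    rw [← mul_add, hc, inv_mul_le_iff₀ (by positivity)]
    exact h8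
  have hpd : (s : Set ι).PairwiseDisjoint fun i => ball (cayley z (x i)) (c * kern z (x i)) :=
    fun i _ j _ hij => ball_disjoint_ball (hdisj i j hij)
  have hsub : (⋃ i ∈ s, ball (cayley z (x i)) (c * kern z (x i))) ⊆ ball (0 : ℂ) 2 := by
    refine iUnion₂_subset fun i _ => ball_subset_ball' ?_
    rw [dist_zero_right]
    have h1 := kern_eq_one_sub z (x i)
    have h2 : c * kern z (x i) ≤ 1 := mul_le_one₀ hc1 (kern_pos _ _).le (kern_le_one _ _)
    nlinarith [kern_pos z (x i), norm_nonneg (cayley z (x i))]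
  have hvol := MeasureTheory.measure_mono (μ := MeasureTheory.volume) hsub
  rw [MeasureTheory.measure_biUnion_finset hpd fun i _ => measurableSet_ball] at hvol
  simp only [Complex.volume_ball] at hvol
  rw [← Finset.sum_mul] at hvol
  have hpi : (NNReal.pi : ℝ≥0∞) ≠ 0 := by
    simpa using NNReal.pi_ne_zero
  have hvol2 := (ENNReal.mul_le_mul_iff_left hpi ENNReal.coe_ne_top).1 hvol
  have hvol3 : ∑ i ∈ s, (c * kern z (x i)) ^ 2 ≤ 2 ^ 2 := by
    rw [← ENNReal.ofReal_le_ofReal_iff (by positivity),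
      ENNReal.ofReal_sum_of_nonneg fun i _ => by positivity]
    simp only [ENNReal.ofReal_pow (mul_nonneg hc0.le (kern_pos z _).le)]
    rw [ENNReal.ofReal_pow (by positivity)]
    exact hvol2
  simp only [mul_pow] at hvol3
  rw [← Finset.mul_sum, hc, inv_pow, inv_mul_le_iff₀ (by positivity), mul_pow, hsq] at hvol3
  rw [sepConst]
  linarith

theorem summable_kern_sq {ι : Type*} {x : ι → ℍ} {σ : ℝ} (hσ : 0 < σ)
    (hx : ∀ i j, i ≠ j → σ ≤ dist (x i) (x j)) (z : ℍ) :
    Summable fun i => kern z (x i) ^ 2 :=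
  summable_of_sum_le (fun _ => sq_nonneg _) (sum_kern_sq_le hσ hx z)

end

/-! ### Automorphic forms and Poincaré series -/

section

section Series

variable {ι : Type*} {F : ι → ℂ → ℂ} {V : Set ℂ} {u : ι → ℝ}

lemma _root_.TendstoLocallyUniformlyOn.iteratedDeriv {f : ℂ → ℂ} {G : ι → ℂ → ℂ} {p : Filter ι}
    (h : TendstoLocallyUniformlyOn G f p V) (hG : ∀ i, DifferentiableOn ℂ (G i) V)
    (hV : IsOpen V) (l : ℕ) :
    TendstoLocallyUniformlyOn (fun i => iteratedDeriv l (G i)) (iteratedDeriv l f) p V ∧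
      ∀ i, DifferentiableOn ℂ (iteratedDeriv l (G i)) V := by
  induction l with
  | zero => simpa using ⟨h, hG⟩
  | succ l ih =>
    simp only [iteratedDeriv_succ]
    exact ⟨ih.1.deriv (Eventually.of_forall ih.2) hV, fun i => (ih.2 i).deriv hV⟩

lemma hasSum_iteratedDeriv (hu : Summable u) (hF : ∀ i, DifferentiableOn ℂ (F i) V)
    (hV : IsOpen V) (hle : ∀ i, ∀ w ∈ V, ‖F i w‖ ≤ u i) (l : ℕ) {z : ℂ} (hz : z ∈ V) :
    HasSum (fun i => iteratedDeriv l (F i) z) (iteratedDeriv l (fun w => ∑' i, F i w) z) := by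
  have h := (tendstoUniformlyOn_tsum hu hle).tendstoLocallyUniformlyOn
  have h2 := (h.iteratedDeriv (fun s => DifferentiableOn.fun_sum fun i _ => hF i) hV l).1.tendsto_at
    hz
  refine h2.congr fun s => ?_
  rw [iteratedDeriv_fun_sum]
  exact fun i _ => ((hF i).analyticAt (hV.mem_nhds hz)).contDiffAt

end Series

variable {Γ : Type*} [Group Γ] [MulAction Γ ℍ]

/-- The action of weight `k` (that is, on sections of the `k`-th power of the canonical bundle). -/
def slash (k : ℕ) (γ : Γ) (f : ℂ → ℂ) (z : ℂ) : ℂ := f (act γ z) * jac γ z ^ k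

variable (Γ) in
/-- `f` is a holomorphic `k`-differential for `Γ`; the values outside the upper half-plane are
normalized to `0`. -/
structure IsForm (k : ℕ) (f : ℂ → ℂ) : Prop where
  differentiableOn : DifferentiableOn ℂ f upperHalfPlaneSet
  eq_zero : ∀ z, ¬ 0 < z.im → f z = 0
  slash_eq : ∀ γ : Γ, ∀ z, 0 < z.im → slash k γ f z = f z

variable (Γ) in
/-- The space of holomorphic `k`-differentials for `Γ`. -/
def Form (k : ℕ) : Submodule ℂ (ℂ → ℂ) where
  carrier := {f | IsForm Γ k f}
  add_mem' := by
    rintro f g ⟨h1, h2, h3⟩ ⟨k1, k2, k3⟩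
    refine ⟨h1.add k1, fun z hz => by simp [h2 z hz, k2 z hz], fun γ z hz => ?_⟩
    rw [Pi.add_apply, ← h3 γ z hz, ← k3 γ z hz]
    simp [slash, add_mul]
  zero_mem' := ⟨differentiableOn_const 0, fun _ _ => rfl, fun γ z hz => by simp [slash]⟩
  smul_mem' := by
    rintro c f ⟨h1, h2, h3⟩
    refine ⟨h1.const_smul c, fun z hz => by simp [h2 z hz], fun γ z hz => ?_⟩
    rw [Pi.smul_apply, ← h3 γ z hz]
    simp [slash, mul_assoc]

lemma analyticAt_of_differentiableOn {f : ℂ → ℂ} (hf : DifferentiableOn ℂ f upperHalfPlaneSet)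
    {z : ℂ} (hz : 0 < z.im) : AnalyticAt ℂ f z :=
  hf.analyticAt (mem_nhds_upperHalfPlaneSet hz)

lemma IsForm.analyticAt {k : ℕ} {f : ℂ → ℂ} (hf : IsForm Γ k f) {z : ℂ} (hz : 0 < z.im) :
    AnalyticAt ℂ f z := analyticAt_of_differentiableOn hf.1 hz

lemma slash_one (k : ℕ) (f : ℂ → ℂ) {z : ℂ} (hz : 0 < z.im) : slash k (1 : Γ) f z = f z := by
  rw [slash, act_one hz, jac_one hz, one_pow, mul_one]

variable (Γ) in
/-- The Poincaré series of weight `k` of the function `f`. -/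
def poincare (k : ℕ) (f : ℂ → ℂ) (z : ℂ) : ℂ := if 0 < z.im then ∑' γ : Γ, slash k γ f z else 0

lemma poincare_eventuallyEq (k : ℕ) (f : ℂ → ℂ) {z : ℂ} (hz : 0 < z.im) :
    poincare Γ k f =ᶠ[𝓝 z] fun z => ∑' γ : Γ, slash k γ f z := by
  filter_upwards [mem_nhds_upperHalfPlaneSet hz] with w hw
  exact if_pos hw

variable [IsCocompactAction Γ]

lemma differentiableOn_slash {k : ℕ} (γ : Γ) {f : ℂ → ℂ}
    (hf : DifferentiableOn ℂ f upperHalfPlaneSet) :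
    DifferentiableOn ℂ (slash k γ f) upperHalfPlaneSet :=
  (hf.comp (IsCocompactAction.differentiableOn_act γ) fun z _ => act_im_pos γ z).mul
    ((differentiableOn_jac γ).pow k)

lemma slash_slash (k : ℕ) (γ δ : Γ) (f : ℂ → ℂ) {z : ℂ} (hz : 0 < z.im) :
    slash k δ (slash k γ f) z = slash k (γ * δ) f z := by
  rw [slash, slash, slash, act_mul, jac_mul γ δ hz, mul_pow, mul_assoc]

lemma norm_slash (k : ℕ) (γ : Γ) (f : ℂ → ℂ) (z : ℍ) :
    ‖slash k γ f z‖ = ‖f ↑(γ • z)‖ * (γ • z).im ^ k / z.im ^ k := by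
  rw [slash, norm_mul, norm_pow, norm_jac γ z.im_pos, act_coe, div_pow, coe_im, coe_im,
    mul_div_assoc]

lemma IsForm.norm_smul {k : ℕ} {f : ℂ → ℂ} (hf : IsForm Γ k f) (γ : Γ) (z : ℍ) :
    ‖f ↑(γ • z)‖ * (γ • z).im ^ k = ‖f z‖ * z.im ^ k := by
  rw [← hf.3 γ z z.im_pos, norm_slash, div_mul_cancel₀ _ (pow_pos z.im_pos k).ne']

lemma exists_le_dist_orbit : ∃ σ : ℝ, 0 < σ ∧ ∀ z : ℍ, ∀ γ δ : Γ, γ ≠ δ →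
    σ ≤ dist (γ⁻¹ • z) (δ⁻¹ • z) := by
  obtain ⟨σ, hσ, h⟩ := IsCocompactAction.exists_le_dist (Γ := Γ)
  refine ⟨σ, hσ, fun z γ δ hne => ?_⟩
  rw [← dist_smul δ, smul_inv_smul, smul_smul]
  exact h _ (fun h1 => hne (mul_inv_eq_one.1 h1).symm) z

lemma summable_kern_orbit (z w : ℍ) : Summable fun γ : Γ => kern z (γ⁻¹ • w) ^ 2 := by
  obtain ⟨σ, hσ, h⟩ := exists_le_dist_orbit (Γ := Γ)
  exact summable_kern_sq hσ (h w) z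

/-- The function `f` is small enough for its Poincaré series of weight `k` to converge. -/
def IsDominated (k : ℕ) (f : ℂ → ℂ) : Prop :=
  ∃ (w : ℍ) (C : ℝ), ∀ z : ℍ, ‖f z‖ * z.im ^ k ≤ C * kern z w ^ 2

/-- On the unit ball about `z` the term of γ is at most a constant times `kern z (γ⁻¹ • x) ^ 2`, by
the Harnack inequality; these are summable because the orbit of `x` is separated. -/
lemma IsDominated.exists_summable {k : ℕ} {f : ℂ → ℂ} (h : IsDominated k f) (z : ℍ) :
    ∃ V : Set ℂ, IsOpen V ∧ (z : ℂ) ∈ V ∧ V ⊆ upperHalfPlaneSet ∧ ∃ u : Γ → ℝ, Summable u ∧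
      ∀ γ, ∀ w ∈ V, ‖slash k γ f w‖ ≤ u γ := by
  obtain ⟨x, C, hC⟩ := h
  refine ⟨(↑) '' ball z 1, isOpenEmbedding_coe.isOpenMap _ isOpen_ball, ⟨z, by simp, rfl⟩, ?_,
    fun γ => |C| * (Real.exp 1 ^ 2 * kern z (γ⁻¹ • x) ^ 2) * (Real.exp 1 / z.im) ^ k, ?_, ?_⟩
  · rintro _ ⟨w, _, rfl⟩
    exact w.im_pos
  · exact (((summable_kern_orbit z x).mul_left _).mul_left _).mul_right _
  · rintro γ _ ⟨w, hw, rfl⟩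
    rw [mem_ball] at hw
    have h1 := hC (γ • w)
    have h2 : kern (γ • w) x ≤ Real.exp 1 * kern z (γ⁻¹ • x) := by
      have := kern_le_exp_mul (γ • w) (γ • z) x
      rw [dist_smul] at this
      refine this.trans ?_
      rw [← kern_smul γ z, smul_inv_smul]
      have := kern_pos (γ • z) x
      gcongr
    have h3 : z.im ≤ w.im * Real.exp 1 := by
      refine (im_le_im_mul_exp_dist z w).trans ?_
      have := w.im_pos
      rw [dist_comm]
      gcongr
    have h4 : (w.im ^ k)⁻¹ ≤ (Real.exp 1 / z.im) ^ k := by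
      rw [← inv_pow]
      have := w.im_pos
      have := z.im_pos
      gcongr
      rw [inv_le_iff_one_le_mul₀ (by positivity)]
      field_simp
      linarith
    rw [norm_slash, div_eq_mul_inv]
    have h5 := kern_pos (γ • w) x
    have h6 : C * kern (γ • w) x ^ 2 ≤ |C| * (Real.exp 1 ^ 2 * kern z (γ⁻¹ • x) ^ 2) := by
      rw [← mul_pow]
      have := le_abs_self C
      gcongr
    have := (pow_pos w.im_pos k)
    exact mul_le_mul (h1.trans h6) h4 (by positivity) (by positivity)

lemma IsDominated.summable {k : ℕ} {f : ℂ → ℂ} (h : IsDominated k f) {z : ℂ} (hz : 0 < z.im) :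
    Summable fun γ : Γ => ‖slash k γ f z‖ := by
  obtain ⟨V, -, hzV, -, u, hu, hle⟩ := h.exists_summable (Γ := Γ) ⟨z, hz⟩
  exact hu.of_nonneg_of_le (fun _ => norm_nonneg _) fun γ => hle γ z hzV

theorem poincare_mem {k : ℕ} {f : ℂ → ℂ} (hf : DifferentiableOn ℂ f upperHalfPlaneSet)
    (h : IsDominated k f) : IsForm Γ k (poincare Γ k f) := by
  refine ⟨fun z hz => ?_, fun z hz => if_neg hz, fun γ z hz => ?_⟩
  · obtain ⟨V, hV, hzV, hVU, u, hu, hle⟩ := h.exists_summable (Γ := Γ) ⟨z, hz⟩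
    have h1 := Complex.differentiableOn_tsum_of_summable_norm hu
      (fun γ => (differentiableOn_slash γ hf).mono hVU) hV hle
    exact ((h1.differentiableAt (hV.mem_nhds hzV)).congr_of_eventuallyEq
      (poincare_eventuallyEq k f hz)).differentiableWithinAt
  · rw [slash, poincare, if_pos (act_im_pos γ z), ← tsum_mul_right, poincare, if_pos hz,
      ← (Equiv.mulRight γ).tsum_eq fun δ => slash k δ f z]
    refine tsum_congr fun δ => ?_
    rw [Equiv.coe_mulRight, ← slash_slash k δ γ f hz]
    rfl

theorem hasSum_iteratedDeriv_poincare {k : ℕ} {f : ℂ → ℂ}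
    (hf : DifferentiableOn ℂ f upperHalfPlaneSet) (h : IsDominated k f) (l : ℕ) {z : ℂ}
    (hz : 0 < z.im) :
    HasSum (fun γ : Γ => iteratedDeriv l (slash k γ f) z) (iteratedDeriv l (poincare Γ k f) z) := by
  obtain ⟨V, hV, hzV, hVU, u, hu, hle⟩ := h.exists_summable (Γ := Γ) ⟨z, hz⟩
  rw [(poincare_eventuallyEq k f hz).iteratedDeriv_eq]
  exact hasSum_iteratedDeriv hu (fun γ => (differentiableOn_slash γ hf).mono hVU) hV hle l hzV

end

/-! ### Local divisibility of holomorphic functions -/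

section

/-- Near `z`, the function `f` is the product of `F` and an analytic function. -/
def LocDvd (F f : ℂ → ℂ) (z : ℂ) : Prop := ∃ q, AnalyticAt ℂ q z ∧ f =ᶠ[𝓝 z] F * q

lemma locDvd_of_analyticOrderAt_le {F f : ℂ → ℂ} {z : ℂ} (hF : AnalyticAt ℂ F z)
    (hf : AnalyticAt ℂ f z) (htop : analyticOrderAt F z ≠ ⊤)
    (hle : analyticOrderAt F z ≤ analyticOrderAt f z) : LocDvd F f z := by
  obtain ⟨g, hg, hg0, hgF⟩ := hF.analyticOrderAt_ne_top.1 htop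
  rw [← Nat.cast_analyticOrderNatAt htop, natCast_le_analyticOrderAt hf] at hle
  obtain ⟨h, hh, hhf⟩ := hle
  refine ⟨h / g, hh.div hg hg0, ?_⟩
  filter_upwards [hgF, hhf, hg.continuousAt.eventually_ne hg0] with w h1 h2 h3
  rw [h2, Pi.mul_apply, Pi.div_apply, h1]
  simp only [smul_eq_mul]
  field_simp

lemma locDvd_of_ne_zero {F f : ℂ → ℂ} {z : ℂ} (hF : AnalyticAt ℂ F z)
    (hf : AnalyticAt ℂ f z) (h : F z ≠ 0) : LocDvd F f z :=
  ⟨f / F, hf.div hF h, by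
    filter_upwards [hF.continuousAt.eventually_ne h] with w hw
    simp [mul_div_cancel₀ _ hw]⟩

lemma LocDvd.add {F f g : ℂ → ℂ} {z : ℂ} (hf : LocDvd F f z) (hg : LocDvd F g z) :
    LocDvd F (f + g) z := by
  obtain ⟨p, hp, hpf⟩ := hf
  obtain ⟨q, hq, hqg⟩ := hg
  exact ⟨p + q, hp.add hq, by rw [mul_add]; exact hpf.add hqg⟩

lemma LocDvd.sub {F f g : ℂ → ℂ} {z : ℂ} (hf : LocDvd F f z) (hg : LocDvd F g z) :
    LocDvd F (f - g) z := by
  obtain ⟨p, hp, hpf⟩ := hf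
  obtain ⟨q, hq, hqg⟩ := hg
  exact ⟨p - q, hp.sub hq, by rw [mul_sub]; exact hpf.sub hqg⟩

lemma LocDvd.sum {ι : Type*} {F : ℂ → ℂ} {f : ι → ℂ → ℂ} {z : ℂ} {s : Finset ι}
    (h : ∀ i ∈ s, LocDvd F (f i) z) : LocDvd F (∑ i ∈ s, f i) z := by
  classical
  induction s using Finset.induction_on with
  | empty => exact ⟨0, analyticAt_const, by simp⟩
  | insert i s hi ih =>
    rw [Finset.sum_insert hi]
    exact (h i (Finset.mem_insert_self _ _)).add
      (ih fun j hj => h j (Finset.mem_insert_of_mem hj))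

lemma LocDvd.congr {F f g : ℂ → ℂ} {z : ℂ} (hf : LocDvd F f z) (h : f =ᶠ[𝓝 z] g) :
    LocDvd F g z := by
  obtain ⟨p, hp, hpf⟩ := hf
  exact ⟨p, hp, h.symm.trans hpf⟩

/-- Zeros of `F` are isolated, so two local quotients agree near each common point by the identity
theorem. The choices `p z` hence glue to the function z ↦ `p z z`. -/
theorem exists_eq_mul_of_locDvd {F f : ℂ → ℂ} {V : Set ℂ} (hV : IsOpen V)
    (hF : DifferentiableOn ℂ F V) (htop : ∀ z ∈ V, analyticOrderAt F z ≠ ⊤)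
    (h : ∀ z ∈ V, LocDvd F f z) :
    ∃ q, DifferentiableOn ℂ q V ∧ (∀ z ∉ V, q z = 0) ∧ ∀ z ∈ V, f z = F z * q z := by
  classical
  choose! p hp hpf using h
  refine ⟨fun z => if z ∈ V then p z z else 0, fun z hz => ?_, fun z hz => if_neg hz,
    fun z hz => ?_⟩
  · have key : (fun z => if z ∈ V then p z z else 0) =ᶠ[𝓝 z] p z := by
      filter_upwards [(hp z hz).eventually_analyticAt, (hpf z hz).eventually_nhds,
        hV.mem_nhds hz] with w h1 h2 hw
      rw [if_pos hw]
      have h3 : ∃ᶠ x in 𝓝[≠] w, p w x = p z x := by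
        have h4 : ∀ᶠ x in 𝓝[≠] w, F x ≠ 0 := by
          have hFw := hF.analyticAt (hV.mem_nhds hw)
          refine hFw.eventually_eq_zero_or_eventually_ne_zero.resolve_left fun h5 => htop w hw ?_
          exact analyticOrderAt_eq_top.2 h5
        refine Eventually.frequently ?_
        filter_upwards [h4, nhdsWithin_le_nhds h2, nhdsWithin_le_nhds (hpf w hw)] with x h5 h6 h7
        rw [h6, Pi.mul_apply, Pi.mul_apply] at h7
        exact (mul_left_cancel₀ h5 h7).symm
      exact (((hp w hw).frequently_eq_iff_eventually_eq h1).1 h3).self_of_nhds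
    exact ((hp z hz).differentiableAt.congr_of_eventuallyEq key).differentiableWithinAt
  · simp only [if_pos hz]
    exact (hpf z hz).self_of_nhds

/-! ### Wronskians -/

/-- The Wronskian `g' φ - g φ'`. -/
def wronskian (g φ : ℂ → ℂ) (z : ℂ) : ℂ := deriv g z * φ z - g z * deriv φ z

lemma wronskian_add {g₁ g₂ φ : ℂ → ℂ} {z : ℂ} (h₁ : DifferentiableAt ℂ g₁ z)
    (h₂ : DifferentiableAt ℂ g₂ z) :
    wronskian (g₁ + g₂) φ z = wronskian g₁ φ z + wronskian g₂ φ z := by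
  rw [wronskian, deriv_add h₁ h₂, wronskian, wronskian, Pi.add_apply]; ring

lemma wronskian_sub {g₁ g₂ φ : ℂ → ℂ} {z : ℂ} (h₁ : DifferentiableAt ℂ g₁ z)
    (h₂ : DifferentiableAt ℂ g₂ z) :
    wronskian (g₁ - g₂) φ z = wronskian g₁ φ z - wronskian g₂ φ z := by
  rw [wronskian, deriv_sub h₁ h₂, wronskian, wronskian, Pi.sub_apply]; ring

lemma wronskian_smul (c : ℂ) (g φ : ℂ → ℂ) (z : ℂ) :
    wronskian (c • g) φ z = c * wronskian g φ z := by
  rw [wronskian, deriv_const_smul_field, wronskian]; simp; ring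

lemma wronskian_sum {ι : Type*} {s : Finset ι} {g : ι → ℂ → ℂ} {φ : ℂ → ℂ} {z : ℂ}
    (h : ∀ i ∈ s, DifferentiableAt ℂ (g i) z) :
    wronskian (∑ i ∈ s, g i) φ z = ∑ i ∈ s, wronskian (g i) φ z := by
  rw [wronskian, deriv_sum h, Finset.sum_apply, Finset.sum_mul, Finset.sum_mul,
    ← Finset.sum_sub_distrib]
  rfl

lemma wronskian_self (φ : ℂ → ℂ) (z : ℂ) : wronskian φ φ z = 0 := by
  rw [wronskian]; ring

lemma wronskian_mul_self {R φ : ℂ → ℂ} {z : ℂ} (hφ : DifferentiableAt ℂ φ z)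
    (hR : DifferentiableAt ℂ R z) : wronskian (φ * R) φ z = φ z ^ 2 * deriv R z := by
  rw [wronskian, deriv_mul hφ hR, Pi.mul_apply]; ring

lemma wronskian_congr {g₁ g₂ φ₁ φ₂ : ℂ → ℂ} {z : ℂ} (hg : g₁ =ᶠ[𝓝 z] g₂) (hφ : φ₁ =ᶠ[𝓝 z] φ₂) :
    wronskian g₁ φ₁ z = wronskian g₂ φ₂ z := by
  rw [wronskian, wronskian, hg.deriv_eq, hφ.deriv_eq, hg.self_of_nhds, hφ.self_of_nhds]

/-- The Wronskian is φ² (g/φ)'. It stands for the derivative of the meromorphic function g/φ while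
only holomorphic functions are handled. -/
lemma LocDvd.wronskian {g φ : ℂ → ℂ} {z : ℂ} (hφ : AnalyticAt ℂ φ z) (h : LocDvd φ g z) :
    LocDvd (φ ^ 2) (wronskian g φ) z := by
  obtain ⟨q, hq, hgq⟩ := h
  refine ⟨deriv q, hq.deriv, ?_⟩
  filter_upwards [hgq.eventually_nhds, hq.eventually_analyticAt, hφ.eventually_analyticAt]
    with w h1 h2 h3
  rw [wronskian_congr h1 EventuallyEq.rfl,
    wronskian_mul_self h3.differentiableAt h2.differentiableAt]
  rfl

theorem eq_const_mul_of_wronskian_eq_zero {g φ : ℂ → ℂ} {V : Set ℂ} (hV : IsOpen V)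
    (hc : IsPreconnected V) (hg : DifferentiableOn ℂ g V) (hφ : DifferentiableOn ℂ φ V)
    (h : ∀ z ∈ V, wronskian g φ z = 0) {b : ℂ} (hb : b ∈ V) (hb0 : φ b ≠ 0) :
    ∀ z ∈ V, g z = g b / φ b * φ z := by
  have hφb := hφ.differentiableAt (hV.mem_nhds hb)
  obtain ⟨r, hr, hball⟩ : ∃ r > 0, ball b r ⊆ V ∩ {z | φ z ≠ 0} := by
    rw [← Metric.mem_nhds_iff]
    exact inter_mem (hV.mem_nhds hb) (hφb.continuousAt.eventually_ne hb0)
  have h1 : DifferentiableOn ℂ (fun z => g z / φ z) (ball b r) :=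
    (hg.mono fun z hz => (hball hz).1).div (hφ.mono fun z hz => (hball hz).1)
      fun z hz => (hball hz).2
  have h2 : (ball b r).EqOn (deriv fun z => g z / φ z) 0 := by
    intro z hz
    have hzV := (hball hz).1
    have := h z hzV
    rw [deriv_fun_div (hg.differentiableAt (hV.mem_nhds hzV))
      (hφ.differentiableAt (hV.mem_nhds hzV)) (hball hz).2]
    rw [wronskian] at this
    rw [this, zero_div]
    rfl
  have h3 : g =ᶠ[𝓝 b] fun z => g b / φ b * φ z := by
    filter_upwards [ball_mem_nhds b hr] with z hz
    have := isOpen_ball.is_const_of_deriv_eq_zero (convex_ball b r).isPreconnected h1 h2 hz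
      (mem_ball_self hr)
    rw [← this, div_mul_cancel₀ _ (hball hz).2]
  exact (hg.analyticOnNhd hV).eqOn_of_preconnected_of_eventuallyEq
    ((hφ.const_mul _).analyticOnNhd hV) hc hb h3

/-! ### Zeros of forms -/

lemma isPreconnected_upperHalfPlaneSet : IsPreconnected upperHalfPlaneSet :=
  (convex_halfSpace_im_gt 0).isPreconnected

variable {Γ : Type*} [Group Γ] [MulAction Γ ℍ]

lemma IsForm.analyticOrderAt_ne_top {k : ℕ} {f : ℂ → ℂ} (hf : IsForm Γ k f) (h0 : f ≠ 0) {z : ℂ}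
    (hz : 0 < z.im) : analyticOrderAt f z ≠ ⊤ := by
  intro h
  refine h0 (funext fun w => ?_)
  by_cases hw : 0 < w.im
  · exact
      (hf.1.analyticOnNhd isOpen_upperHalfPlaneSet).eqOn_zero_of_preconnected_of_eventuallyEq_zero
      isPreconnected_upperHalfPlaneSet hz (analyticOrderAt_eq_top.1 h) hw
  · exact hf.2 w hw

lemma IsForm.mul {a j : ℕ} {f g : ℂ → ℂ} (hf : IsForm Γ a f) (hg : IsForm Γ j g) :
    IsForm Γ (a + j) (f * g) := by
  refine ⟨hf.1.mul hg.1, fun z hz => by simp [hf.2 z hz], fun γ z hz => ?_⟩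
  rw [Pi.mul_apply, ← hf.3 γ z hz, ← hg.3 γ z hz]
  simp only [slash, Pi.mul_apply]
  ring

lemma IsForm.slash_eventuallyEq {k : ℕ} {f : ℂ → ℂ} (hf : IsForm Γ k f) (γ : Γ) {z : ℂ}
    (hz : 0 < z.im) : slash k γ f =ᶠ[𝓝 z] f := by
  filter_upwards [mem_nhds_upperHalfPlaneSet hz] with w hw using hf.3 γ w hw

variable [IsCocompactAction Γ]

lemma analyticOrderAt_slash (k : ℕ) (γ : Γ) {f : ℂ → ℂ} {z : ℂ} (hz : 0 < z.im)
    (hf : AnalyticAt ℂ f (act γ z)) :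
    analyticOrderAt (slash k γ f) z = analyticOrderAt f (act γ z) := by
  have hγ := analyticAt_of_differentiableOn (IsCocompactAction.differentiableOn_act γ) hz
  have hj := (analyticAt_of_differentiableOn (differentiableOn_jac γ) hz).pow k
  have h1 : slash k γ f = (f ∘ act γ) * jac γ ^ k := rfl
  rw [h1, analyticOrderAt_mul (hf.comp hγ) hj,
    analyticOrderAt_comp_of_deriv_ne_zero hγ (jac_ne_zero γ hz),
    hj.analyticOrderAt_eq_zero.2 (pow_ne_zero k (jac_ne_zero γ hz)), add_zero]

lemma IsForm.analyticOrderAt_act {k : ℕ} {f : ℂ → ℂ} (hf : IsForm Γ k f) (γ : Γ) {z : ℂ}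
    (hz : 0 < z.im) : analyticOrderAt f (act γ z) = analyticOrderAt f z := by
  rw [← analyticOrderAt_slash k γ hz (hf.analyticAt (act_im_pos γ z)),
    analyticOrderAt_congr (hf.slash_eventuallyEq γ hz)]

/-- The transformation law of `q` follows by cancelling `f` away from its isolated zeros, and
extends across them by the identity theorem. -/
lemma IsForm.of_mul {a j : ℕ} {f q : ℂ → ℂ} (hf : IsForm Γ a f) (h0 : f ≠ 0)
    (hq : DifferentiableOn ℂ q upperHalfPlaneSet) (hq0 : ∀ z, ¬ 0 < z.im → q z = 0)
    (h : IsForm Γ (a + j) (f * q)) : IsForm Γ j q := by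
  refine ⟨hq, hq0, fun γ z hz => ?_⟩
  have h1 : ∀ w, 0 < w.im → f w * slash j γ q w = f w * q w := by
    intro w hw
    have h2 := h.3 γ w hw
    have h3 := hf.3 γ w hw
    rw [Pi.mul_apply, slash, Pi.mul_apply, pow_add] at h2
    rw [← h2, ← h3, slash, slash]
    ring
  have h2 : ∀ᶠ w in 𝓝[≠] z, f w ≠ 0 :=
    (hf.analyticAt hz).eventually_eq_zero_or_eventually_ne_zero.resolve_left fun h5 =>
      hf.analyticOrderAt_ne_top h0 hz (analyticOrderAt_eq_top.2 h5)
  have h3 : ∀ᶠ w in 𝓝[≠] z, slash j γ q w = q w := by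
    filter_upwards [h2, nhdsWithin_le_nhds (mem_nhds_upperHalfPlaneSet hz)] with w hw hw2
    exact mul_left_cancel₀ hw (h1 w hw2)
  exact (((analyticAt_of_differentiableOn (differentiableOn_slash γ hq) hz
    ).frequently_eq_iff_eventually_eq (analyticAt_of_differentiableOn hq hz)).1
      h3.frequently).self_of_nhds

/-- The function |f| Imᵏ is Γ-invariant, and every orbit meets a fixed compact set, so its maximum
is attained. -/
lemma IsForm.bounded {k : ℕ} {f : ℂ → ℂ} (hf : IsForm Γ k f) :
    ∃ w : ℍ, ∀ z : ℍ, ‖f z‖ * z.im ^ k ≤ ‖f w‖ * w.im ^ k := by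
  obtain ⟨K, hK, hKΓ⟩ := IsCocompactAction.exists_isCompact (Γ := Γ)
  have hne : K.Nonempty := ⟨_, (hKΓ I).choose_spec⟩
  have hc : Continuous fun z : ℍ => ‖f z‖ * z.im ^ k := by
    refine Continuous.mul ?_ (continuous_im.pow k)
    exact (hf.1.continuousOn.comp_continuous continuous_coe fun z => z.im_pos).norm
  obtain ⟨w, -, hw⟩ := hK.exists_isMaxOn hne hc.continuousOn
  refine ⟨w, fun z => ?_⟩
  obtain ⟨γ, hγ⟩ := hKΓ z
  rw [← hf.norm_smul γ z]
  exact hw hγ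

lemma IsForm.eq_const {f : ℂ → ℂ} (hf : IsForm Γ 0 f) : ∃ c, ∀ z, 0 < z.im → f z = c := by
  obtain ⟨w, hw⟩ := hf.bounded
  simp only [pow_zero, mul_one] at hw
  refine ⟨f w, fun z hz => ?_⟩
  exact Complex.eqOn_of_isPreconnected_of_isMaxOn_norm isPreconnected_upperHalfPlaneSet
    isOpen_upperHalfPlaneSet hf.1 w.im_pos (fun x hx => hw ⟨x, hx⟩) hz

/-- A set of representatives for the zeros of `φ`. -/
structure IsZeroSystem (Γ : Type*) [Group Γ] [MulAction Γ ℍ] (φ : ℂ → ℂ) (Z : Finset ℍ) :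
    Prop where
  eq_of_smul_eq : ∀ z ∈ Z, ∀ w ∈ Z, ∀ γ : Γ, γ • z = w → z = w
  exists_smul_eq : ∀ w : ℍ, φ w = 0 → ∃ z ∈ Z, ∃ γ : Γ, γ • z = w

lemma finite_zeros_inter {φ : ℂ → ℂ} (hφ : DifferentiableOn ℂ φ upperHalfPlaneSet)
    (htop : ∀ z : ℂ, 0 < z.im → analyticOrderAt φ z ≠ ⊤) {K : Set ℍ} (hK : IsCompact K) :
    {z ∈ K | φ z = 0}.Finite := by
  by_contra hinf
  obtain ⟨x, -, hx⟩ := Set.Infinite.exists_accPt_of_subset_isCompact hinf hK fun z hz => hz.1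
  refine htop x x.im_pos (analyticOrderAt_eq_top.2 ?_)
  rw [← (analyticAt_of_differentiableOn hφ x.im_pos).frequently_zero_iff_eventually_zero]
  rw [accPt_iff_frequently_nhdsNE] at hx
  have h1 : Tendsto ((↑) : ℍ → ℂ) (𝓝[≠] x) (𝓝[≠] (x : ℂ)) :=
    tendsto_nhdsWithin_of_tendsto_nhds_of_eventually_within _
      (continuous_coe.continuousAt.tendsto.mono_left nhdsWithin_le_nhds)
      (eventually_mem_nhdsWithin.mono fun y hy h => hy (UpperHalfPlane.ext h))
  exact h1.frequently (hx.mono fun z hz => hz.2)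

theorem IsForm.exists_isZeroSystem {k : ℕ} {φ : ℂ → ℂ} (hφ : IsForm Γ k φ) (h0 : φ ≠ 0) :
    ∃ Z, IsZeroSystem Γ φ Z := by
  classical
  obtain ⟨K, hK, hKΓ⟩ := IsCocompactAction.exists_isCompact (Γ := Γ)
  have hfin := finite_zeros_inter hφ.1 (fun z hz => hφ.analyticOrderAt_ne_top h0 hz) hK
  let q : ℍ → MulAction.orbitRel.Quotient Γ ℍ := Quotient.mk _
  have hq : ∀ γ : Γ, ∀ z, q (γ • z) = q z := fun γ z => Quotient.sound ⟨γ, rfl⟩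
  -- One representative for each of the finitely many orbits of zeros meeting `K`.
  refine ⟨(hfin.toFinset.image q).image Quotient.out, ?_, ?_⟩
  · intro z hz w hw γ h
    obtain ⟨z', -, rfl⟩ := Finset.mem_image.1 hz
    obtain ⟨w', -, rfl⟩ := Finset.mem_image.1 hw
    have h1 := hq γ z'.out
    rw [h] at h1
    have h2 : w' = z' := by
      have e1 : q w'.out = w' := Quotient.out_eq _
      have e2 : q z'.out = z' := Quotient.out_eq _
      rw [← e1, ← e2, h1]
    rw [h2]
  · intro w hw
    obtain ⟨γ, hγ⟩ := hKΓ w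
    have h1 : φ ↑(γ • w) = 0 := by
      have := hφ.3 γ w w.im_pos
      rw [hw, slash, act_coe] at this
      exact (mul_eq_zero.1 this).resolve_right (pow_ne_zero k (jac_ne_zero γ w.im_pos))
    refine ⟨(q (γ • w)).out, ?_, ?_⟩
    · exact Finset.mem_image_of_mem _ (Finset.mem_image_of_mem _ (by simpa using ⟨hγ, h1⟩))
    · have h2 : q w = q (q (γ • w)).out := by
        rw [← hq γ w]; exact (Quotient.out_eq _).symm
      obtain ⟨δ, hδ⟩ := Quotient.exact h2
      exact ⟨δ, hδ⟩

end

/-! ### Dimensions of spaces of forms -/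

section

lemma exists_eq_pow_mul {f : ℂ → ℂ} (hf : DifferentiableOn ℂ f upperHalfPlaneSet)
    {z₀ : ℂ} (hz₀ : 0 < z₀.im) (htop : analyticOrderAt f z₀ ≠ ⊤) :
    ∃ v : ℂ → ℂ, DifferentiableOn ℂ v upperHalfPlaneSet ∧ v z₀ ≠ 0 ∧
      ∀ z, 0 < z.im → f z = (z - z₀) ^ analyticOrderNatAt f z₀ * v z := by
  set m := analyticOrderNatAt f z₀ with hm
  set F : ℂ → ℂ := fun z => (z - z₀) ^ m with hF
  have hFd : Differentiable ℂ F := by fun_prop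
  have hFne : ∀ z, z ≠ z₀ → F z ≠ 0 := fun z hz => pow_ne_zero _ (sub_ne_zero.2 hz)
  have hF0 : analyticOrderAt F z₀ = m :=
    ((hFd.analyticAt z₀).analyticOrderAt_eq_natCast).2
      ⟨1, analyticAt_const, one_ne_zero, by simp [hF]⟩
  have hFtop : ∀ z, analyticOrderAt F z ≠ ⊤ := by
    intro z
    by_cases hz : z = z₀
    · rw [hz, hF0]; exact ENat.natCast_ne_top m
    · rw [(hFd.analyticAt z).analyticOrderAt_eq_zero.2 (hFne z hz)]; exact ENat.zero_ne_top
  obtain ⟨v, hv, -, hfv⟩ := exists_eq_mul_of_locDvd isOpen_upperHalfPlaneSet hFd.differentiableOn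
    (fun z _ => hFtop z) (f := f) (fun z hz => by
      by_cases h : z = z₀
      · subst h
        refine locDvd_of_analyticOrderAt_le (hFd.analyticAt z)
          (analyticAt_of_differentiableOn hf hz) (hFtop z) ?_
        rw [hF0, hm, Nat.cast_analyticOrderNatAt htop]
      · exact locDvd_of_ne_zero (hFd.analyticAt z) (analyticAt_of_differentiableOn hf hz)
          (hFne z h))
  refine ⟨v, hv, fun h0 => ?_, hfv⟩
  have h1 : f =ᶠ[𝓝 z₀] F * v := by
    filter_upwards [mem_nhds_upperHalfPlaneSet hz₀] with w hw using hfv w hw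
  have hva := analyticAt_of_differentiableOn hv hz₀
  have h2 := analyticOrderAt_congr h1
  rw [analyticOrderAt_mul (hFd.analyticAt z₀) hva, hF0, ← Nat.cast_analyticOrderNatAt htop, ← hm]
    at h2
  have h3 : analyticOrderAt v z₀ = 0 := by
    generalize analyticOrderAt v z₀ = x at h2
    induction x using ENat.recTopCoe with
    | top => simp at h2
    | coe n => norm_cast at h2 ⊢; omega
  exact (hva.analyticOrderAt_eq_zero.1 h3) h0

/-- Inside the closed unit ball about `w`, compactness bounds the left side above and `kern` is
bounded below, so only the outside needs checking. -/
lemma isDominated_of_le_dist {k : ℕ} {f : ℂ → ℂ} (hf : DifferentiableOn ℂ f upperHalfPlaneSet)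
    (w : ℍ) (C : ℝ) (h : ∀ z : ℍ, 1 ≤ dist z w → ‖f z‖ * z.im ^ k ≤ C * kern z w ^ 2) :
    IsDominated k f := by
  have hc : Continuous fun z : ℍ => ‖f z‖ * z.im ^ k := by
    refine Continuous.mul ?_ (continuous_im.pow k)
    exact (hf.continuousOn.comp_continuous continuous_coe fun z => z.im_pos).norm
  obtain ⟨B, hB⟩ := (isCompact_closedBall w 1).bddAbove_image hc.continuousOn
  set κ := (Real.cosh (1 / 2) ^ 2)⁻¹ with hκ
  have hκ0 : 0 < κ := inv_pos.2 (pow_pos (Real.cosh_pos _) 2)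
  refine ⟨w, max C (|B| / κ ^ 2), fun z => ?_⟩
  have hk := kern_pos z w
  rcases le_total 1 (dist z w) with hd | hd
  · refine (h z hd).trans ?_
    gcongr
    exact le_max_left _ _
  · have h1 : ‖f z‖ * z.im ^ k ≤ |B| :=
      (hB ⟨z, hd, rfl⟩).trans (le_abs_self B)
    have h2 : κ ≤ kern z w := by
      rw [hκ, kern]
      have : Real.cosh (dist z w / 2) ≤ Real.cosh (1 / 2) := by
        rw [Real.cosh_le_cosh, abs_of_nonneg (by positivity), abs_of_nonneg (by positivity)]
        linarith
      have := Real.cosh_pos (dist z w / 2)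
      gcongr
    calc ‖f z‖ * z.im ^ k ≤ |B| := h1
      _ = |B| / κ ^ 2 * κ ^ 2 := by field_simp
      _ ≤ max C (|B| / κ ^ 2) * kern z w ^ 2 := by
        gcongr
        exact le_max_right _ _

variable {Γ : Type*} [Group Γ] [MulAction Γ ℍ]

/-- The indices of the coefficients of a jet modulo `φ` at a system of zeros of `φ`. -/
abbrev JetIndex (φ : ℂ → ℂ) (Z : Finset ℍ) := Σ z : Z, Fin (analyticOrderNatAt φ (z : ℍ))

/-- The number of zeros of `φ` in `Z`, with multiplicity. -/
def zeroCount (φ : ℂ → ℂ) (Z : Finset ℍ) : ℕ := Fintype.card (JetIndex φ Z)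

variable (Γ) in
/-- The derivatives of a form, up to the order of `φ`, at the points of `Z`. -/
def jet (φ : ℂ → ℂ) (Z : Finset ℍ) (k : ℕ) : Form Γ k →ₗ[ℂ] (JetIndex φ Z → ℂ) where
  toFun f := fun i => iteratedDeriv i.2 f.1 (i.1.1 : ℂ)
  map_add' f g := funext fun i => by
    have hf := IsForm.analyticAt f.2 i.1.1.im_pos
    have hg := IsForm.analyticAt g.2 i.1.1.im_pos
    exact iteratedDeriv_add hf.contDiffAt hg.contDiffAt
  map_smul' c f := funext fun i => by
    simp [iteratedDeriv_const_smul_field]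

variable [IsCocompactAction Γ]

lemma eq_one_of_smul_eq {γ : Γ} {z : ℍ} (h : γ • z = z) : γ = 1 := by
  obtain ⟨σ, hσ, hle⟩ := IsCocompactAction.exists_le_dist (Γ := Γ)
  by_contra hne
  have := hle γ hne z
  rw [h, dist_self] at this
  linarith

/-- Elements of the kernel of `jet φ` are divisible by `φ`. -/
theorem exists_eq_mul_of_jet_eq_zero {a j : ℕ} {φ : ℂ → ℂ} (hφ : IsForm Γ a φ) (h0 : φ ≠ 0)
    {Z : Finset ℍ} (hZ : IsZeroSystem Γ φ Z) (f : Form Γ (a + j))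
    (hf : jet Γ φ Z (a + j) f = 0) : ∃ q, IsForm Γ j q ∧ f.1 = φ * q := by
  have hff : IsForm Γ (a + j) f.1 := f.2
  have hord : ∀ z : ℂ, 0 < z.im → LocDvd φ f.1 z := by
    intro z hz
    by_cases hφz : φ z = 0
    · obtain ⟨w, hw, γ, hγ⟩ := hZ.exists_smul_eq ⟨z, hz⟩ hφz
      have hz' : z = act γ w := by rw [act_coe, hγ]
      refine locDvd_of_analyticOrderAt_le (hφ.analyticAt hz) (hff.analyticAt hz)
        (hφ.analyticOrderAt_ne_top h0 hz) ?_
      rw [hz', hφ.analyticOrderAt_act γ w.im_pos, hff.analyticOrderAt_act γ w.im_pos,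
        ← Nat.cast_analyticOrderNatAt (hφ.analyticOrderAt_ne_top h0 w.im_pos),
        natCast_le_analyticOrderAt_iff_iteratedDeriv_eq_zero (hff.analyticAt w.im_pos)]
      intro l hl
      exact congrFun hf ⟨⟨w, hw⟩, ⟨l, hl⟩⟩
    · exact locDvd_of_ne_zero (hφ.analyticAt hz) (hff.analyticAt hz) hφz
  obtain ⟨q, hq, hq0, hfq⟩ := exists_eq_mul_of_locDvd isOpen_upperHalfPlaneSet hφ.differentiableOn
    (fun z hz => hφ.analyticOrderAt_ne_top h0 hz) hord
  have h1 : f.1 = φ * q := by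
    funext z
    by_cases hz : 0 < z.im
    · exact hfq z hz
    · simp [hff.eq_zero z hz, hφ.eq_zero z hz]
  exact ⟨q, hφ.of_mul h0 hq hq0 (h1 ▸ hff), h1⟩

/-- A form in the kernel is φ times a form of weight 0, which is constant by the maximum principle.
-/
lemma ker_jet_le_span {a : ℕ} {φ : ℂ → ℂ} (hφ : IsForm Γ a φ) (h0 : φ ≠ 0)
    {Z : Finset ℍ} (hZ : IsZeroSystem Γ φ Z) :
    LinearMap.ker (jet Γ φ Z a) ≤ Submodule.span ℂ {(⟨φ, hφ⟩ : Form Γ a)} := by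
  intro f hf
  obtain ⟨q, hq, hfq⟩ := exists_eq_mul_of_jet_eq_zero (j := 0) hφ h0 hZ f hf
  obtain ⟨c, hc⟩ := hq.eq_const
  refine Submodule.mem_span_singleton.2 ⟨c, Subtype.ext (funext fun z => ?_)⟩
  rw [hfq]
  by_cases hz : 0 < z.im
  · simp [hc z hz, mul_comm]
  · simp [hφ.eq_zero z hz]

instance finiteDimensional_form (k : ℕ) : FiniteDimensional ℂ (Form Γ k) := by
  by_cases h : ∃ φ, IsForm Γ k φ ∧ φ ≠ 0
  · obtain ⟨φ, hφ, h0⟩ := h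
    obtain ⟨Z, hZ⟩ := hφ.exists_isZeroSystem h0
    have h1 : FiniteDimensional ℂ (LinearMap.ker (jet Γ φ Z k)) :=
      Submodule.finiteDimensional_of_le (ker_jet_le_span hφ h0 hZ)
    have h2 : IsNoetherian ℂ (Form Γ k) := by
      rw [IsNoetherian.iff_rank_lt_aleph0, ← LinearMap.rank_range_add_rank_ker (jet Γ φ Z k)]
      exact Cardinal.add_lt_aleph0 (Module.rank_lt_aleph0 ℂ _) (Module.rank_lt_aleph0 ℂ _)
    infer_instance
  · push Not at h
    have : Subsingleton (Form Γ k) :=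
      ⟨fun f g => Subtype.ext ((h f.1 f.2).trans (h g.1 g.2).symm)⟩
    infer_instance

theorem finrank_form_le {a : ℕ} {φ : ℂ → ℂ} (hφ : IsForm Γ a φ) (h0 : φ ≠ 0)
    {Z : Finset ℍ} (hZ : IsZeroSystem Γ φ Z) :
    Module.finrank ℂ (Form Γ a) ≤ zeroCount φ Z + 1 := by
  rw [← LinearMap.finrank_range_add_finrank_ker (jet Γ φ Z a)]
  refine add_le_add ?_ ?_
  · refine (Submodule.finrank_le _).trans ?_
    rw [Module.finrank_fintype_fun_eq_card, zeroCount]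
  · exact (Submodule.finrank_mono (ker_jet_le_span hφ h0 hZ)).trans
      ((finrank_span_le_card _).trans (by simp))

/-- A form with a prescribed order of vanishing at one zero of `φ`, divisible by `φ` at the others;
it is `φ` times a meromorphic Poincaré series of weight `j` with a single pole modulo `Γ`. -/
theorem exists_form_iteratedDeriv {a j : ℕ} (hj : 2 ≤ j) {φ : ℂ → ℂ} (hφ : IsForm Γ a φ)
    (h0 : φ ≠ 0) {Z : Finset ℍ} (hZ : IsZeroSystem Γ φ Z) {z₀ : ℍ} (hz₀ : z₀ ∈ Z) {l : ℕ}
    (hl : l < analyticOrderNatAt φ z₀) :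
    ∃ f, IsForm Γ (a + j) f ∧ iteratedDeriv l f z₀ ≠ 0 ∧ (∀ i < l, iteratedDeriv i f z₀ = 0) ∧
      ∀ z ∈ Z, z ≠ z₀ → ∀ i < analyticOrderNatAt φ z, iteratedDeriv i f z = 0 := by
  have htop : ∀ z : ℂ, 0 < z.im → analyticOrderAt φ z ≠ ⊤ := fun z hz =>
    hφ.analyticOrderAt_ne_top h0 hz
  obtain ⟨v, hv, hv0, hφv⟩ := exists_eq_pow_mul hφ.differentiableOn z₀.im_pos (htop _ z₀.im_pos)
  set m := analyticOrderNatAt φ (z₀ : ℂ) with hm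
  -- With this `g`, the function `F` below equals φ times the (m - l)-th power of the inverse Cayley
  -- coordinate at `z₀` times (z - z̄₀)⁻²ʲ: the second factor is the pole, bounded far from `z₀`,
  -- and the third gives the decay `kern ^ j`.
  set g : ℂ → ℂ := fun z => v z * (z - conj (z₀ : ℂ)) ^ (m - l) / (z - conj (z₀ : ℂ)) ^ (2 * j)
    with hg
  have hgd : DifferentiableOn ℂ g upperHalfPlaneSet := by
    refine DifferentiableOn.div (hv.mul (by fun_prop)) (by fun_prop) fun z hz => ?_
    exact pow_ne_zero _ (sub_conj_ne_zero hz z₀.im_pos)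
  have hg0 : g z₀ ≠ 0 :=
    div_ne_zero (mul_ne_zero hv0 (pow_ne_zero _ (sub_conj_ne_zero z₀.im_pos z₀.im_pos)))
      (pow_ne_zero _ (sub_conj_ne_zero z₀.im_pos z₀.im_pos))
  set F : ℂ → ℂ := fun z => (z - z₀) ^ l * g z with hF
  have hFd : DifferentiableOn ℂ F upperHalfPlaneSet :=
    DifferentiableOn.mul (by fun_prop) hgd
  have hFφ : ∀ z : ℂ, 0 < z.im → (z - z₀) ^ (m - l) * F z =
      φ z * ((z - conj (z₀ : ℂ)) ^ (m - l) / (z - conj (z₀ : ℂ)) ^ (2 * j)) := by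
    intro z hz
    rw [hφv z hz, hF, hg, ← Nat.sub_add_cancel hl.le, pow_add]
    simp only [Nat.add_sub_cancel]
    ring
  -- At distance at least 1 from `z₀` the Cayley coordinate has modulus at least `t`, and |φ| Imᵃ is
  -- bounded. The hypothesis 2 ≤ j gives `kern ^ j ≤ kern ^ 2`.
  have hdom : IsDominated (a + j) F := by
    obtain ⟨w, hw⟩ := hφ.bounded
    set B := ‖φ w‖ * w.im ^ a with hB
    have hκ : Real.cosh (1 / 2) ^ 2 > 1 :=
      one_lt_pow₀ (Real.one_lt_cosh.2 (by norm_num)) two_ne_zero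
    set κ := (Real.cosh (1 / 2) ^ 2)⁻¹ with hκd
    have hκ1 : κ < 1 := inv_lt_one_of_one_lt₀ hκ
    set t := √(1 - κ) with ht
    have ht0 : 0 < t := Real.sqrt_pos.2 (by linarith)
    refine isDominated_of_le_dist hFd z₀ ((t ^ (m - l))⁻¹ * B * ((4 * z₀.im) ^ j)⁻¹)
      fun z hz => ?_
    have h1 := sub_conj_ne_zero z.im_pos z₀.im_pos
    have h1' := norm_pos_iff.2 h1
    have h2 : t * ‖(z : ℂ) - conj (z₀ : ℂ)‖ ≤ ‖(z : ℂ) - z₀‖ := by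
      have h3 : t ≤ ‖cayley z₀ z‖ := by
        rw [ht]
        refine Real.sqrt_le_iff.2 ⟨norm_nonneg _, ?_⟩
        have := kern_le_of_le_dist zero_le_one hz
        have h4 := kern_eq_one_sub z₀ z
        rw [kern_comm] at h4
        linarith
      rwa [cayley, norm_div, le_div_iff₀ h1'] at h3
    have h5 : ‖(z : ℂ) - z₀‖ ^ (m - l) * ‖F z‖ = ‖φ z‖ * (‖(z : ℂ) - conj (z₀ : ℂ)‖ ^ (m - l) /
        ‖(z : ℂ) - conj (z₀ : ℂ)‖ ^ (2 * j)) := by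
      rw [← norm_pow, ← norm_mul, hFφ z z.im_pos, norm_mul, norm_div, norm_pow, norm_pow]
    have h6 := hw z
    have h7 : z.im ^ j / ‖(z : ℂ) - conj (z₀ : ℂ)‖ ^ (2 * j) =
        ((4 * z₀.im) ^ j)⁻¹ * kern z z₀ ^ j := by
      rw [kern_eq, pow_mul, ← div_pow, ← inv_pow, ← mul_pow]
      have := z₀.im_pos
      congr 1
      field_simp
    have h8 : kern z z₀ ^ j ≤ kern z z₀ ^ 2 :=
      pow_le_pow_of_le_one (kern_pos _ _).le (kern_le_one _ _) hj
    have h9 : (t * ‖(z : ℂ) - conj (z₀ : ℂ)‖) ^ (m - l) * ‖F z‖ ≤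
        ‖φ z‖ * (‖(z : ℂ) - conj (z₀ : ℂ)‖ ^ (m - l) / ‖(z : ℂ) - conj (z₀ : ℂ)‖ ^ (2 * j)) := by
      rw [← h5]
      gcongr
    have h10 : t ^ (m - l) * ‖F z‖ ≤ ‖φ z‖ / ‖(z : ℂ) - conj (z₀ : ℂ)‖ ^ (2 * j) := by
      rw [mul_pow] at h9
      have hp : 0 < ‖(z : ℂ) - conj (z₀ : ℂ)‖ ^ (m - l) := by positivity
      refine le_of_mul_le_mul_left ?_ hp
      calc _ = t ^ (m - l) * ‖(z : ℂ) - conj (z₀ : ℂ)‖ ^ (m - l) * ‖F z‖ := by ring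
        _ ≤ _ := h9
        _ = _ := by ring
    have hzp := z.im_pos
    have hz0p := z₀.im_pos
    have h11 : t ^ (m - l) * (‖F z‖ * z.im ^ (a + j)) ≤ B * (((4 * z₀.im) ^ j)⁻¹ * kern z z₀ ^ 2) :=
      calc t ^ (m - l) * (‖F z‖ * z.im ^ (a + j))
          = (t ^ (m - l) * ‖F z‖) * z.im ^ (a + j) := by ring
        _ ≤ (‖φ z‖ / ‖(z : ℂ) - conj (z₀ : ℂ)‖ ^ (2 * j)) * z.im ^ (a + j) := by gcongr
        _ = (‖φ z‖ * z.im ^ a) * (z.im ^ j / ‖(z : ℂ) - conj (z₀ : ℂ)‖ ^ (2 * j)) := by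
          rw [pow_add]; ring
        _ ≤ B * (((4 * z₀.im) ^ j)⁻¹ * kern z z₀ ^ 2) := by
          rw [h7]
          have : 0 ≤ B := by positivity
          have := kern_pos z z₀
          gcongr
    have htp : 0 < t ^ (m - l) := by positivity
    calc ‖F z‖ * z.im ^ (a + j) = (t ^ (m - l))⁻¹ * (t ^ (m - l) * (‖F z‖ * z.im ^ (a + j))) := by
          field_simp
      _ ≤ (t ^ (m - l))⁻¹ * (B * (((4 * z₀.im) ^ j)⁻¹ * kern z z₀ ^ 2)) := by gcongr
      _ = _ := by ring
  have hF0 : analyticOrderAt F z₀ = l :=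
    ((analyticAt_of_differentiableOn hFd z₀.im_pos).analyticOrderAt_eq_natCast).2
      ⟨g, analyticAt_of_differentiableOn hgd z₀.im_pos, hg0, by simp [hF]⟩
  have hFz₀ := (analyticOrderAt_eq_nat_iff_iteratedDeriv_eq_zero
    (analyticAt_of_differentiableOn hFd z₀.im_pos)).1 hF0
  -- Away from `z₀`, `F` is φ times an analytic function, so this term vanishes at z to the order of
  -- φ.
  have hzero : ∀ z : ℍ, ∀ γ : Γ, γ • z ≠ z₀ → ∀ i < analyticOrderNatAt φ z,
      iteratedDeriv i (slash (a + j) γ F) z = 0 := by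
    intro z γ hγ
    refine (natCast_le_analyticOrderAt_iff_iteratedDeriv_eq_zero
      (analyticAt_of_differentiableOn (differentiableOn_slash γ hFd) z.im_pos)).1 ?_
    have hFγ := analyticAt_of_differentiableOn hFd (act_im_pos γ z)
    rw [analyticOrderAt_slash _ γ z.im_pos hFγ, Nat.cast_analyticOrderNatAt (htop z z.im_pos),
      ← hφ.analyticOrderAt_act γ z.im_pos]
    have h1 : act γ z - z₀ ≠ 0 := by
      rw [act_coe, sub_ne_zero]
      exact fun h => hγ (UpperHalfPlane.ext h)
    set G : ℂ → ℂ := fun w => ((w - conj (z₀ : ℂ)) ^ (m - l) / (w - conj (z₀ : ℂ)) ^ (2 * j)) /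
      (w - z₀) ^ (m - l) with hG
    have hGa : AnalyticAt ℂ G (act γ z) := by
      have := sub_conj_ne_zero (act_im_pos γ z) z₀.im_pos
      have h2 : (act γ z - conj (z₀ : ℂ)) ^ (2 * j) ≠ 0 := pow_ne_zero _ this
      have h3 : (act γ z - z₀) ^ (m - l) ≠ 0 := pow_ne_zero _ h1
      rw [hG]
      fun_prop (disch := assumption)
    have h4 : F =ᶠ[𝓝 (act γ z)] φ * G := by
      filter_upwards [mem_nhds_upperHalfPlaneSet (act_im_pos γ z),
        (continuousAt_id.sub continuousAt_const).eventually_ne h1] with w hw hw2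
      have h5 := hFφ w hw
      have h6 : (w - z₀) ^ (m - l) ≠ 0 := pow_ne_zero _ hw2
      rw [Pi.mul_apply, hG, ← mul_div_assoc, eq_div_iff h6, ← h5, mul_comm]
    rw [analyticOrderAt_congr h4, analyticOrderAt_mul (hφ.analyticAt (act_im_pos γ z)) hGa]
    exact le_self_add
  -- Γ acts freely, so only the term of the identity contributes below order m.
  have hz₀eq : ∀ i < m, iteratedDeriv i (poincare Γ (a + j) F) z₀ = iteratedDeriv i F z₀ := by
    intro i hi
    have h1 := hasSum_iteratedDeriv_poincare (Γ := Γ) hFd hdom i z₀.im_pos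
    have h2 := hasSum_single (f := fun γ : Γ => iteratedDeriv i (slash (a + j) γ F) z₀) 1
      fun γ hγ => hzero z₀ γ (fun h => hγ (eq_one_of_smul_eq h)) i hi
    rw [h1.unique h2]
    have h3 : slash (a + j) (1 : Γ) F =ᶠ[𝓝 (z₀ : ℂ)] F := by
      filter_upwards [mem_nhds_upperHalfPlaneSet z₀.im_pos] with w hw using slash_one _ _ hw
    exact h3.iteratedDeriv_eq i
  refine ⟨poincare Γ (a + j) F, poincare_mem hFd hdom, ?_, fun i hi => ?_,
    fun z hz hne i hi => ?_⟩
  · rw [hz₀eq l hl]; exact hFz₀.2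
  · rw [hz₀eq i (hi.trans hl)]; exact hFz₀.1 i hi
  · have h1 := hasSum_iteratedDeriv_poincare (Γ := Γ) hFd hdom i z.im_pos
    refine h1.unique ?_
    convert! hasSum_zero using 2 with γ
    exact hzero z γ (fun h => hne (hZ.eq_of_smul_eq z hz z₀ hz₀ γ h)) i hi

/-- Triangularity: if a nonzero functional `L` killed all jets, take at some `z₀` the largest order
`l` on which `L` is nonzero. The form vanishing to order exactly `l` at `z₀`, with zero jets at the
other points, would not be killed. -/
theorem range_jet {a j : ℕ} (hj : 2 ≤ j) {φ : ℂ → ℂ} (hφ : IsForm Γ a φ)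
    (h0 : φ ≠ 0) {Z : Finset ℍ} (hZ : IsZeroSystem Γ φ Z) :
    LinearMap.range (jet Γ φ Z (a + j)) = ⊤ := by
  classical
  by_contra hne
  obtain ⟨L, hL, hle⟩ := Submodule.exists_le_ker_of_lt_top _ (lt_top_iff_ne_top.2 hne)
  obtain ⟨⟨z₀, i₀⟩, hi₀⟩ : ∃ i, L (Pi.single i 1) ≠ 0 := by
    by_contra h
    push Not at h
    exact hL (LinearMap.pi_ext' fun i => LinearMap.ext_ring (by simpa using h i))
  obtain ⟨l, hl, hmax⟩ := Finset.exists_max_image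
    (Finset.univ.filter fun i => L (Pi.single ⟨z₀, i⟩ 1) ≠ 0) id ⟨i₀, by simpa using hi₀⟩
  simp only [Finset.mem_filter, Finset.mem_univ, true_and, id] at hl hmax
  obtain ⟨f, hf, hfl, hflt, hfne⟩ := exists_form_iteratedDeriv hj hφ h0 hZ z₀.2 l.2
  have h1 : L (jet Γ φ Z (a + j) ⟨f, hf⟩) = 0 := hle ⟨_, rfl⟩
  have h2 : jet Γ φ Z (a + j) ⟨f, hf⟩ =
      ∑ i, jet Γ φ Z (a + j) ⟨f, hf⟩ i • Pi.single i (1 : ℂ) :=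
    pi_eq_sum_univ' _
  rw [h2, map_sum, Finset.sum_eq_single ⟨z₀, l⟩] at h1
  · rw [map_smul, smul_eq_mul] at h1
    exact (mul_ne_zero hfl hl) h1
  · rintro ⟨z, i⟩ - hzi
    rw [map_smul, smul_eq_mul]
    by_cases hz : z = z₀
    · subst hz
      rcases lt_trichotomy i l with h3 | h3 | h3
      · rw [show jet Γ φ Z (a + j) ⟨f, hf⟩ ⟨z, i⟩ = 0 from hflt i h3, zero_mul]
      · exact absurd (by rw [h3]) hzi
      · have : L (Pi.single ⟨z, i⟩ 1) = 0 := by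
          by_contra h4
          exact absurd (hmax i h4) (not_le.2 h3)
        rw [this, mul_zero]
    · rw [show jet Γ φ Z (a + j) ⟨f, hf⟩ ⟨z, i⟩ = 0 from
        hfne z z.2 (fun h => hz (Subtype.ext h)) i i.2, zero_mul]
  · simp

/-- The jets of forms of weight a + j are arbitrary, and the forms with zero jets are φ times those
of weight j. This exact sequence plays the role of Riemann–Roch. -/
theorem finrank_form_add {a j : ℕ} (hj : 2 ≤ j) {φ : ℂ → ℂ} (hφ : IsForm Γ a φ)
    (h0 : φ ≠ 0) {Z : Finset ℍ} (hZ : IsZeroSystem Γ φ Z) :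
    Module.finrank ℂ (Form Γ (a + j)) = zeroCount φ Z + Module.finrank ℂ (Form Γ j) := by
  rw [← LinearMap.finrank_range_add_finrank_ker (jet Γ φ Z (a + j)), range_jet hj hφ h0 hZ,
    finrank_top, Module.finrank_fintype_fun_eq_card, zeroCount]
  congr 1
  let M : Form Γ j →ₗ[ℂ] Form Γ (a + j) :=
    { toFun := fun q => ⟨φ * q.1, hφ.mul q.2⟩
      map_add' := fun p q => Subtype.ext (mul_add φ p.1 q.1)
      map_smul' := fun c q => Subtype.ext (mul_smul_comm c φ q.1) }
  have hMinj : Function.Injective M := by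
    rw [← LinearMap.ker_eq_bot, LinearMap.ker_eq_bot']
    intro q hq
    have h1 : φ * q.1 = 0 := congrArg Subtype.val hq
    by_contra hq0
    have hq0' : q.1 ≠ 0 := fun h => hq0 (Subtype.ext h)
    have h2 := analyticOrderAt_mul (hφ.analyticAt I.im_pos) (IsForm.analyticAt q.2 I.im_pos)
    rw [h1] at h2
    have h3 : analyticOrderAt (0 : ℂ → ℂ) (I : ℍ) = ⊤ := analyticOrderAt_eq_top.2 (by simp)
    rw [h3] at h2
    rcases WithTop.add_eq_top.1 h2.symm with h4 | h4
    · exact hφ.analyticOrderAt_ne_top h0 I.im_pos h4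
    · exact IsForm.analyticOrderAt_ne_top q.2 hq0' I.im_pos h4
  suffices h : LinearMap.ker (jet Γ φ Z (a + j)) = LinearMap.range M by
    rw [h, LinearMap.finrank_range_of_inj hMinj]
  refine le_antisymm ?_ ?_
  · intro f hf
    obtain ⟨q, hq, hfq⟩ := exists_eq_mul_of_jet_eq_zero hφ h0 hZ f hf
    exact ⟨⟨q, hq⟩, Subtype.ext hfq.symm⟩
  · rintro _ ⟨q, rfl⟩
    refine LinearMap.mem_ker.2 (funext fun i => ?_)
    have hz := i.1.1.im_pos
    have hMa : AnalyticAt ℂ (φ * q.1) i.1.1 := IsForm.analyticAt (hφ.mul q.2) hz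
    refine (natCast_le_analyticOrderAt_iff_iteratedDeriv_eq_zero hMa
      (n := analyticOrderNatAt φ i.1.1)).1 ?_ i.2 i.2.2
    rw [analyticOrderAt_mul (hφ.analyticAt hz) (IsForm.analyticAt q.2 hz),
      Nat.cast_analyticOrderNatAt (hφ.analyticOrderAt_ne_top h0 hz)]
    exact le_self_add

end

/-! ### Forms peaked at the points of a separated set -/

section

/-- The function `(4 Im w)ᵇ / (z - w̄)²ᵇ`. -/
def peak (b : ℕ) (w : ℍ) (z : ℂ) : ℂ := (4 * w.im : ℂ) ^ b / (z - conj (w : ℂ)) ^ (2 * b)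

lemma norm_peak_mul (b : ℕ) (w z : ℍ) : ‖peak b w z‖ * z.im ^ b = kern z w ^ b := by
  have := w.im_pos
  rw [peak, norm_div, norm_pow, norm_pow, norm_mul, Complex.norm_real, kern_eq, pow_mul,
    ← div_pow, ← mul_pow, Real.norm_of_nonneg w.im_pos.le, Complex.norm_ofNat]
  congr 1
  ring

lemma differentiableOn_peak (b : ℕ) (w : ℍ) :
    DifferentiableOn ℂ (peak b w) upperHalfPlaneSet :=
  DifferentiableOn.div (by fun_prop) (by fun_prop) fun _ hz =>
    pow_ne_zero _ (sub_conj_ne_zero hz w.im_pos)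

lemma isDominated_peak {b : ℕ} (hb : 2 ≤ b) (w : ℍ) : IsDominated b (peak b w) :=
  ⟨w, 1, fun z => by
    rw [norm_peak_mul, one_mul]
    exact pow_le_pow_of_le_one (kern_pos _ _).le (kern_le_one _ _) hb⟩

variable {Γ : Type*} [Group Γ] [MulAction Γ ℍ] [IsCocompactAction Γ]

lemma norm_slash_peak_mul (b : ℕ) (γ : Γ) (w z : ℍ) :
    ‖slash b γ (peak b w) z‖ * z.im ^ b = kern z (γ⁻¹ • w) ^ b := by
  rw [norm_slash, div_mul_cancel₀ _ (pow_pos z.im_pos b).ne', norm_peak_mul, ← kern_smul γ z,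
    smul_inv_smul]

/-- The Poincaré series of `peak b (z i)` has normalized size close to 1 at `z i` and is small at
the other points. The matrix of values is diagonally dominant by columns, hence invertible, so these
series are linearly independent. -/
theorem card_le_finrank_form {σ : ℝ} (hσ : 0 < σ) {b : ℕ} (hb : 2 ≤ b)
    (hsmall : ((Real.cosh (σ / 2) ^ 2)⁻¹) ^ (b - 2) * sepConst σ < 1) {ι : Type*} [Fintype ι]
    (z : ι → ℍ) (hz : ∀ i j, ∀ γ : Γ, (i ≠ j ∨ γ ≠ 1) → σ ≤ dist (γ • z i) (z j)) :
    Fintype.card ι ≤ Module.finrank ℂ (Form Γ b) := by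
  classical
  set κ := (Real.cosh (σ / 2) ^ 2)⁻¹ with hκ
  have hκ0 : 0 < κ := inv_pos.2 (pow_pos (Real.cosh_pos _) 2)
  -- All the orbits together form one σ-separated family, so a single packing estimate controls a
  -- whole column of the matrix.
  let x : ι × Γ → ℍ := fun p => p.2⁻¹ • z p.1
  have hx : ∀ p q, p ≠ q → σ ≤ dist (x p) (x q) := by
    rintro ⟨i, γ⟩ ⟨j, δ⟩ hne
    simp only [x]
    rw [← dist_smul δ, smul_inv_smul, smul_smul]
    refine hz i j _ ?_
    by_contra h
    push Not at h
    exact hne (Prod.ext h.1 (mul_inv_eq_one.1 h.2).symm)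
  let P : ι → Form Γ b := fun i =>
    ⟨poincare Γ b (peak b (z i)), poincare_mem (differentiableOn_peak b _) (isDominated_peak hb _)⟩
  let A : Matrix ι ι ℂ := fun i j => (P i).1 (z j) * ((z j).im : ℂ) ^ b
  -- The sizes of all contributions at `z j` except the peak itself; `hsmall` makes their total less
  -- than 1.
  let G : ι → ι × Γ → ℝ := fun j p => if p = (j, 1) then 0 else kern (z j) (x p) ^ b
  have hGle : ∀ j p, G j p ≤ κ ^ (b - 2) * kern (z j) (x p) ^ 2 := by
    intro j p
    have hk := kern_pos (z j) (x p)
    simp only [G]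
    split_ifs with h
    · positivity
    · rw [← Nat.sub_add_cancel hb, pow_add, Nat.add_sub_cancel]
      have : kern (z j) (x p) ≤ κ := by
        refine kern_le_of_le_dist hσ.le ?_
        have := hx p (j, 1) h
        simpa [x, dist_comm] using this
      gcongr
  have hG0 : ∀ j p, 0 ≤ G j p := by
    intro j p
    have hk := kern_pos (z j) (x p)
    simp only [G]
    split_ifs <;> positivity
  have hGsum : ∀ j, Summable (G j) := fun j =>
    ((summable_kern_sq hσ hx (z j)).mul_left _).of_nonneg_of_le (hG0 j) (hGle j)
  have hGtot : ∀ j, ∑' p, G j p < 1 := by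
    intro j
    refine lt_of_le_of_lt ?_ hsmall
    refine ((hGsum j).tsum_le_tsum (hGle j) ((summable_kern_sq hσ hx (z j)).mul_left _)).trans ?_
    rw [tsum_mul_left]
    have := (summable_kern_sq hσ hx (z j)).tsum_le_of_sum_le (sum_kern_sq_le hσ hx (z j))
    gcongr
  have hterm : ∀ i j, ∀ γ : Γ, ‖slash b γ (peak b (z i)) (z j) * ((z j).im : ℂ) ^ b‖ =
      kern (z j) (x (i, γ)) ^ b := by
    intro i j γ
    rw [norm_mul, norm_pow, Complex.norm_real, Real.norm_of_nonneg (z j).im_pos.le,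
      norm_slash_peak_mul]
  have hA : ∀ i j, A i j = ∑' γ : Γ, slash b γ (peak b (z i)) (z j) * ((z j).im : ℂ) ^ b := by
    intro i j
    simp only [A, P]
    have hzj : 0 < ((z j : ℍ) : ℂ).im := (z j).im_pos
    rw [poincare, if_pos hzj, tsum_mul_right]
  have hs : ∀ i j, Summable fun γ : Γ =>
      ‖slash b γ (peak b (z i)) (z j) * ((z j).im : ℂ) ^ b‖ := by
    intro i j
    simp only [norm_mul]
    exact ((isDominated_peak hb (z i)).summable (z j).im_pos).mul_right _
  have hfib : ∀ i j, Summable fun γ : Γ => G j (i, γ) := fun i j =>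
    (hGsum j).comp_injective (Prod.mk_right_injective i)
  have hoff : ∀ i j, i ≠ j → ‖A i j‖ ≤ ∑' γ : Γ, G j (i, γ) := by
    intro i j hij
    rw [hA]
    refine (norm_tsum_le_tsum_norm (hs i j)).trans (le_of_eq (tsum_congr fun γ => ?_))
    rw [hterm]
    simp [G, hij]
  have hdiag : ∀ j, 1 - ∑' γ : Γ, G j (j, γ) ≤ ‖A j j‖ := by
    intro j
    rw [hA, (hs j j).of_norm.tsum_eq_add_tsum_ite 1]
    have h1 : ‖slash b (1 : Γ) (peak b (z j)) (z j) * ((z j).im : ℂ) ^ b‖ = 1 := by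
      rw [hterm]; simp [x, kern]
    have h2 : ‖∑' γ : Γ, if γ = 1 then 0 else
        slash b γ (peak b (z j)) (z j) * ((z j).im : ℂ) ^ b‖ ≤ ∑' γ : Γ, G j (j, γ) := by
      have h3 : ∀ γ : Γ, ‖if γ = 1 then 0 else
          slash b γ (peak b (z j)) (z j) * ((z j).im : ℂ) ^ b‖ = G j (j, γ) := by
        intro γ
        by_cases h : γ = 1
        · simp [G, h]
        · rw [if_neg h, hterm]; simp [G, h]
      refine (norm_tsum_le_tsum_norm ?_).trans (le_of_eq (tsum_congr h3))
      exact (hfib j j).congr fun γ => (h3 γ).symm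
    have h4 := norm_sub_le_norm_add (slash b (1 : Γ) (peak b (z j)) (z j) * ((z j).im : ℂ) ^ b)
      (∑' γ : Γ, if γ = 1 then 0 else slash b γ (peak b (z j)) (z j) * ((z j).im : ℂ) ^ b)
    linarith
  have hdet : A.det ≠ 0 := by
    refine det_ne_zero_of_sum_col_lt_diag fun j => ?_
    have h1 : ∑' p, G j p = ∑ i, ∑' γ : Γ, G j (i, γ) := by
      rw [(hGsum j).tsum_prod, tsum_fintype]
    have h2 := hGtot j
    rw [h1, ← Finset.add_sum_erase _ _ (Finset.mem_univ j)] at h2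
    have h3 : ∑ i ∈ Finset.univ.erase j, ‖A i j‖ ≤
        ∑ i ∈ Finset.univ.erase j, ∑' γ : Γ, G j (i, γ) :=
      Finset.sum_le_sum fun i hi => hoff i j (Finset.ne_of_mem_erase hi)
    have := hdiag j
    linarith
  have hli : LinearIndependent ℂ P := by
    rw [Fintype.linearIndependent_iff]
    intro c hc
    refine congrFun (Matrix.eq_zero_of_vecMul_eq_zero hdet (funext fun j => ?_))
    have h1 := congrArg (fun f : Form Γ b => f.1 (z j) * ((z j).im : ℂ) ^ b) hc
    simp only [Submodule.coe_sum, Submodule.coe_smul, Finset.sum_apply, Pi.smul_apply,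
      Submodule.coe_zero, Pi.zero_apply, zero_mul, Finset.sum_mul, smul_eq_mul, mul_assoc] at h1
    exact h1
  exact hli.fintype_card_le_finrank

theorem exists_weight {σ : ℝ} (hσ : 0 < σ) :
    ∃ a : ℕ, 2 ≤ a ∧ ∀ b, a ≤ b →
      ((Real.cosh (σ / 2) ^ 2)⁻¹) ^ (b - 2) * sepConst σ < 1 := by
  have h1 : 1 < Real.cosh (σ / 2) ^ 2 :=
    one_lt_pow₀ (Real.one_lt_cosh.2 (by positivity)) two_ne_zero
  have h2 := inv_lt_one_of_one_lt₀ h1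
  have h0 : 0 < (Real.cosh (σ / 2) ^ 2)⁻¹ := by positivity
  have hS := sepConst_pos σ
  obtain ⟨N, hN⟩ := exists_pow_lt_of_lt_one (inv_pos.2 hS) h2
  refine ⟨N + 2, by omega, fun b hb => ?_⟩
  have h3 : ((Real.cosh (σ / 2) ^ 2)⁻¹) ^ (b - 2) ≤ ((Real.cosh (σ / 2) ^ 2)⁻¹) ^ N :=
    pow_le_pow_of_le_one h0.le h2.le (by omega)
  calc _ ≤ ((Real.cosh (σ / 2) ^ 2)⁻¹) ^ N * sepConst σ := by gcongr
    _ < (sepConst σ)⁻¹ * sepConst σ := by gcongr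
    _ = 1 := inv_mul_cancel₀ hS.ne'

end

/-! ### Periods of differentials of the second kind -/

section

/-- The function `p` is holomorphic, divisible by `φ` except at `z₀`, and solves the equation
`wronskian p φ = h` modulo `φ ^ 2` at `z₀`; in other words, `p / φ` has the principal part at `z₀`
of a primitive of `h / φ ^ 2`. -/
structure IsPrincipalPart (φ h : ℂ → ℂ) (z₀ : ℂ) (p : ℂ → ℂ) : Prop where
  differentiableOn : DifferentiableOn ℂ p upperHalfPlaneSet
  locDvd : ∀ w : ℂ, 0 < w.im → w ≠ z₀ → LocDvd φ p w
  locDvd_sub : LocDvd (φ ^ 2) (h - wronskian p φ) z₀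

/-- The Taylor coefficients of order `0, …, m - 2` and `2 m - 1` of `h / v ^ 2` obstruct the
existence of a meromorphic primitive with a pole of order at most `m` of `h / (z - z₀) ^ 2 m v ^ 2`.
-/
def obstructionAt (v : ℂ → ℂ) (z₀ : ℂ) (m i : ℕ) (h : ℂ → ℂ) : ℂ :=
  iteratedDeriv (if i + 1 < m then i else 2 * m - 1) (fun x => h (z₀ + x) / v (z₀ + x) ^ 2) 0

lemma analyticAt_obstruction {h v : ℂ → ℂ} {z₀ : ℂ} (hh : AnalyticAt ℂ h z₀)
    (hv : AnalyticAt ℂ v z₀) (hv0 : v z₀ ≠ 0) :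
    AnalyticAt ℂ (fun x => h (z₀ + x) / v (z₀ + x) ^ 2) 0 := by
  have hadd : AnalyticAt ℂ (fun x => z₀ + x) 0 := by fun_prop
  refine AnalyticAt.div ?_ (AnalyticAt.pow ?_ 2) (by simpa using hv0)
  · exact AnalyticAt.comp_of_eq hh hadd (by simp)
  · exact AnalyticAt.comp_of_eq hv hadd (by simp)

lemma wronskian_mul_mul {v A B : ℂ → ℂ} {z : ℂ} (hv : DifferentiableAt ℂ v z)
    (hA : DifferentiableAt ℂ A z) (hB : DifferentiableAt ℂ B z) :
    wronskian (v * A) (v * B) z = v z ^ 2 * wronskian A B z := by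
  rw [wronskian, deriv_mul hv hA, deriv_mul hv hB, wronskian]
  simp only [Pi.mul_apply]
  ring

/-- The Laurent expansion of h/φ² at `z₀` is integrated term by term. The obstructions exclude the m
- 1 terms of too high a pole order and the residue: m conditions in all, as many as the order of the
zero. -/
theorem exists_isPrincipalPart {φ h v : ℂ → ℂ} (hφ : DifferentiableOn ℂ φ upperHalfPlaneSet)
    (hh : DifferentiableOn ℂ h upperHalfPlaneSet) (hv : DifferentiableOn ℂ v upperHalfPlaneSet)
    {z₀ : ℂ} (hz₀ : 0 < z₀.im) (hv0 : v z₀ ≠ 0) {m : ℕ}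
    (hφv : ∀ z, 0 < z.im → φ z = (z - z₀) ^ m * v z)
    (hob : ∀ i < m, obstructionAt v z₀ m i h = 0) : ∃ p, IsPrincipalPart φ h z₀ p := by
  -- If m = 0, then φ does not vanish at `z₀` and the zero principal part serves.
  rcases Nat.eq_zero_or_pos m with rfl | hm
  · have h1 : (0 : ℂ → ℂ) = φ * 0 := by simp
    refine ⟨0, differentiableOn_const 0, fun w _ _ => ⟨0, analyticAt_const, by simp⟩, ?_⟩
    have h2 : wronskian 0 φ = 0 := by funext z; simp [wronskian]
    rw [h2, sub_zero]
    refine locDvd_of_ne_zero ((analyticAt_of_differentiableOn hφ hz₀).pow 2)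
      (analyticAt_of_differentiableOn hh hz₀) ?_
    rw [Pi.pow_apply, hφv z₀ hz₀]
    simpa using hv0
  set H : ℂ → ℂ := fun x => h (z₀ + x) / v (z₀ + x) ^ 2 with hH
  have hHa : AnalyticAt ℂ H 0 := analyticAt_obstruction (analyticAt_of_differentiableOn hh hz₀)
    (analyticAt_of_differentiableOn hv hz₀) hv0
  obtain ⟨r, hr, hTaylor⟩ := hHa.exists_eventuallyEq_sum_add_pow_mul (2 * m)
  set c : ℕ → ℂ := fun i => iteratedDeriv i H 0 / i.factorial with hc
  have hclow : ∀ i, i + 1 < m → c i = 0 := by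
    intro i hi
    have := hob i (by omega)
    rw [obstructionAt, if_pos hi] at this
    rw [hc]
    simp only
    rw [this, zero_div]
  have hctop : c (2 * m - 1) = 0 := by
    have := hob (m - 1) (by omega)
    rw [obstructionAt, if_neg (by omega)] at this
    rw [hc]
    simp only
    rw [this, zero_div]
  have hsum : ∀ x : ℂ, ∑ i ∈ Finset.range (2 * m), (x ^ i / i.factorial) • iteratedDeriv i H 0 =
      ∑ i ∈ Finset.range m, c (m - 1 + i) * x ^ (m - 1 + i) := by
    intro x
    have e : 2 * m = (m - 1 + m) + 1 := by omega
    have h1 : ∀ i, (x ^ i / i.factorial) • iteratedDeriv i H 0 = c i * x ^ i := by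
      intro i; rw [hc, smul_eq_mul]; ring
    simp only [h1]
    rw [e, Finset.sum_range_succ, Finset.sum_range_add,
      Finset.sum_eq_zero (s := Finset.range (m - 1)) fun i hi => ?_,
      show m - 1 + m = 2 * m - 1 by omega, hctop]
    · simp
    · rw [hclow i (by have := Finset.mem_range.1 hi; omega), zero_mul]
  -- The quotient P/X is the primitive: the term of exponent i - m - 1 integrates to exponent i - m,
  -- which is never 0 since i < m.
  set P : ℂ → ℂ := fun z => ∑ i ∈ Finset.range m,
    c (m - 1 + i) / ((i : ℂ) - m) * (z - z₀) ^ i with hP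
  have hPd : Differentiable ℂ P := by fun_prop
  set X : ℂ → ℂ := fun z => (z - z₀) ^ m with hX
  have hXd : Differentiable ℂ X := by fun_prop
  have hW : ∀ z, wronskian P X z =
      ∑ i ∈ Finset.range m, c (m - 1 + i) * (z - z₀) ^ (m - 1 + i) := by
    intro z
    have h1 : deriv P z = ∑ i ∈ Finset.range m,
        c (m - 1 + i) / ((i : ℂ) - m) * (i * (z - z₀) ^ (i - 1)) := by
      refine HasDerivAt.deriv (HasDerivAt.fun_sum fun i _ => ?_)
      refine HasDerivAt.const_mul _ ?_
      simpa using ((hasDerivAt_id' z).sub_const z₀).fun_pow i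
    have h2 : deriv X z = m * (z - z₀) ^ (m - 1) := by
      refine HasDerivAt.deriv ?_
      simpa [hX] using ((hasDerivAt_id' z).sub_const z₀).fun_pow m
    rw [wronskian, h1, h2, hP, hX]
    simp only
    rw [Finset.sum_mul, Finset.sum_mul, ← Finset.sum_sub_distrib]
    refine Finset.sum_congr rfl fun i hi => ?_
    have h3 : (i : ℂ) - m ≠ 0 := by
      rw [sub_ne_zero]
      exact_mod_cast (Finset.mem_range.1 hi).ne
    have h4 : (i : ℂ) * (z - z₀) ^ (i - 1) * (z - z₀) ^ m = i * (z - z₀) ^ (m - 1 + i) := by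
      rcases Nat.eq_zero_or_pos i with rfl | hi0
      · simp
      · rw [mul_assoc, ← pow_add]; congr 2; omega
    have h5 : (z - z₀) ^ i * (z - z₀) ^ (m - 1) = (z - z₀) ^ (m - 1 + i) := by
      rw [← pow_add]; congr 1; omega
    calc _ = c (m - 1 + i) / ((i : ℂ) - m) * ((i : ℂ) * (z - z₀) ^ (i - 1) * (z - z₀) ^ m)
          - c (m - 1 + i) / ((i : ℂ) - m) * m * ((z - z₀) ^ i * (z - z₀) ^ (m - 1)) := by ring
      _ = c (m - 1 + i) / ((i : ℂ) - m) * ((i : ℂ) - m) * (z - z₀) ^ (m - 1 + i) := by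
        rw [h4, h5]; ring
      _ = _ := by rw [div_mul_cancel₀ _ h3]
  have hφX : ∀ z : ℂ, 0 < z.im → φ =ᶠ[𝓝 z] v * X := by
    intro z hz
    filter_upwards [mem_nhds_upperHalfPlaneSet hz] with w hw
    rw [hφv w hw, Pi.mul_apply, mul_comm]
  refine ⟨v * P, hv.mul hPd.differentiableOn, fun w hw hne => ?_, ?_⟩
  · refine ⟨P / X, (hPd.analyticAt w).div (hXd.analyticAt w)
      (pow_ne_zero _ (sub_ne_zero.2 hne)), ?_⟩
    filter_upwards [hφX w hw, isOpen_ne.mem_nhds hne] with x hx hne'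
    have : X x ≠ 0 := pow_ne_zero _ (sub_ne_zero.2 hne')
    rw [Pi.mul_apply, Pi.mul_apply, hx, Pi.mul_apply, Pi.div_apply]
    field_simp
  · refine ⟨fun z => r (z - z₀), ?_, ?_⟩
    · exact AnalyticAt.comp_of_eq hr (by fun_prop) (by simp)
    have hsub : Tendsto (fun z => z - z₀) (𝓝 z₀) (𝓝 0) := by
      have : ContinuousAt (fun z => z - z₀) z₀ := by fun_prop
      simpa [ContinuousAt] using this
    filter_upwards [hsub.eventually hTaylor, mem_nhds_upperHalfPlaneSet hz₀,
      (analyticAt_of_differentiableOn hv hz₀).continuousAt.eventually_ne hv0] with z h1 hz h2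
    rw [hsum, ← hW, hH] at h1
    simp only [add_sub_cancel, smul_eq_mul] at h1
    rw [Pi.sub_apply, wronskian_congr EventuallyEq.rfl (hφX z hz),
      wronskian_mul_mul (hv.differentiableAt (mem_nhds_upperHalfPlaneSet hz)) (hPd z) (hXd z),
      Pi.mul_apply, Pi.pow_apply, hφv z hz]
    have h3 : h z = v z ^ 2 * (wronskian P X z + (z - z₀) ^ (2 * m) * r (z - z₀)) := by
      rw [← h1, mul_div_cancel₀ _ (pow_ne_zero 2 h2)]
    rw [h3]
    ring

section

variable {Γ : Type*} [Group Γ] [MulAction Γ ℍ] [IsCocompactAction Γ]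

/-- The terms containing the derivative of the automorphy factor cancel by antisymmetry; the chain
rule adds one to the weight 2a. -/
lemma wronskian_slash (a : ℕ) (γ : Γ) {g φ : ℂ → ℂ} (hg : DifferentiableOn ℂ g upperHalfPlaneSet)
    (hφ : DifferentiableOn ℂ φ upperHalfPlaneSet) {z : ℂ} (hz : 0 < z.im) :
    wronskian (slash a γ g) (slash a γ φ) z = slash (2 * a + 1) γ (wronskian g φ) z := by
  have hγ := (differentiableAt_act γ hz).hasDerivAt
  have hj := (((differentiableOn_jac γ).differentiableAt
    (mem_nhds_upperHalfPlaneSet hz)).fun_pow a).hasDerivAt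
  have key : ∀ f : ℂ → ℂ, DifferentiableOn ℂ f upperHalfPlaneSet →
      deriv (slash a γ f) z = deriv f (act γ z) * jac γ z * jac γ z ^ a +
        f (act γ z) * deriv (fun z => jac γ z ^ a) z := by
    intro f hf
    have hf' := (hf.differentiableAt (mem_nhds_upperHalfPlaneSet (act_im_pos γ z))).hasDerivAt
    exact ((hf'.comp z hγ).mul hj).deriv
  rw [wronskian, key g hg, key φ hφ]
  simp only [slash, wronskian]
  ring

lemma LocDvd.slash {F f : ℂ → ℂ} {γ : Γ} {z : ℂ} (hz : 0 < z.im) (k n : ℕ)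
    (h : LocDvd F f (act γ z)) : LocDvd (slash k γ F) (slash (k + n) γ f) z := by
  obtain ⟨q, hq, hfq⟩ := h
  have hγ := analyticAt_of_differentiableOn (IsCocompactAction.differentiableOn_act γ) hz
  refine ⟨(q ∘ act γ) * jac γ ^ n, (hq.comp hγ).mul
    ((analyticAt_of_differentiableOn (differentiableOn_jac γ) hz).pow n), ?_⟩
  filter_upwards [hγ.continuousAt.eventually hfq] with w hw
  simp only [BersSpace.slash, Pi.mul_apply, Pi.pow_apply, Function.comp_apply] at hw ⊢
  rw [hw]
  ring

lemma LocDvd.congr_left {F G f : ℂ → ℂ} {z : ℂ} (hf : LocDvd F f z) (h : F =ᶠ[𝓝 z] G) :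
    LocDvd G f z := by
  obtain ⟨p, hp, hpf⟩ := hf
  exact ⟨p, hp, hpf.trans (h.mul EventuallyEq.rfl)⟩

/-- Principal parts are carried along orbits, so obstructions need only vanish at the
representatives in `Z`. -/
lemma IsPrincipalPart.slash {a : ℕ} {φ h p : ℂ → ℂ} {z₀ : ℂ} (hz₀ : 0 < z₀.im)
    (hφ : IsForm Γ a φ) (hh : IsForm Γ (2 * a + 1) h) (hp : IsPrincipalPart φ h z₀ p) (γ : Γ) :
    IsPrincipalPart φ h (act γ z₀) (slash a γ⁻¹ p) := by
  refine ⟨differentiableOn_slash _ hp.differentiableOn, fun w hw hne => ?_, ?_⟩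
  · have h1 : act γ⁻¹ w ≠ z₀ := fun h1 => hne (by rw [← h1, act_act_inv γ hw])
    exact ((hp.locDvd _ (act_im_pos γ⁻¹ w) h1).slash hw a 0).congr_left
      (hφ.slash_eventuallyEq γ⁻¹ hw)
  · have hw := act_im_pos γ z₀
    have h1 : LocDvd (φ ^ 2) (h - wronskian p φ) (act γ⁻¹ (act γ z₀)) := by
      rw [act_inv_act γ hz₀]; exact hp.locDvd_sub
    have h5 : BersSpace.slash (a + a) γ⁻¹ (φ ^ 2) =ᶠ[𝓝 (act γ z₀)] φ ^ 2 := by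
      rw [sq]; exact (hφ.mul hφ).slash_eventuallyEq γ⁻¹ hw
    have h2 := (h1.slash hw (a + a) 1).congr_left h5
    refine h2.congr ?_
    filter_upwards [mem_nhds_upperHalfPlaneSet hw] with x hx
    have h3 := hh.slash_eq γ⁻¹ x hx
    have h4 := wronskian_slash a γ⁻¹ hp.differentiableOn hφ.differentiableOn hx
    rw [wronskian_congr EventuallyEq.rfl (hφ.slash_eventuallyEq γ⁻¹ hx)] at h4
    rw [Pi.sub_apply, h4, ← h3, ← two_mul]
    simp only [BersSpace.slash, Pi.sub_apply]
    ring

end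

/-! ### Solving the Wronskian equation -/

lemma isOpen_coe_ball (b : ℍ) (r : ℝ) : IsOpen ((↑) '' ball b r : Set ℂ) :=
  isOpenEmbedding_coe.isOpenMap _ isOpen_ball

lemma coe_ball_subset (b : ℍ) (r : ℝ) : ((↑) '' ball b r : Set ℂ) ⊆ upperHalfPlaneSet := by
  rintro _ ⟨w, _, rfl⟩
  exact w.im_pos

/-- The ball contains finitely many zeros of φ. After subtracting their principal parts, the
right-hand side is φ² q with q holomorphic, and a primitive R of q completes the solution by φR. -/
theorem exists_wronskian_eq_on_ball {φ h : ℂ → ℂ} (hφ : DifferentiableOn ℂ φ upperHalfPlaneSet)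
    (htop : ∀ z : ℂ, 0 < z.im → analyticOrderAt φ z ≠ ⊤)
    (hh : DifferentiableOn ℂ h upperHalfPlaneSet)
    (hpp : ∀ z : ℍ, φ z = 0 → ∃ p, IsPrincipalPart φ h z p) (b : ℍ) (r : ℝ) :
    ∃ g, DifferentiableOn ℂ g ((↑) '' ball b r) ∧
      ∀ z ∈ ((↑) '' ball b r : Set ℂ), wronskian g φ z = h z := by
  classical
  have hfin := finite_zeros_inter hφ htop (isCompact_closedBall b r)
  set Z := hfin.toFinset with hZ
  have hZφ : ∀ z ∈ Z, φ z = 0 := fun z hz => ((hfin.mem_toFinset).1 hz).2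
  choose! p hp using hpp
  set g₀ : ℂ → ℂ := ∑ z ∈ Z, p z with hg₀
  set V : Set ℂ := (↑) '' ball b r with hV
  have hVo : IsOpen V := isOpen_coe_ball b r
  have hVU : V ⊆ upperHalfPlaneSet := coe_ball_subset b r
  have hpd : ∀ z ∈ Z, ∀ w : ℂ, 0 < w.im → DifferentiableAt ℂ (p z) w := fun z hz w hw =>
    (hp z (hZφ z hz)).differentiableOn.differentiableAt (mem_nhds_upperHalfPlaneSet hw)
  have hφd : ∀ w : ℂ, 0 < w.im → DifferentiableAt ℂ φ w := fun w hw =>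
    hφ.differentiableAt (mem_nhds_upperHalfPlaneSet hw)
  have hWsum : ∀ w : ℂ, 0 < w.im → wronskian g₀ φ w = ∑ z ∈ Z, wronskian (p z) φ w :=
    fun w hw => wronskian_sum fun z hz => hpd z hz w hw
  have hdvd : ∀ w ∈ V, LocDvd (φ ^ 2) (h - ∑ z ∈ Z, wronskian (p z) φ) w := by
    intro w hw
    have hwU : 0 < w.im := hVU hw
    have hφw := analyticAt_of_differentiableOn hφ hwU
    obtain ⟨w', hw', rfl⟩ := hw
    by_cases h0 : φ w' = 0
    · have hwZ : w' ∈ Z := hfin.mem_toFinset.2 ⟨ball_subset_closedBall hw', h0⟩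
      rw [← Finset.add_sum_erase _ _ hwZ, ← sub_sub]
      refine (hp w' h0).locDvd_sub.sub (LocDvd.sum fun z hz => ?_)
      refine LocDvd.wronskian hφw ((hp z (hZφ z (Finset.mem_of_mem_erase hz))).locDvd _ hwU ?_)
      exact fun h1 => Finset.ne_of_mem_erase hz (UpperHalfPlane.ext h1).symm
    · refine locDvd_of_ne_zero (hφw.pow 2) ?_ (by simpa using h0)
      refine (analyticAt_of_differentiableOn hh hwU).sub (Finset.analyticAt_sum _ fun z hz => ?_)
      have hpz := analyticAt_of_differentiableOn (hp z (hZφ z hz)).differentiableOn hwU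
      exact (hpz.deriv.mul hφw).sub (hpz.mul hφw.deriv)
  obtain ⟨q, hq, -, hqeq⟩ := exists_eq_mul_of_locDvd hVo ((hφ.pow 2).mono hVU) (fun w hw => by
    rw [analyticOrderAt_pow (analyticAt_of_differentiableOn hφ (hVU hw)), nsmul_eq_mul]
    exact WithTop.mul_ne_top (ENat.natCast_ne_top 2) (htop w (hVU hw))) hdvd
  have hq' := hq
  -- A hyperbolic ball is a Euclidean disc, on which holomorphic functions have primitives.
  rw [hV, image_coe_ball] at hq'
  obtain ⟨R, hR⟩ := hq'.isExactOn_ball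
  rw [← image_coe_ball, ← hV] at hR
  have hg₀d : ∀ w ∈ V, DifferentiableAt ℂ g₀ w := fun w hw =>
    DifferentiableAt.sum fun z hz => hpd z hz w (hVU hw)
  have hφRd : ∀ w ∈ V, DifferentiableAt ℂ (φ * R) w := fun w hw =>
    (hφd w (hVU hw)).mul (hR w hw).differentiableAt
  refine ⟨g₀ + φ * R, fun w hw => ((hg₀d w hw).add (hφRd w hw)).differentiableWithinAt,
    fun w hw => ?_⟩
  have h1 := hqeq w hw
  rw [wronskian_add (hg₀d w hw) (hφRd w hw), hWsum w (hVU hw),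
    wronskian_mul_self (hφd w (hVU hw)) (hR w hw).differentiableAt, (hR w hw).deriv]
  rw [Pi.sub_apply, Finset.sum_apply, Pi.pow_apply] at h1
  rw [← h1]
  ring

/-- Two solutions on a ball differ by a multiple of φ. Normalized to vanish at `b`, where φ does
not, the solutions on growing balls agree and glue. -/
theorem exists_wronskian_eq {φ h : ℂ → ℂ} (hφ : DifferentiableOn ℂ φ upperHalfPlaneSet)
    (htop : ∀ z : ℂ, 0 < z.im → analyticOrderAt φ z ≠ ⊤)
    (hh : DifferentiableOn ℂ h upperHalfPlaneSet)
    (hpp : ∀ z : ℍ, φ z = 0 → ∃ p, IsPrincipalPart φ h z p) {b : ℍ} (hb : φ b ≠ 0) :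
    ∃ g, DifferentiableOn ℂ g upperHalfPlaneSet ∧ (∀ z, ¬ 0 < z.im → g z = 0) ∧
      ∀ z : ℂ, 0 < z.im → wronskian g φ z = h z := by
  have hφd : ∀ w : ℂ, 0 < w.im → DifferentiableAt ℂ φ w := fun w hw =>
    hφ.differentiableAt (mem_nhds_upperHalfPlaneSet hw)
  set V : ℕ → Set ℂ := fun n => (↑) '' ball b ((n : ℝ) + 1) with hV
  have hVo : ∀ n, IsOpen (V n) := fun n => isOpen_coe_ball b _
  have hVU : ∀ n, V n ⊆ upperHalfPlaneSet := fun n => coe_ball_subset b _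
  have hbV : ∀ n, (b : ℂ) ∈ V n := fun n => ⟨b, mem_ball_self (by positivity), rfl⟩
  have hsol : ∀ n, ∃ g, DifferentiableOn ℂ g (V n) ∧ (∀ z ∈ V n, wronskian g φ z = h z) ∧
      g b = 0 := by
    intro n
    obtain ⟨g, hg, hgW⟩ := exists_wronskian_eq_on_ball hφ htop hh hpp b ((n : ℝ) + 1)
    have hcφ : DifferentiableOn ℂ ((g b / φ b) • φ) (V n) := (hφ.mono (hVU n)).const_smul _
    refine ⟨g - (g b / φ b) • φ, hg.sub hcφ, fun z hz => ?_, ?_⟩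
    · rw [wronskian_sub (hg.differentiableAt ((hVo n).mem_nhds hz))
        (hcφ.differentiableAt ((hVo n).mem_nhds hz)), wronskian_smul, wronskian_self, mul_zero,
        sub_zero, hgW z hz]
    · simp [div_mul_cancel₀ _ hb]
  choose G hGd hGW hGb using hsol
  have hmono : ∀ n m, n ≤ m → V n ⊆ V m := fun n m hnm =>
    image_mono (ball_subset_ball (by gcongr))
  have heq' : ∀ n m, n ≤ m → ∀ z ∈ V n, G n z = G m z := by
    intro n m hnm z hz
    have hGm := (hGd m).mono (hmono n m hnm)
    have hpre : IsPreconnected (V n) := by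
      rw [hV]; simp only; rw [image_coe_ball]; exact (convex_ball _ _).isPreconnected
    have h1 := eq_const_mul_of_wronskian_eq_zero (hVo n) hpre ((hGd n).sub hGm)
      (hφ.mono (hVU n)) (fun w hw => by
        rw [wronskian_sub ((hGd n).differentiableAt ((hVo n).mem_nhds hw))
          (hGm.differentiableAt ((hVo n).mem_nhds hw)), hGW n w hw, hGW m w (hmono n m hnm hw),
          sub_self]) (hbV n) hb z hz
    rw [Pi.sub_apply, Pi.sub_apply, hGb, hGb, sub_self, zero_div, zero_mul] at h1
    exact sub_eq_zero.1 h1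
  have heq : ∀ n m, ∀ z ∈ V n, z ∈ V m → G n z = G m z := by
    intro n m z hn hm
    rcases le_total n m with h1 | h1
    · exact heq' n m h1 z hn
    · exact (heq' m n h1 z hm).symm
  have hN : ∀ z : ℂ, 0 < z.im → ∃ n, z ∈ V n := by
    intro z hz
    obtain ⟨n, hn⟩ := exists_nat_gt (dist (⟨z, hz⟩ : ℍ) b)
    exact ⟨n, ⟨z, hz⟩, by rw [mem_ball]; linarith, rfl⟩
  choose! N hN using hN
  have hloc : ∀ n, ∀ z ∈ V n, (fun z : ℂ => if 0 < z.im then G (N z) z else 0) =ᶠ[𝓝 z] G n := by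
    intro n z hz
    filter_upwards [(hVo n).mem_nhds hz] with w hw
    have hwU : 0 < w.im := hVU n hw
    rw [if_pos hwU]
    exact heq _ _ w (hN w hwU) hw
  refine ⟨fun z => if 0 < z.im then G (N z) z else 0, fun z hz => ?_, fun z hz => if_neg hz,
    fun z hz => ?_⟩
  · have hzN := hN z hz
    exact (((hGd _).differentiableAt ((hVo _).mem_nhds hzN)).congr_of_eventuallyEq
      (hloc _ z hzN)).differentiableWithinAt
  · have hzN := hN z hz
    rw [wronskian_congr (hloc _ z hzN) EventuallyEq.rfl, hGW _ z hzN]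

end

/-! ### Functions of the second kind -/

section

variable {Γ : Type*} [Group Γ] [MulAction Γ ℍ]

variable (Γ) in
/-- The obstructions at all points of `Z` to the solution of `wronskian g φ = h`. -/
def obstruction (φ : ℂ → ℂ) (Z : Finset ℍ) (k : ℕ) (v : ℍ → ℂ → ℂ)
    (hv : ∀ z : Z, DifferentiableOn ℂ (v z) upperHalfPlaneSet) (hv0 : ∀ z : Z, v z z.1 ≠ 0) :
    Form Γ k →ₗ[ℂ] (JetIndex φ Z → ℂ) where
  toFun f := fun i => obstructionAt (v i.1) i.1.1 (analyticOrderNatAt φ i.1.1) i.2 f.1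
  map_add' f g := funext fun i => by
    have hv' := analyticAt_of_differentiableOn (hv i.1) i.1.1.im_pos
    have hf := analyticAt_obstruction (IsForm.analyticAt f.2 i.1.1.im_pos) hv' (hv0 i.1)
    have hg := analyticAt_obstruction (IsForm.analyticAt g.2 i.1.1.im_pos) hv' (hv0 i.1)
    refine Eq.trans ?_ (iteratedDeriv_fun_add hf.contDiffAt hg.contDiffAt)
    simp only [obstructionAt, Submodule.coe_add, Pi.add_apply, add_div]
  map_smul' c f := funext fun i => by
    simp only [obstructionAt, Submodule.coe_smul, Pi.smul_apply, smul_eq_mul, mul_div_assoc,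
      RingHom.id_apply]
    rw [iteratedDeriv_const_mul_field]

variable (Γ) in
/-- The holomorphic functions `g` whose Wronskian with the `a`-differential `φ` is a
`(2 a + 1)`-differential: the quotients `g / φ` are the primitives of the meromorphic differentials
of the second kind with poles bounded by the zeros of `φ`. -/
structure IsSecondKind (a : ℕ) (φ g : ℂ → ℂ) : Prop where
  differentiableOn : DifferentiableOn ℂ g upperHalfPlaneSet
  eq_zero : ∀ z, ¬ 0 < z.im → g z = 0
  slash_wronskian : ∀ γ : Γ, ∀ z, 0 < z.im →
    slash (2 * a + 1) γ (wronskian g φ) z = wronskian g φ z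

variable (Γ) in
/-- The space of functions `g` such that `IsSecondKind Γ a φ g`. -/
def SecondKind (a : ℕ) (φ : ℂ → ℂ) : Submodule ℂ (ℂ → ℂ) where
  carrier := {g | IsSecondKind Γ a φ g}
  add_mem' := by
    rintro f g ⟨h1, h2, h3⟩ ⟨k1, k2, k3⟩
    have key : ∀ z : ℂ, 0 < z.im → wronskian (f + g) φ z = wronskian f φ z + wronskian g φ z :=
      fun z hz => wronskian_add (h1.differentiableAt (mem_nhds_upperHalfPlaneSet hz))
        (k1.differentiableAt (mem_nhds_upperHalfPlaneSet hz))
    refine ⟨h1.add k1, fun z hz => by simp [h2 z hz, k2 z hz], fun γ z hz => ?_⟩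
    rw [key z hz, ← h3 γ z hz, ← k3 γ z hz]
    simp only [slash]
    rw [key _ (act_im_pos γ z), add_mul]
  zero_mem' := ⟨differentiableOn_const 0, fun _ _ => rfl, fun γ z _ => by
    simp [slash, wronskian]⟩
  smul_mem' := by
    rintro c f ⟨h1, h2, h3⟩
    refine ⟨h1.const_smul c, fun z hz => by simp [h2 z hz], fun γ z hz => ?_⟩
    rw [wronskian_smul, ← h3 γ z hz]
    simp only [slash]
    rw [wronskian_smul, mul_assoc]

variable (Γ) in
/-- The Wronskian with `φ`, as a linear map. -/
def wronskianMap (a : ℕ) {φ : ℂ → ℂ} (hφ : DifferentiableOn ℂ φ upperHalfPlaneSet) :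
    SecondKind Γ a φ →ₗ[ℂ] Form Γ (2 * a + 1) where
  toFun g := ⟨fun z => if 0 < z.im then wronskian g.1 φ z else 0, by
    have hg : IsSecondKind Γ a φ g.1 := g.2
    refine ⟨fun z hz => ?_, fun z hz => if_neg hz, fun γ z hz => ?_⟩
    · have hz' : 0 < z.im := hz
      have h1 := analyticAt_of_differentiableOn hg.differentiableOn hz'
      have h2 := analyticAt_of_differentiableOn hφ hz'
      have h3 : DifferentiableAt ℂ (wronskian g.1 φ) z :=
        ((h1.deriv.mul h2).sub (h1.mul h2.deriv)).differentiableAt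
      refine (h3.congr_of_eventuallyEq ?_).differentiableWithinAt
      filter_upwards [mem_nhds_upperHalfPlaneSet hz'] with w hw
      exact if_pos hw
    · rw [slash, if_pos (act_im_pos γ z), if_pos hz]
      exact hg.slash_wronskian γ z hz⟩
  map_add' f g := Subtype.ext (funext fun z => by
    have hf : IsSecondKind Γ a φ f.1 := f.2
    have hg : IsSecondKind Γ a φ g.1 := g.2
    by_cases hz : 0 < z.im
    · simp only [Submodule.coe_add, Pi.add_apply, if_pos hz]
      exact wronskian_add (hf.1.differentiableAt (mem_nhds_upperHalfPlaneSet hz))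
        (hg.1.differentiableAt (mem_nhds_upperHalfPlaneSet hz))
    · simp [hz])
  map_smul' c f := Subtype.ext (funext fun z => by
    by_cases hz : 0 < z.im
    · simp [hz, wronskian_smul]
    · simp [hz])

section

variable {a : ℕ} {φ : ℂ → ℂ} {b : ℍ}

lemma nontrivial_ker_wronskianMap (hφ : IsForm Γ a φ) (h0 : φ ≠ 0) :
    Nontrivial (LinearMap.ker (wronskianMap Γ a hφ.differentiableOn)) := by
  have hmem : IsSecondKind Γ a φ φ := by
    have h1 : wronskian φ φ = 0 := funext (wronskian_self φ)
    exact ⟨hφ.differentiableOn, hφ.eq_zero, fun γ z _ => by simp [h1, slash]⟩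
  have hker : (⟨φ, hmem⟩ : SecondKind Γ a φ) ∈
      LinearMap.ker (wronskianMap Γ a hφ.differentiableOn) := by
    refine Subtype.ext (funext fun z => ?_)
    simp [wronskianMap, wronskian_self]
  exact ⟨⟨_, hker⟩, 0, fun h => h0 (by simpa using congrArg (fun x => x.1.1) h)⟩

variable [IsCocompactAction Γ]

/-- There is one linear obstruction for each zero counted with multiplicity, and a form of weight 2a
+ 1 with no obstruction is a Wronskian. -/
theorem finrank_form_le_range_wronskianMap (hφ : IsForm Γ a φ) (h0 : φ ≠ 0) {Z : Finset ℍ}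
    (hZ : IsZeroSystem Γ φ Z) : Module.finrank ℂ (Form Γ (2 * a + 1)) ≤
      zeroCount φ Z +
        Module.finrank ℂ (LinearMap.range (wronskianMap Γ a hφ.differentiableOn)) := by
  have htop : ∀ z : ℂ, 0 < z.im → analyticOrderAt φ z ≠ ⊤ := fun z hz =>
    hφ.analyticOrderAt_ne_top h0 hz
  have hv : ∀ z : ℍ, ∃ v : ℂ → ℂ, DifferentiableOn ℂ v upperHalfPlaneSet ∧ v z ≠ 0 ∧
      ∀ w, 0 < w.im → φ w = (w - z) ^ analyticOrderNatAt φ z * v w := fun z =>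
    exists_eq_pow_mul hφ.differentiableOn z.im_pos (htop z z.im_pos)
  choose v hvd hv0 hvφ using hv
  set ob := obstruction Γ φ Z (2 * a + 1) v (fun z => hvd z) (fun z => hv0 z)
  obtain ⟨b, hb⟩ : ∃ b : ℍ, φ b ≠ 0 := by
    by_contra hcon
    push Not at hcon
    refine h0 (funext fun z => ?_)
    by_cases hz : 0 < z.im
    · exact hcon ⟨z, hz⟩
    · exact hφ.eq_zero z hz
  have hle : LinearMap.ker ob ≤ LinearMap.range (wronskianMap Γ a hφ.differentiableOn) := by
    intro h hh
    have hform : IsForm Γ (2 * a + 1) h.1 := h.2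
    have hpp : ∀ z : ℍ, φ z = 0 → ∃ p, IsPrincipalPart φ h.1 z p := by
      intro w hw
      obtain ⟨z, hz, γ, rfl⟩ := hZ.exists_smul_eq w hw
      obtain ⟨p, hp⟩ := exists_isPrincipalPart hφ.differentiableOn hform.differentiableOn (hvd z)
        z.im_pos (hv0 z) (hvφ z) fun i hi => congrFun hh ⟨⟨z, hz⟩, ⟨i, hi⟩⟩
      rw [← act_coe]
      exact ⟨_, hp.slash z.im_pos hφ hform γ⟩
    obtain ⟨g, hg, hg0, hgW⟩ := exists_wronskian_eq hφ.differentiableOn htop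
      hform.differentiableOn hpp hb
    have hmem : IsSecondKind Γ a φ g := by
      refine ⟨hg, hg0, fun γ z hz => ?_⟩
      rw [slash, hgW _ (act_im_pos γ z), hgW z hz]
      exact hform.slash_eq γ z hz
    refine ⟨⟨g, hmem⟩, Subtype.ext (funext fun z => ?_)⟩
    by_cases hz : 0 < z.im
    · simp [wronskianMap, hz, hgW z hz]
    · simp [wronskianMap, hz, hform.eq_zero z hz]
  rw [← LinearMap.finrank_range_add_finrank_ker ob]
  refine add_le_add ?_ (Submodule.finrank_mono hle)
  refine (Submodule.finrank_le _).trans ?_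
  rw [Module.finrank_fintype_fun_eq_card, zeroCount]

/-- The period of `g / φ` along `γ`. -/
def period (a : ℕ) (φ : ℂ → ℂ) (b : ℍ) (γ : Γ) (g : ℂ → ℂ) : ℂ := (slash a γ g b - g b) / φ b

/-- The difference of `slash a γ g` and `g` has zero Wronskian with φ, so it is a constant multiple
of φ; evaluation at `b` gives the constant. -/
lemma IsSecondKind.slash_eq {g : ℂ → ℂ} (hφ : IsForm Γ a φ) (hb : φ b ≠ 0)
    (hg : IsSecondKind Γ a φ g) (γ : Γ) {z : ℂ} (hz : 0 < z.im) :
    slash a γ g z = g z + period a φ b γ g * φ z := by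
  have hs := differentiableOn_slash (k := a) γ hg.differentiableOn
  have h1 := eq_const_mul_of_wronskian_eq_zero isOpen_upperHalfPlaneSet
    isPreconnected_upperHalfPlaneSet (hs.sub hg.differentiableOn) hφ.differentiableOn
    (fun w hw => by
      have hw' : 0 < w.im := hw
      rw [wronskian_sub (hs.differentiableAt (mem_nhds_upperHalfPlaneSet hw'))
        (hg.differentiableOn.differentiableAt (mem_nhds_upperHalfPlaneSet hw')),
        ← wronskian_congr EventuallyEq.rfl (hφ.slash_eventuallyEq γ hw'),
        wronskian_slash a γ hg.differentiableOn hφ.differentiableOn hw',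
        hg.slash_wronskian γ w hw', sub_self]) (b := b) b.im_pos hb z hz
  rw [Pi.sub_apply, Pi.sub_apply, sub_eq_iff_eq_add'] at h1
  exact h1

lemma period_mul {g : ℂ → ℂ} (hφ : IsForm Γ a φ) (hb : φ b ≠ 0) (hg : IsSecondKind Γ a φ g)
    (γ δ : Γ) : period a φ b (γ * δ) g = period a φ b γ g + period a φ b δ g := by
  have h1 : slash a δ (slash a γ g) b = slash a δ g b + period a φ b γ g * φ b := by
    rw [← hφ.slash_eq δ b b.im_pos]
    simp only [slash]
    rw [← slash, hg.slash_eq hφ hb γ (act_im_pos δ b)]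
    ring
  rw [slash_slash a γ δ g b.im_pos, hg.slash_eq hφ hb _ b.im_pos, hg.slash_eq hφ hb _ b.im_pos,
    add_assoc, ← add_mul] at h1
  rw [mul_right_cancel₀ hb (add_left_cancel h1), add_comm]

/-- The periods, as a linear map to the space of homomorphisms from `Γ` to `ℂ`. -/
def periodMap (hφ : IsForm Γ a φ) (hb : φ b ≠ 0) :
    SecondKind Γ a φ →ₗ[ℂ] (Additive Γ →+ ℂ) where
  toFun g := AddMonoidHom.mk' (fun γ => period a φ b γ.toMul g.1)
    fun γ δ => period_mul hφ hb g.2 γ.toMul δ.toMul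
  map_add' f g := by
    ext γ
    simp [period, slash]
    ring
  map_smul' c g := by
    ext γ
    simp [period, slash]
    ring

/-- If all periods vanish, `g` is itself an a-differential. -/
lemma exists_ker_periodMap_injective (hφ : IsForm Γ a φ) (hb : φ b ≠ 0) :
    ∃ f : LinearMap.ker (periodMap hφ hb) →ₗ[ℂ] Form Γ a, Function.Injective f := by
  refine ⟨LinearMap.codRestrict (Form Γ a)
    ((SecondKind Γ a φ).subtype ∘ₗ (LinearMap.ker (periodMap hφ hb)).subtype) ?_, ?_⟩
  · rintro ⟨g, hg⟩
    have hg' : IsSecondKind Γ a φ g.1 := g.2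
    refine ⟨hg'.differentiableOn, hg'.eq_zero, fun γ z hz => ?_⟩
    have h1 : period a φ b γ g.1 = 0 := DFunLike.congr_fun hg (Additive.ofMul γ)
    have h2 := hg'.slash_eq hφ hb γ hz
    rwa [h1, zero_mul, add_zero] at h2
  · intro g h hgh
    exact Subtype.ext (Subtype.ext (congrArg (fun x => x.1) hgh))

variable (Γ) in
-- Rank–nullity for `periodMap` bounds dim `SecondKind` above by dim Hom(Γ, ℂ) + dim Form(a); for
-- `wronskianMap` it bounds it below. The summand 1 comes from φ itself, which lies in the kernel of
-- the latter.
theorem finrank_form_two_mul_add_one_le [FiniteDimensional ℂ (Additive Γ →+ ℂ)]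
    (hφ : IsForm Γ a φ) (h0 : φ ≠ 0) {Z : Finset ℍ} (hZ : IsZeroSystem Γ φ Z) :
    Module.finrank ℂ (Form Γ (2 * a + 1)) + 1 ≤
      Module.finrank ℂ (Additive Γ →+ ℂ) + Module.finrank ℂ (Form Γ a) + zeroCount φ Z := by
  obtain ⟨b, hb⟩ : ∃ b : ℍ, φ b ≠ 0 := by
    by_contra hcon
    push Not at hcon
    refine h0 (funext fun z => ?_)
    by_cases hz : 0 < z.im
    · exact hcon ⟨z, hz⟩
    · exact hφ.eq_zero z hz
  obtain ⟨f, hf⟩ := exists_ker_periodMap_injective hφ hb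
  have : FiniteDimensional ℂ (LinearMap.ker (periodMap hφ hb)) := Module.Finite.of_injective f hf
  have : FiniteDimensional ℂ (SecondKind Γ a φ ⧸ LinearMap.ker (periodMap hφ hb)) :=
    Module.Finite.equiv (periodMap hφ hb).quotKerEquivRange.symm
  have : FiniteDimensional ℂ (SecondKind Γ a φ) :=
    Module.Finite.of_submodule_quotient (LinearMap.ker (periodMap hφ hb))
  have h1 := LinearMap.finrank_le_finrank_of_injective hf
  have h2 := LinearMap.finrank_range_add_finrank_ker (periodMap hφ hb)
  have h3 := LinearMap.finrank_range_add_finrank_ker (wronskianMap Γ a hφ.differentiableOn)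
  have := nontrivial_ker_wronskianMap hφ h0
  have h4 : 0 < Module.finrank ℂ (LinearMap.ker (wronskianMap Γ a hφ.differentiableOn)) :=
    Module.finrank_pos (R := ℂ) (M := LinearMap.ker (wronskianMap Γ a hφ.differentiableOn))
  have h5 := finrank_form_le_range_wronskianMap hφ h0 hZ
  have h6 := Submodule.finrank_le (LinearMap.range (periodMap hφ hb))
  omega

end

end

/-! ### Separated points and homomorphisms to `ℂ` -/

section

/-- A bound, linear in the dimension of `Γ →+ ℂ`, for the number of separated orbits of `Γ`. -/
theorem exists_card_le_mul_finrank {σ : ℝ} (hσ : 0 < σ) :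
    ∃ a : ℕ, ∀ (Γ : Type) [Group Γ] [MulAction Γ ℍ] [IsCocompactAction Γ]
      [FiniteDimensional ℂ (Additive Γ →+ ℂ)], (∀ γ : Γ, γ ≠ 1 → ∀ z : ℍ, σ ≤ dist (γ • z) z) →
      ∀ {ι : Type} [Fintype ι] (z : ι → ℍ),
        (∀ i j, i ≠ j → ∀ γ : Γ, σ ≤ dist (γ • z i) (z j)) →
        Fintype.card ι ≤ a * Module.finrank ℂ (Additive Γ →+ ℂ) := by
  obtain ⟨a, ha2, ha⟩ := exists_weight hσ
  refine ⟨a, fun Γ _ _ _ _ hΓ ι _ z hz => ?_⟩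
  have hne : ∀ b, a ≤ b → ∃ φ, IsForm Γ b φ ∧ φ ≠ 0 := by
    intro b hb
    have h1 := card_le_finrank_form (Γ := Γ) hσ (ha2.trans hb) (ha b hb)
      (fun _ : Unit => I) fun i j γ h => hΓ γ (h.resolve_left fun h => h rfl) I
    have : Nontrivial (Form Γ b) := Module.nontrivial_of_finrank_pos (R := ℂ)
      (by simpa [Nat.succ_le_iff] using h1)
    obtain ⟨φ, hφ⟩ := exists_ne (0 : Form Γ b)
    exact ⟨φ.1, φ.2, fun h => hφ (Subtype.ext h)⟩
  -- Forms of consecutive weights: computing D(a + j + 1) from θ and from ψ shows that D has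
  -- constant increments.
  obtain ⟨θ, hθ, hθ0⟩ := hne a le_rfl
  obtain ⟨ψ, hψ, hψ0⟩ := hne (a + 1) (Nat.le_succ a)
  obtain ⟨Z, hZ⟩ := hθ.exists_isZeroSystem hθ0
  obtain ⟨Y, hY⟩ := hψ.exists_isZeroSystem hψ0
  have hn : Fintype.card ι ≤ Module.finrank ℂ (Form Γ a) := by
    refine card_le_finrank_form (Γ := Γ) hσ ha2 (ha a le_rfl) z fun i j γ h => ?_
    by_cases hij : i = j
    · subst hij
      exact hΓ γ (h.resolve_left fun h => h rfl) _
    · exact hz i j hij γ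
  set D : ℕ → ℤ := fun k => Module.finrank ℂ (Form Γ k) with hD
  have hstep : ∀ j, 2 ≤ j → D (j + 1) = D j + (zeroCount ψ Y - zeroCount θ Z : ℤ) := by
    intro j hj
    have h1 := finrank_form_add (j := j + 1) (by omega) hθ hθ0 hZ
    have h2 := finrank_form_add (j := j) hj hψ hψ0 hY
    rw [show a + (j + 1) = a + 1 + j by omega] at h1
    simp only [hD]
    omega
  set κ : ℤ := zeroCount ψ Y - zeroCount θ Z
  have hiter : ∀ i : ℕ, D (2 + i) = D 2 + i * κ := by
    intro i
    induction i with
    | zero => simp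
    | succ i ih => rw [← add_assoc, hstep _ (by omega), ih]; push_cast; ring
  -- Compared with `hiter`, this says that θ has aκ zeros.
  have h1 : D (a + 2) = zeroCount θ Z + D 2 := by
    simp only [hD]; exact_mod_cast finrank_form_add le_rfl hθ hθ0 hZ
  have h2 : D (a + a) = zeroCount θ Z + D a := by
    simp only [hD]; exact_mod_cast finrank_form_add ha2 hθ hθ0 hZ
  have h3 : D a ≤ zeroCount θ Z + 1 := by
    simp only [hD]; exact_mod_cast finrank_form_le hθ hθ0 hZ
  have h4 : D (2 * a + 1) + 1 ≤
      Module.finrank ℂ (Additive Γ →+ ℂ) + D a + zeroCount θ Z := by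
    simp only [hD]; exact_mod_cast finrank_form_two_mul_add_one_le Γ hθ hθ0 hZ
  rw [two_mul, hstep _ (by omega), h2] at h4
  rw [add_comm a 2, hiter] at h1
  -- In `h4` the left side has become `zeroCount θ Z + D a + κ + 1`, so D a and the zero count
  -- cancel.
  have h5 : κ + 1 ≤ Module.finrank ℂ (Additive Γ →+ ℂ) := by linarith
  have h6 : (Fintype.card ι : ℤ) ≤ D a := by simp only [hD]; exact_mod_cast hn
  have h7 : (a : ℤ) * (κ + 1) ≤ a * Module.finrank ℂ (Additive Γ →+ ℂ) := by gcongr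
  have h8 : (1 : ℤ) ≤ a := by exact_mod_cast (by omega : 1 ≤ a)
  zify
  linarith

/-- Evaluation of homomorphisms to `ℂ` at a maximal independent family is injective. -/
theorem exists_injective_of_finrank_pos {A : Type*} [AddCommGroup A]
    (hA : 0 < Module.finrank ℤ A) :
    ∃ v : Fin (Module.finrank ℤ A) → A, ∀ f : A →+ ℂ, (∀ i, f (v i) = 0) → f = 0 := by
  set N := Module.finrank ℤ A with hN
  obtain ⟨v, hv⟩ := exists_linearIndependent_of_le_finrank (R := ℤ) (M := A) le_rfl
  refine ⟨v, fun f hf => AddMonoidHom.ext fun x => ?_⟩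
  -- Positivity of `finrank` excludes infinite rank, for which `finrank` is 0 by convention.
  have hrank : Module.rank ℤ A = N :=
    (Cardinal.cast_toNat_of_lt_aleph0 (Cardinal.toNat_ne_zero.1 hA.ne').2).symm
  have hdep : ¬ LinearIndependent ℤ (Fin.cons x v : Fin (N + 1) → A) := by
    intro h
    have := h.cardinal_lift_le_rank
    rw [hrank] at this
    simp only [Cardinal.mk_fin, Cardinal.lift_natCast, Nat.cast_le] at this
    omega
  obtain ⟨c, hc, i, hi⟩ := Fintype.not_linearIndependent_iff.1 hdep
  rw [Fin.sum_univ_succ] at hc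
  simp only [Fin.cons_zero, Fin.cons_succ] at hc
  have hc0 : c 0 ≠ 0 := by
    intro h0
    rw [h0, zero_smul, zero_add] at hc
    have := Fintype.linearIndependent_iff.1 hv (fun i => c i.succ) hc
    rcases Fin.eq_zero_or_eq_succ i with rfl | ⟨j, rfl⟩
    · exact hi h0
    · exact hi (this j)
  have h := congrArg f hc
  simp only [map_add, map_sum, map_zsmul, hf, smul_zero, Finset.sum_const_zero, add_zero,
    map_zero] at h
  exact (smul_eq_zero.1 h).resolve_left hc0

/-- If `Γ` is an anti-quotient of the group `P`, the homomorphisms from `Γ` to `ℂ` form a space of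
dimension at most the rank of the abelianization of `P`. -/
theorem finrank_addMonoidHom_le {P Γ : Type*} [Group P] [Group Γ] {q : P →* Γᵐᵒᵖ}
    (hq : Function.Surjective q) (hP : 0 < Module.finrank ℤ (Additive (Abelianization P))) :
    FiniteDimensional ℂ (Additive Γ →+ ℂ) ∧ Module.finrank ℂ (Additive Γ →+ ℂ) ≤
      Module.finrank ℤ (Additive (Abelianization P)) := by
  obtain ⟨v, hv⟩ := exists_injective_of_finrank_pos hP
  choose p hp using fun i => QuotientGroup.mk_surjective (v i).toMul
  let L : (Additive Γ →+ ℂ) →ₗ[ℂ] (Fin (Module.finrank ℤ (Additive (Abelianization P))) → ℂ) :=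
    { toFun := fun f i => f (Additive.ofMul (q (p i)).unop)
      map_add' := fun f g => rfl
      map_smul' := fun c f => rfl }
  have hL : Function.Injective L := by
    rw [← LinearMap.ker_eq_bot, LinearMap.ker_eq_bot']
    intro f hf
    -- Reversing the order of multiplication is harmless because the target is commutative.
    let F : P →* Multiplicative ℂ :=
      { toFun := fun x => Multiplicative.ofAdd (f (Additive.ofMul (q x).unop))
        map_one' := by simp
        map_mul' := fun x y => by
          rw [map_mul, MulOpposite.unop_mul, ofMul_mul, map_add, add_comm, ofAdd_add] }
    have h1 := hv (MonoidHom.toAdditiveLeft (Abelianization.lift F)) fun i => by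
      have : v i = Additive.ofMul (Abelianization.of (p i)) := (hp i).symm
      rw [this]
      exact congrFun hf i
    ext γ
    obtain ⟨x, hx⟩ := hq (MulOpposite.op γ)
    have h2 := DFunLike.congr_fun h1 (Additive.ofMul (Abelianization.of x))
    have h3 : f (Additive.ofMul (q x).unop) = 0 := h2
    rw [hx] at h3
    exact h3
  exact ⟨Module.Finite.of_injective L hL, by
    simpa using LinearMap.finrank_le_finrank_of_injective hL⟩

end

/-! ### The deck transformations of a universal covering -/

section

/-- A holomorphic function with a continuous local inverse has a nonvanishing derivative. -/
theorem deriv_ne_zero_of_continuous_inverse {f s : ℂ → ℂ} {z₀ : ℂ} (hf : AnalyticAt ℂ f z₀)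
    (hs : ∀ᶠ w in 𝓝 (f z₀), ContinuousAt s w) (hs0 : s (f z₀) = z₀)
    (hfs : ∀ᶠ w in 𝓝 (f z₀), f (s w) = w) : deriv f z₀ ≠ 0 := by
  intro h0
  have hsc : ContinuousAt s (f z₀) := hs.self_of_nhds
  have hst : Tendsto s (𝓝 (f z₀)) (𝓝 z₀) := by
    have := hsc.tendsto
    rwa [hs0] at this
  have hd : ∀ᶠ w in 𝓝 (f z₀), DifferentiableAt ℂ f (s w) :=
    hst.eventually hf.eventually_analyticAt |>.mono fun w hw => hw.differentiableAt
  -- Zeros of f' are isolated, as f is not locally constant. So s is holomorphic off `f z₀` by the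
  -- inverse function rule, and at `f z₀` by removal of singularities; then f'(z₀) s'(f z₀) = 1.
  have hs' : DifferentiableAt ℂ s (f z₀) := by
    have hne : ∀ᶠ w in 𝓝[≠] (f z₀), deriv f (s w) ≠ 0 := by
      have hst' : Tendsto s (𝓝[≠] (f z₀)) (𝓝[≠] z₀) := by
        refine tendsto_nhdsWithin_iff.2 ⟨hst.mono_left nhdsWithin_le_nhds, ?_⟩
        filter_upwards [nhdsWithin_le_nhds hfs, self_mem_nhdsWithin] with w hw hne h
        exact hne (by rw [← hw, mem_singleton_iff.1 h]; rfl)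
      rcases hf.deriv.eventually_eq_zero_or_eventually_ne_zero with h | h
      · exfalso
        obtain ⟨r, hr, hball⟩ := Metric.eventually_nhds_iff_ball.1 (h.and hf.eventually_analyticAt)
        have hconst : ∀ w ∈ ball z₀ r, f w = f z₀ := fun w hw =>
          (convex_ball z₀ r).is_const_of_fderivWithin_eq_zero (𝕜 := ℂ)
            (fun x hx => (hball x hx).2.differentiableAt.differentiableWithinAt)
            (fun x hx => by
              rw [fderivWithin_of_isOpen isOpen_ball hx]
              ext
              simp [(hball x hx).1]) hw (mem_ball_self hr)
        have h1 : ∀ᶠ w in 𝓝[≠] (f z₀), w = f z₀ := by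
          filter_upwards [nhdsWithin_le_nhds hfs,
            nhdsWithin_le_nhds (hst.eventually (ball_mem_nhds z₀ hr))] with w hw hw'
          rw [← hconst _ hw', hw]
        obtain ⟨w, hw, hw'⟩ := (h1.and self_mem_nhdsWithin).exists
        exact hw' hw
      · exact hst'.eventually h
    rw [eventually_nhdsWithin_iff] at hne
    obtain ⟨V, hV, hVo, hfV⟩ := _root_.eventually_nhds_iff.1 (hne.and (hs.and (hfs.and hd)))
    have hVn := hVo.mem_nhds hfV
    refine ((Complex.differentiableOn_compl_singleton_and_continuousAt_iff hVn).1
      ⟨fun w hw => ?_, hsc⟩).differentiableAt hVn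
    obtain ⟨h1, h2, h3, h4⟩ := hV w hw.1
    refine (h4.hasDerivAt.of_local_left_inverse h2 (h1 hw.2)
      ?_).differentiableAt.differentiableWithinAt
    filter_upwards [hVo.mem_nhds hw.1] with y hy using (hV y hy).2.2.1
  have h1 : HasDerivAt (f ∘ s) (deriv f z₀ * deriv s (f z₀)) (f z₀) := by
    refine HasDerivAt.comp _ ?_ hs'.hasDerivAt
    rw [hs0]
    exact hf.differentiableAt.hasDerivAt
  have h2 : HasDerivAt (f ∘ s) 1 (f z₀) :=
    (hasDerivAt_id (f z₀)).congr_of_eventuallyEq hfs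
  rw [h0, zero_mul] at h1
  exact zero_ne_one (h1.unique h2)

lemma differentiableAt_of_comp {f g h : ℂ → ℂ} {z : ℂ} (hf : AnalyticAt ℂ f (g z))
    (hf' : deriv f (g z) ≠ 0) (hg : ContinuousAt g z) (hh : DifferentiableAt ℂ h z)
    (hfg : ∀ᶠ w in 𝓝 z, f (g w) = h w) : DifferentiableAt ℂ g z := by
  have hs : HasStrictDerivAt f (deriv f (g z)) (g z) := hf.hasStrictDerivAt
  have h1 := hs.to_localInverse hf'
  rw [hfg.self_of_nhds] at h1
  refine (h1.hasDerivAt.differentiableAt.comp z hh).congr_of_eventuallyEq ?_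
  filter_upwards [hg.eventually (hs.eventually_left_inverse hf'), hfg] with w hw hw'
  rw [Function.comp_apply, ← hw', hw]

section

variable {S : Type u}

/-- The group of deck transformations of `π`. -/
def deckGroup (π : ℍ → S) : Subgroup (ℍ ≃ₜ ℍ) where
  carrier := {h | ∀ z, π (h z) = π z}
  mul_mem' {f g} hf hg z := by
    rw [Homeomorph.mul_apply, hf, hg]
  one_mem' z := rfl
  inv_mem' {f} hf z := by
    have h := hf (f⁻¹ z)
    rw [← h]
    exact congrArg π (f.apply_symm_apply z)

instance (π : ℍ → S) : MulAction (deckGroup π) ℍ where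
  smul γ z := γ.1 z
  one_smul _ := rfl
  mul_smul _ _ _ := rfl

lemma map_deckGroup_smul {π : ℍ → S} (γ : deckGroup π) (z : ℍ) : π (γ • z) = π z := γ.2 z

instance (π : ℍ → S) : ContinuousConstSMul (deckGroup π) ℍ := ⟨fun γ => γ.1.continuous⟩

variable [TopologicalSpace S]

lemma eq_one_of_deckGroup_smul_eq {π : ℍ → S} (hπ : IsCoveringMap π) {γ : deckGroup π} {z : ℍ}
    (h : γ • z = z) : γ = 1 := by
  have h1 := hπ.eq_of_comp_eq γ.1.continuous continuous_id (funext fun w => γ.2 w) z h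
  exact Subtype.ext (Homeomorph.ext fun w => congrFun h1 w)

/-- As ℍ is simply connected, π lifts through itself with z ↦ w and with w ↦ z; by uniqueness of
lifts the two maps are mutually inverse. -/
lemma exists_deckGroup_smul_eq {π : ℍ → S} (hπ : IsCoveringMap π) {z w : ℍ} (h : π z = π w) :
    ∃ γ : deckGroup π, γ • z = w := by
  obtain ⟨F, ⟨hF, hFπ⟩, -⟩ :=
    hπ.existsUnique_continuousMap_lifts ⟨π, hπ.continuous⟩ z w h.symm
  obtain ⟨G, ⟨hG, hGπ⟩, -⟩ :=
    hπ.existsUnique_continuousMap_lifts ⟨π, hπ.continuous⟩ w z h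
  have hFπ' : ∀ x, π (F x) = π x := fun x => congrFun hFπ x
  have hGπ' : ∀ x, π (G x) = π x := fun x => congrFun hGπ x
  have h1 : G ∘ F = id := hπ.eq_of_comp_eq (G.continuous.comp F.continuous) continuous_id
    (funext fun x => by simp [hFπ', hGπ']) z (by simp [hF, hG])
  have h2 : F ∘ G = id := hπ.eq_of_comp_eq (F.continuous.comp G.continuous) continuous_id
    (funext fun x => by simp [hFπ', hGπ']) w (by simp [hF, hG])
  exact ⟨⟨⟨⟨F, G, congrFun h1, congrFun h2⟩, F.continuous, G.continuous⟩, hFπ'⟩, hF⟩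

theorem isQuotientCoveringMap_deckGroup {π : ℍ → S} (hπ : IsCoveringMap π)
    (hs : Function.Surjective π) : IsQuotientCoveringMap π (deckGroup π) := by
  refine (isQuotientCoveringMap_iff_isCoveringMap_and π (deckGroup π)).2
    ⟨hπ, hs, inferInstance, ?_, fun {z w} => ⟨fun h => ?_, ?_⟩⟩
  · exact
      { left_cancel' := fun γ z w h => γ.1.injective h
        right_cancel' := fun γ δ z h => by
          have h1 : (δ⁻¹ * γ) • z = z := by rw [mul_smul, h, inv_smul_smul]
          exact (inv_mul_eq_one.1 (eq_one_of_deckGroup_smul_eq hπ h1)).symm }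
  · exact exists_deckGroup_smul_eq hπ h.symm
  · rintro ⟨γ, rfl⟩
    exact γ.2 w

/-- Otherwise z and γz would be two points with the same image in one ball about z on which π is
injective. -/
lemma le_dist_of_le_injectivityRadius {π : ℍ → S} (hπ : IsCoveringMap π) {ε : ℝ}
    (hε : ENNReal.ofReal ε ≤ injectivityRadius π) (γ : deckGroup π) (hγ : γ ≠ 1) (z : ℍ) :
    ε ≤ dist (γ • z) z := by
  by_contra! h
  refine hγ (eq_one_of_deckGroup_smul_eq hπ (z := z) ?_)
  have h1 : edist (γ • z) z < injectivityRadiusAt π (π z) := by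
    refine lt_of_lt_of_le ?_ (hε.trans (iInf_le _ (π z)))
    rw [edist_dist]
    exact (ENNReal.ofReal_lt_ofReal_iff_of_nonneg dist_nonneg).2 h
  obtain ⟨r, hr, hlt⟩ := lt_sSup_iff.1 h1
  exact hr z rfl (Metric.mem_eball.2 hlt) (Metric.mem_eball_self (bot_le.trans_lt hlt)) (γ.2 z)

lemma exists_isCompact_deckGroup [CompactSpace S] {π : ℍ → S} (hπ : IsCoveringMap π)
    (hs : Function.Surjective π) :
    ∃ K : Set ℍ, IsCompact K ∧ ∀ z : ℍ, ∃ γ : deckGroup π, γ • z ∈ K := by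
  obtain ⟨n, hn⟩ := isCompact_univ.elim_directed_cover (fun n : ℕ => π '' ball I n)
    (fun n => hπ.isLocalHomeomorph.isOpenMap _ isOpen_ball) (fun p _ => by
      obtain ⟨z, rfl⟩ := hs p
      obtain ⟨n, hn⟩ := exists_nat_gt (dist z I)
      exact mem_iUnion.2 ⟨n, z, hn, rfl⟩)
    (Monotone.directed_le fun n m hnm => image_mono (ball_subset_ball (by exact_mod_cast hnm)))
  refine ⟨closedBall I n, isCompact_closedBall _ _, fun z => ?_⟩
  obtain ⟨w, hw, hwz⟩ := hn (mem_univ (π z))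
  obtain ⟨γ, hγ⟩ := exists_deckGroup_smul_eq hπ hwz.symm
  exact ⟨γ, hγ ▸ ball_subset_closedBall hw⟩

variable [ChartedSpace ℂ S]

/-- The only use of the genus: the fundamental group maps onto the opposite of the deck group.
Positivity of g guards against the convention that infinite rank has `finrank` 0. -/
theorem finrank_deckGroup_addMonoidHom_le {π : ℍ → S} (hπ : IsUniversalCovering π) {g : ℕ}
    (hg : 0 < g) (hS : HasGenus S g) :
    FiniteDimensional ℂ (Additive (deckGroup π) →+ ℂ) ∧
      Module.finrank ℂ (Additive (deckGroup π) →+ ℂ) ≤ 2 * g := by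
  have hq := isQuotientCoveringMap_deckGroup hπ.isCoveringMap hπ.surjective
  have h1 := hS (π I)
  rw [← h1]
  exact finrank_addMonoidHom_le (hq.fundamentalGroupToMulOpposite_surjective ⟨I, rfl⟩)
    (by rw [h1]; omega)

lemma eventually_mem_source {π : ℍ → S} (hπ : IsUniversalCovering π)
    {e : OpenPartialHomeomorph S ℂ} {z : ℍ} (hz : π z ∈ e.source) :
    ∀ᶠ w : ℂ in 𝓝 z, 0 < w.im ∧ π (ofComplex w) ∈ e.source := by
  have h0 : ∀ᶠ w : ℂ in 𝓝 z, 0 < w.im := mem_nhds_upperHalfPlaneSet z.im_pos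
  refine h0.and ?_
  have h1 : ContinuousAt (fun w : ℂ => π (ofComplex w)) z :=
    hπ.isCoveringMap.continuous.continuousAt.comp
      (contMDiffAt_ofComplex (n := 0) z.im_pos).continuousAt
  refine h1.eventually (e.open_source.mem_nhds ?_)
  simpa using hz

variable [IsManifold 𝓘(ℂ) ω S]

lemma differentiableAt_chart_comp {π : ℍ → S} (hπ : IsUniversalCovering π)
    {e : OpenPartialHomeomorph S ℂ} (he : e ∈ atlas ℂ S) {z : ℍ} (hz : π z ∈ e.source) :
    DifferentiableAt ℂ (fun w : ℂ => e (π (ofComplex w))) z := by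
  have : IsManifold 𝓘(ℂ) 1 S := IsManifold.of_le (n := ω) le_top
  exact UpperHalfPlane.mdifferentiableAt_iff.1
    ((mdifferentiableAt_atlas he hz).comp z (hπ.holomorphic z))

lemma analyticAt_chart_comp {π : ℍ → S} (hπ : IsUniversalCovering π)
    {e : OpenPartialHomeomorph S ℂ} (he : e ∈ atlas ℂ S) {z : ℍ} (hz : π z ∈ e.source) :
    AnalyticAt ℂ (fun w : ℂ => e (π (ofComplex w))) z := by
  rw [Complex.analyticAt_iff_eventually_differentiableAt]
  filter_upwards [eventually_mem_source hπ hz] with w hw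
  have := differentiableAt_chart_comp hπ he (z := ⟨w, hw.1⟩)
    (by rw [← ofComplex_apply_of_im_pos hw.1]; exact hw.2)
  exact this

lemma deriv_chart_comp_ne_zero {π : ℍ → S} (hπ : IsUniversalCovering π)
    {e : OpenPartialHomeomorph S ℂ} (he : e ∈ atlas ℂ S) {z : ℍ} (hz : π z ∈ e.source) :
    deriv (fun w : ℂ => e (π (ofComplex w))) z ≠ 0 := by
  obtain ⟨p, hzp, hp⟩ := hπ.isCoveringMap.isLocalHomeomorph z
  set q := p.trans e with hq
  have hzq : z ∈ q.source := by
    rw [hq, OpenPartialHomeomorph.trans_source]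
    exact ⟨hzp, by rw [mem_preimage, ← hp]; exact hz⟩
  have hqz : q z = e (π (ofComplex z)) := by simp [hq, hp]
  refine deriv_ne_zero_of_continuous_inverse (s := fun w => (q.symm w : ℂ))
    (analyticAt_chart_comp hπ he hz) ?_ ?_ ?_
  · rw [← hqz]
    filter_upwards [q.open_target.mem_nhds (q.map_source hzq)] with w hw
    exact continuous_coe.continuousAt.comp (q.continuousAt_symm hw)
  · rw [← hqz, q.left_inv hzq]
  · rw [← hqz]
    filter_upwards [q.open_target.mem_nhds (q.map_source hzq)] with w hw
    have := q.right_inv hw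
    rw [ofComplex_apply]
    simpa [hq, hp] using this

/-- A deck transformation is a priori only a homeomorphism; since π ∘ γ = π, it is locally a branch
of the inverse of π composed with π, hence holomorphic. -/
theorem differentiableOn_act_deckGroup {π : ℍ → S} (hπ : IsUniversalCovering π)
    (γ : deckGroup π) : DifferentiableOn ℂ (act γ) upperHalfPlaneSet := by
  intro z hz
  lift z to ℍ using hz
  have he := chart_mem_atlas ℂ (π z)
  have hz := mem_chart_source ℂ (π z)
  have hγz : π (γ • z) ∈ (chartAt ℂ (π z)).source := by
    rwa [map_deckGroup_smul γ z]
  refine (differentiableAt_of_comp (f := fun w : ℂ => chartAt ℂ (π z) (π (ofComplex w)))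
    (h := fun w : ℂ => chartAt ℂ (π z) (π (ofComplex w))) ?_ ?_ ?_
    (differentiableAt_chart_comp hπ he hz) ?_).differentiableWithinAt
  · rw [act_coe]
    exact analyticAt_chart_comp hπ he hγz
  · rw [act_coe]
    exact deriv_chart_comp_ne_zero hπ he hγz
  · exact (continuous_coe.comp γ.1.continuous).continuousAt.comp
      (contMDiffAt_ofComplex (n := 0) z.im_pos).continuousAt
  · refine Eventually.of_forall fun w => ?_
    simp [act, map_deckGroup_smul]

theorem isCocompactAction_deckGroup [CompactSpace S] {π : ℍ → S} (hπ : IsUniversalCovering π)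
    {ε : ℝ} (hε : 0 < ε) (hinj : ENNReal.ofReal ε ≤ injectivityRadius π) :
    IsCocompactAction (deckGroup π) where
  differentiableOn_act := differentiableOn_act_deckGroup hπ
  exists_le_dist := ⟨ε, hε, le_dist_of_le_injectivityRadius hπ.isCoveringMap hinj⟩
  exists_isCompact := exists_isCompact_deckGroup hπ.isCoveringMap hπ.surjective

end

end

/-! ### Quadratic differentials on the surface and on the upper half-plane -/

section

section

variable {S : Type u} [TopologicalSpace S] [ChartedSpace ℂ S] [IsManifold 𝓘(ℂ) ω S] {π : ℍ → S}

/-- The pull-back of the quadratic differential `φ` under `π`, computed in the chart `e`. -/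
def chartPullback (π : ℍ → S) (φ : QuadraticDifferential S) (e : atlas ℂ S) (z : ℂ) : ℂ :=
  φ.1 e (e.1 (π (ofComplex z))) * deriv (fun w : ℂ => e.1 (π (ofComplex w))) z ^ 2

/-- The pull-back of the quadratic differential `φ` under `π`. -/
def pullback (π : ℍ → S) (φ : QuadraticDifferential S) (z : ℂ) : ℂ :=
  if 0 < z.im then
    chartPullback π φ ⟨chartAt ℂ (π (ofComplex z)), chart_mem_atlas ℂ _⟩ z
  else 0

lemma differentiableAt_transition {e e' : OpenPartialHomeomorph S ℂ} (he : e ∈ atlas ℂ S)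
    (he' : e' ∈ atlas ℂ S) {w : ℂ} (hw : w ∈ e.target) (hw' : e.symm w ∈ e'.source) :
    DifferentiableAt ℂ (fun v => e' (e.symm v)) w := by
  have : IsManifold 𝓘(ℂ) 1 S := IsManifold.of_le (n := ω) le_top
  exact mdifferentiableAt_iff_differentiableAt.1
    (MDifferentiableAt.comp w (mdifferentiableAt_atlas (I := 𝓘(ℂ)) he' hw')
      (mdifferentiableAt_atlas_symm (I := 𝓘(ℂ)) he hw))

lemma chartPullback_eq (hπ : IsUniversalCovering π) (φ : QuadraticDifferential S)
    {e e' : atlas ℂ S} {z : ℍ} (he : π z ∈ e.1.source) (he' : π z ∈ e'.1.source) :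
    chartPullback π φ e z = chartPullback π φ e' z := by
  have h1 : e.1.symm (e.1 (π z)) = π z := e.1.left_inv he
  have h2 := φ.2.2.2 e e' (e.1 (π z)) (e.1.map_source he) (by rwa [h1])
  have h3 := differentiableAt_transition e.2 e'.2 (e.1.map_source he) (by rwa [h1])
  have h4 : deriv (fun w : ℂ => e'.1 (π (ofComplex w))) z =
      deriv (fun v => e'.1 (e.1.symm v)) (e.1 (π z)) *
        deriv (fun w : ℂ => e.1 (π (ofComplex w))) z := by
    have h5 : (fun w : ℂ => e'.1 (π (ofComplex w))) =ᶠ[𝓝 (z : ℂ)]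
        (fun v => e'.1 (e.1.symm v)) ∘ fun w : ℂ => e.1 (π (ofComplex w)) := by
      filter_upwards [eventually_mem_source hπ he] with w hw
      rw [Function.comp_apply, e.1.left_inv hw.2]
    rw [h5.deriv_eq, deriv_comp _ (by simpa using h3) (differentiableAt_chart_comp hπ e.2 he)]
    simp
  rw [chartPullback, chartPullback, h4, ofComplex_apply, h2, h1]
  ring

lemma pullback_eq (hπ : IsUniversalCovering π) (φ : QuadraticDifferential S) {e : atlas ℂ S}
    {z : ℍ} (he : π z ∈ e.1.source) : pullback π φ z = chartPullback π φ e z := by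
  rw [pullback]
  refine (if_pos z.im_pos).trans (chartPullback_eq hπ φ ?_ he)
  simp

lemma differentiableOn_pullback (hπ : IsUniversalCovering π) (φ : QuadraticDifferential S) :
    DifferentiableOn ℂ (pullback π φ) upperHalfPlaneSet := by
  intro z hz
  lift z to ℍ using hz
  set e : atlas ℂ S := ⟨chartAt ℂ (π z), chart_mem_atlas ℂ _⟩ with he
  have hz : π z ∈ e.1.source := mem_chart_source ℂ (π z)
  have h1 : pullback π φ =ᶠ[𝓝 (z : ℂ)] chartPullback π φ e := by
    filter_upwards [eventually_mem_source hπ hz] with w hw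
    have := pullback_eq hπ φ (e := e) (z := ⟨w, hw.1⟩)
      (by rw [← ofComplex_apply_of_im_pos hw.1]; exact hw.2)
    exact this
  have h2 := analyticAt_chart_comp hπ e.2 hz
  have h3 : DifferentiableAt ℂ (φ.1 e) (e.1 (π (ofComplex z))) := by
    rw [ofComplex_apply]
    exact (φ.2.1 e).differentiableAt (e.1.open_target.mem_nhds (e.1.map_source hz))
  have h4 : DifferentiableAt ℂ (chartPullback π φ e) z :=
    (h3.comp (z : ℂ) h2.differentiableAt).mul (h2.deriv.differentiableAt.pow 2)
  exact (h4.congr_of_eventuallyEq h1).differentiableWithinAt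

lemma eq_zero_of_pullback_eq_zero (hπ : IsUniversalCovering π) (φ : QuadraticDifferential S)
    (h : ∀ z : ℍ, pullback π φ z = 0) : φ = 0 := by
  refine Subtype.ext (funext fun e => funext fun w => ?_)
  by_cases hw : w ∈ e.1.target
  · obtain ⟨z, hz⟩ := hπ.surjective (e.1.symm w)
    have hz' : π z ∈ e.1.source := hz ▸ e.1.map_target hw
    have h1 := h z
    rw [pullback_eq hπ φ hz', chartPullback, ofComplex_apply, hz, e.1.right_inv hw] at h1
    exact (mul_eq_zero.1 h1).resolve_right (pow_ne_zero 2 (deriv_chart_comp_ne_zero hπ e.2 hz'))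
  · exact φ.2.2.1 e w hw

variable [IsCocompactAction (deckGroup π)]

lemma deriv_chart_comp_smul (hπ : IsUniversalCovering π) (γ : deckGroup π) {e : atlas ℂ S} {z : ℍ}
    (he : π z ∈ e.1.source) : deriv (fun w : ℂ => e.1 (π (ofComplex w))) z =
      deriv (fun w : ℂ => e.1 (π (ofComplex w))) (γ • z : ℍ) * jac γ z := by
  have h1 : (fun w : ℂ => e.1 (π (ofComplex w))) =
      (fun w : ℂ => e.1 (π (ofComplex w))) ∘ act γ := by
    funext w
    simp [act, map_deckGroup_smul]
  conv_lhs => rw [h1]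
  rw [deriv_comp _ _ (differentiableAt_act γ z.im_pos), act_coe, jac]
  rw [act_coe]
  exact differentiableAt_chart_comp hπ e.2 (by rwa [map_deckGroup_smul γ z])

lemma isForm_pullback (hπ : IsUniversalCovering π) (φ : QuadraticDifferential S) :
    IsForm (deckGroup π) 2 (pullback π φ) := by
  refine ⟨differentiableOn_pullback hπ φ, fun z hz => if_neg hz, fun γ z hz => ?_⟩
  lift z to ℍ using hz
  set e : atlas ℂ S := ⟨chartAt ℂ (π z), chart_mem_atlas ℂ _⟩ with he
  have hz : π z ∈ e.1.source := mem_chart_source ℂ (π z)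
  rw [slash, act_coe, pullback_eq hπ φ (e := e) (by rwa [map_deckGroup_smul γ z]),
    pullback_eq hπ φ hz, chartPullback, chartPullback, deriv_chart_comp_smul hπ γ hz,
    ofComplex_apply, ofComplex_apply, map_deckGroup_smul γ z]
  ring

/-- The density is defined through an arbitrarily chosen point over p; `norm_jac` shows that the
choice does not matter. -/
lemma hypDensity_eq (hπ : IsUniversalCovering π) {e : atlas ℂ S} {z : ℍ}
    (he : π z ∈ e.1.source) : hypDensity π e.1 (π z) =
      1 / (z.im * ‖deriv (fun w : ℂ => e.1 (π (ofComplex w))) (z : ℂ)‖) := by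
  obtain ⟨γ, hγ⟩ := exists_deckGroup_smul_eq hπ.isCoveringMap
    (Function.invFun_eq (hπ.surjective (π z))).symm
  have hz := z.im_pos
  rw [deriv_chart_comp_smul hπ γ he, norm_mul, norm_jac γ z.im_pos, act_coe, hγ, hypDensity,
    coe_im, coe_im]
  field_simp

lemma norm_normalizedValue (hπ : IsUniversalCovering π) (φ : QuadraticDifferential S)
    {e : atlas ℂ S} {z : ℍ} (he : π z ∈ e.1.source) :
    ‖normalizedValue π φ e (π z)‖ = ‖pullback π φ z‖ * z.im ^ 2 := by
  rw [normalizedValue, hypDensity_eq hπ he, pullback_eq hπ φ he, chartPullback, norm_mul, norm_inv,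
    norm_pow, Complex.norm_real, Real.norm_eq_abs, sq_abs, norm_mul, norm_pow, ofComplex_apply,
    one_div, inv_pow, inv_inv]
  ring

lemma supNorm_eq_of_forall_le (hπ : IsUniversalCovering π) (φ : QuadraticDifferential S) {w : ℍ}
    (hw : ∀ z : ℍ, ‖pullback π φ z‖ * z.im ^ 2 ≤ ‖pullback π φ w‖ * w.im ^ 2) :
    supNorm π φ = ENNReal.ofReal (‖pullback π φ w‖ * w.im ^ 2) := by
  have key : ∀ z : ℍ, ‖normalizedValue π φ ⟨chartAt ℂ (π z), chart_mem_atlas ℂ _⟩ (π z)‖ₑ =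
      ENNReal.ofReal (‖pullback π φ z‖ * z.im ^ 2) := fun z => by
    rw [← ofReal_norm, norm_normalizedValue hπ φ (mem_chart_source ℂ (π z))]
  refine le_antisymm (iSup_le fun p => ?_) ?_
  · obtain ⟨z, rfl⟩ := hπ.surjective p
    rw [key]
    exact ENNReal.ofReal_le_ofReal (hw z)
  · rw [← key]
    exact le_iSup (fun p => ‖normalizedValue π φ ⟨chartAt ℂ p, chart_mem_atlas ℂ p⟩ p‖ₑ) (π w)

end

/-! ### Comparison of the norms -/

/-- A holomorphic function whose norm `|f| Im ^ 2` is maximal at `w` cannot be too small at points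
near `w`. -/
theorem le_two_mul_of_dist_lt {f : ℂ → ℂ} (hf : DifferentiableOn ℂ f upperHalfPlaneSet) {w z : ℍ}
    (hw : ∀ z : ℍ, ‖f z‖ * z.im ^ 2 ≤ ‖f w‖ * w.im ^ 2) (hzw : dist z w < Real.log (65 / 64)) :
    ‖f w‖ * w.im ^ 2 ≤ 2 * (‖f z‖ * z.im ^ 2) := by
  set y := w.im with hy
  have hy0 : 0 < y := w.im_pos
  set m := ‖f w‖ with hm
  have hm0 : 0 ≤ m := norm_nonneg _
  have hexp : Real.exp (dist z w) < 65 / 64 := by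
    rwa [← Real.lt_log_iff_exp_lt (by norm_num)]
  -- The constants: |f| ≤ 4m within y/2 of w because Im ≥ y/2 there, so |f'| ≤ 16m/y within y/4. A
  -- displacement of y/64 changes f by at most m/4, and 2 · (3/4) · (64/65)² ≥ 1.
  have hdist : ‖(z : ℂ) - w‖ ≤ y / 64 := by
    rw [← dist_eq_norm]
    refine (dist_coe_le z w).trans ?_
    rw [div_eq_mul_inv]
    gcongr
    linarith
  have him : y * (64 / 65) ≤ z.im := by
    have h1 := im_div_exp_dist_le w z
    rw [dist_comm, ← hy] at h1
    refine le_trans ?_ h1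
    rw [le_div_iff₀ (Real.exp_pos _)]
    nlinarith
  have hball : ∀ ζ : ℂ, ‖ζ - w‖ ≤ y / 2 → y / 2 ≤ ζ.im := by
    intro ζ hζ
    have h1 := (Complex.abs_im_le_norm (ζ - w)).trans hζ
    rw [Complex.sub_im, coe_im, ← hy, abs_le] at h1
    linarith
  have hbound : ∀ ζ : ℂ, ‖ζ - w‖ ≤ y / 2 → ‖f ζ‖ ≤ 4 * m := by
    intro ζ hζ
    have h1 := hball ζ hζ
    have hζ0 : 0 < ζ.im := by linarith
    have h2 : ‖f ζ‖ * ζ.im ^ 2 ≤ m * y ^ 2 := hw ⟨ζ, hζ0⟩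
    have h3 : ‖f ζ‖ * (y / 2) ^ 2 ≤ ‖f ζ‖ * ζ.im ^ 2 := by gcongr
    have h4 : ‖f ζ‖ * y ^ 2 ≤ (4 * m) * y ^ 2 := by linarith
    exact le_of_mul_le_mul_right h4 (by positivity)
  have hderiv : ∀ ζ ∈ closedBall (w : ℂ) (y / 4), ‖deriv f ζ‖ ≤ 4 * m / (y / 4) := by
    intro ζ hζ
    rw [mem_closedBall, dist_eq_norm] at hζ
    have h1 : ∀ x ∈ closedBall ζ (y / 4), ‖x - w‖ ≤ y / 2 := by
      intro x hx
      rw [mem_closedBall, dist_eq_norm] at hx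
      have h2 := norm_add_le (x - ζ) (ζ - w)
      rw [sub_add_sub_cancel] at h2
      linarith
    refine Complex.norm_deriv_le_of_forall_mem_sphere_norm_le (by positivity) ?_ fun x hx =>
      hbound x (h1 x (sphere_subset_closedBall hx))
    refine DifferentiableOn.diffContOnCl (hf.mono ?_)
    intro x hx
    have h3 := hball x (h1 x (closure_ball_subset_closedBall hx))
    change 0 < x.im
    linarith
  have hmv := (convex_closedBall (w : ℂ) (y / 4)).norm_image_sub_le_of_norm_deriv_le
    (fun x hx => hf.differentiableAt (mem_nhds_upperHalfPlaneSet (by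
      rw [mem_closedBall, dist_eq_norm] at hx
      have := hball x (by linarith)
      linarith))) hderiv (mem_closedBall_self (by positivity))
    (show (z : ℂ) ∈ closedBall (w : ℂ) (y / 4) by
      rw [mem_closedBall, dist_eq_norm]; linarith)
  have h5 : ‖f z - f w‖ ≤ m / 4 := by
    refine hmv.trans ?_
    calc 4 * m / (y / 4) * ‖(z : ℂ) - w‖ ≤ 4 * m / (y / 4) * (y / 64) := by gcongr
      _ = m / 4 := by field_simp; ring
  have h6 : 3 / 4 * m ≤ ‖f z‖ := by
    have := norm_sub_norm_le (f w) (f z)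
    rw [norm_sub_rev] at this
    linarith
  calc m * y ^ 2 ≤ 2 * (3 / 4 * m * (y * (64 / 65)) ^ 2) := by
        have : 0 ≤ m * y ^ 2 := by positivity
        nlinarith
    _ ≤ 2 * (‖f z‖ * z.im ^ 2) := by gcongr

section

variable {S : Type u} [TopologicalSpace S] [ChartedSpace ℂ S] [IsManifold 𝓘(ℂ) ω S] {π : ℍ → S}
  [IsCocompactAction (deckGroup π)]

/-- The values of `ρ⁻² φ` at the points `p j`, in the charts `e j`. -/
def evalMap (π : ℍ → S) {n : ℕ} (e : Fin n → atlas ℂ S) (p : Fin n → S) :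
    QuadraticDifferential S →ₗ[ℂ] (Fin n → ℂ) where
  toFun φ := fun j => normalizedValue π φ (e j) (p j)
  map_add' φ ψ := funext fun j => by simp [normalizedValue, mul_add]
  map_smul' c φ := funext fun j => by simp [normalizedValue, mul_left_comm]

/-- The supremum is attained at some w, and some translate of w is δ-close to a point over a centre
`p j`. -/
theorem exists_supNorm_le (hπ : IsUniversalCovering π) {n : ℕ} {p : Fin n → S}
    {e : Fin n → atlas ℂ S} (hcov : ⋃ j, hypBall π (p j) (Real.log (65 / 64)) = univ)
    (he : ∀ j, p j ∈ (e j).1.source) (φ : QuadraticDifferential S) :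
    ∃ j, supNorm π φ ≤ 2 * ‖normalizedValue π φ (e j) (p j)‖ₑ := by
  have hform := isForm_pullback hπ φ
  obtain ⟨w, hw⟩ := hform.bounded
  obtain ⟨j, hj⟩ := mem_iUnion.1 (hcov ▸ mem_univ (π w))
  simp only [hypBall, mem_ofPred_eq, hypEDist, iInf_lt_iff] at hj
  obtain ⟨z, hz, x, hx, hzx⟩ := hj
  obtain ⟨γ, rfl⟩ := exists_deckGroup_smul_eq hπ.isCoveringMap hx.symm
  have hγ := hform.norm_smul γ w
  rw [edist_dist, ENNReal.ofReal_lt_ofReal_iff (Real.log_pos (by norm_num))] at hzx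
  have h1 := le_two_mul_of_dist_lt hform.differentiableOn (fun z => by rw [hγ]; exact hw z) hzx
  refine ⟨j, ?_⟩
  rw [supNorm_eq_of_forall_le hπ φ hw, ← hγ, ← ofReal_norm, ← hz,
    norm_normalizedValue hπ φ (by rw [hz]; exact he j),
    show (2 : ℝ≥0∞) = ENNReal.ofReal 2 by simp, ← ENNReal.ofReal_mul (by norm_num)]
  exact ENNReal.ofReal_le_ofReal h1

lemma enorm_normalizedValue_le (hπ : IsUniversalCovering π) (φ : QuadraticDifferential S)
    {e : atlas ℂ S} {p : S} (he : p ∈ e.1.source) : ‖normalizedValue π φ e p‖ₑ ≤ supNorm π φ := by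
  obtain ⟨z, rfl⟩ := hπ.surjective p
  have h1 : ‖normalizedValue π φ e (π z)‖ₑ =
      ‖normalizedValue π φ ⟨chartAt ℂ (π z), chart_mem_atlas ℂ _⟩ (π z)‖ₑ := by
    rw [← ofReal_norm, ← ofReal_norm, norm_normalizedValue hπ φ he,
      norm_normalizedValue hπ φ (mem_chart_source ℂ (π z))]
  rw [h1]
  exact le_iSup (fun p => ‖normalizedValue π φ ⟨chartAt ℂ p, chart_mem_atlas ℂ p⟩ p‖ₑ) (π z)

lemma eq_zero_of_supNorm_eq_zero (hπ : IsUniversalCovering π) {φ : QuadraticDifferential S}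
    (h : supNorm π φ = 0) : φ = 0 := by
  refine eq_zero_of_pullback_eq_zero hπ φ fun z => ?_
  have h1 := enorm_normalizedValue_le hπ φ (e := ⟨_, chart_mem_atlas ℂ (π z)⟩)
    (mem_chart_source ℂ (π z))
  rw [h, nonpos_iff_eq_zero, enorm_eq_zero, ← norm_eq_zero,
    norm_normalizedValue hπ φ (mem_chart_source ℂ (π z))] at h1
  exact norm_eq_zero.1 ((mul_eq_zero.1 h1).resolve_right (pow_pos z.im_pos 2).ne')

theorem exists_isBiLipschitz (hπ : IsUniversalCovering π) {n : ℕ} {p : Fin n → S}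
    {e : Fin n → atlas ℂ S} (hcov : ⋃ j, hypBall π (p j) (Real.log (65 / 64)) = univ)
    (he : ∀ j, p j ∈ (e j).1.source) :
    ∃ (V : Submodule ℂ (Fin n → ℂ)) (F : QuadraticDifferential S ≃ₗ[ℂ] V), IsBiLipschitz π 2 F ∧
      ∀ (φ : QuadraticDifferential S) (j : Fin n),
        (F φ : Fin n → ℂ) j = normalizedValue π φ (e j) (p j) := by
  have hinj : Function.Injective (evalMap π e p) := by
    rw [← LinearMap.ker_eq_bot, LinearMap.ker_eq_bot']
    intro φ hφ
    obtain ⟨j, hj⟩ := exists_supNorm_le hπ hcov he φ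
    have h1 : normalizedValue π φ (e j) (p j) = 0 := congrFun hφ j
    rw [h1, enorm_zero, mul_zero, nonpos_iff_eq_zero] at hj
    exact eq_zero_of_supNorm_eq_zero hπ hj
  refine ⟨LinearMap.range (evalMap π e p), LinearEquiv.ofInjective _ hinj, fun φ ψ => ?_,
    fun φ j => rfl⟩
  have hF : ∀ j, edist (evalMap π e p φ j) (evalMap π e p ψ j) =
      ‖normalizedValue π (φ - ψ) (e j) (p j)‖ₑ := fun j => by
    rw [edist_eq_enorm_sub, ← Pi.sub_apply, ← map_sub]
    rfl
  change supNorm π (φ - ψ) / (2 : ℝ≥0) ≤ edist (evalMap π e p φ) (evalMap π e p ψ) ∧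
    edist (evalMap π e p φ) (evalMap π e p ψ) ≤ (2 : ℝ≥0) * supNorm π (φ - ψ)
  constructor
  · obtain ⟨j, hj⟩ := exists_supNorm_le hπ hcov he (φ - ψ)
    refine (ENNReal.div_le_of_le_mul' ?_).trans (edist_le_pi_edist _ _ j)
    rw [hF]
    exact_mod_cast hj
  · refine edist_pi_le_iff.2 fun j => ?_
    rw [hF]
    refine (enorm_normalizedValue_le hπ _ (he j)).trans (le_mul_of_one_le_left zero_le ?_)
    norm_num

end

/-- A maximal family of orbits with given separation, if the cardinalities of such families are
bounded. -/
theorem exists_maximal_separated {Γ : Type*} [Group Γ] [MulAction Γ ℍ] [IsCocompactAction Γ]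
    {σ : ℝ} {N : ℕ} (hN : ∀ (n : ℕ) (z : Fin n → ℍ),
      (∀ i j, i ≠ j → ∀ γ : Γ, σ ≤ dist (γ • z i) (z j)) → n ≤ N) :
    ∃ n ≤ N, ∃ z : Fin n → ℍ, ∀ w : ℍ, ∃ j, ∃ γ : Γ, dist (γ • z j) w < σ := by
  classical
  let P : ℕ → Prop := fun n =>
    ∃ z : Fin n → ℍ, ∀ i j, i ≠ j → ∀ γ : Γ, σ ≤ dist (γ • z i) (z j)
  have h0 : P 0 := ⟨Fin.elim0, fun i => i.elim0⟩
  have hspec : P (Nat.findGreatest P N) := Nat.findGreatest_spec (Nat.zero_le N) h0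
  obtain ⟨z, hz⟩ := hspec
  refine ⟨_, Nat.findGreatest_le N, z, fun w => ?_⟩
  by_contra! hw
  have hsucc : P (Nat.findGreatest P N + 1) := by
    refine ⟨Fin.cons w z, fun i j hij γ => ?_⟩
    rcases Fin.eq_zero_or_eq_succ i with rfl | ⟨i, rfl⟩ <;>
      rcases Fin.eq_zero_or_eq_succ j with rfl | ⟨j, rfl⟩
    · exact absurd rfl hij
    · rw [Fin.cons_zero, Fin.cons_succ, ← dist_smul γ⁻¹, inv_smul_smul, dist_comm]
      exact hw j γ⁻¹
    · exact hw i γ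
    · exact hz i j (fun h => hij (by rw [h])) γ
  have h1 := Nat.le_findGreatest (hN _ hsucc.choose hsucc.choose_spec) hsucc
  omega

end

end BersSpace

end

/-! ### The main theorem. -/

theorem theorem5p1 :
    ∃ α : ℝ≥0, 1 ≤ α ∧ ∃ δ : ℝ, 0 < δ ∧
      ∀ ε : ℝ, 0 < ε → ∃ K : ℝ,
        ∀ (g : ℕ), 2 ≤ g →
        ∀ (S : Type u) [TopologicalSpace S] [T2Space S] [CompactSpace S] [ConnectedSpace S]
          [ChartedSpace ℂ S] [IsManifold 𝓘(ℂ) ω S],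
          BersSpace.HasGenus S g →
        ∀ π : ℍ → S, BersSpace.IsUniversalCovering π →
          ENNReal.ofReal ε ≤ BersSpace.injectivityRadius π →
          ∃ n : ℕ, (n : ℝ) ≤ K * g ∧
          ∃ (p : Fin n → S) (e : Fin n → atlas ℂ S),
            (⋃ j, BersSpace.hypBall π (p j) δ) = Set.univ ∧
            (∀ j, p j ∈ (e j).1.source) ∧
            ∃ (V : Submodule ℂ (Fin n → ℂ)) (F : BersSpace.QuadraticDifferential S ≃ₗ[ℂ] V),
              BersSpace.IsBiLipschitz π α F ∧
              ∀ (φ : BersSpace.QuadraticDifferential S) (j : Fin n),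
                (F φ : Fin n → ℂ) j = BersSpace.normalizedValue π φ (e j) (p j) := by
  have hδ : 0 < Real.log (65 / 64) := Real.log_pos (by norm_num)
  refine ⟨2, one_le_two, Real.log (65 / 64), hδ, fun ε hε => ?_⟩
  -- Separation at most ε is compatible with the displacements of deck transformations; separation
  -- at most δ makes a maximal family a δ-net. The weight `a` depends only on ε and serves all S,
  -- since deck groups are groups of homeomorphisms of ℍ.
  obtain ⟨a, ha⟩ := BersSpace.exists_card_le_mul_finrank (lt_min hε hδ)
  refine ⟨2 * a, fun g hg S _ _ _ _ _ _ hS π hπ hinj => ?_⟩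
  have := BersSpace.isCocompactAction_deckGroup hπ hε hinj
  obtain ⟨hfin, hle⟩ := BersSpace.finrank_deckGroup_addMonoidHom_le hπ (by omega) hS
  obtain ⟨n, hn, z, hz⟩ := BersSpace.exists_maximal_separated (Γ := BersSpace.deckGroup π)
    fun n z hz => by
      simpa using ha (BersSpace.deckGroup π) (fun γ hγ z => (min_le_left _ _).trans
        (BersSpace.le_dist_of_le_injectivityRadius hπ.isCoveringMap hinj γ hγ z)) z hz
  have hcov : ⋃ j, BersSpace.hypBall π (π (z j)) (Real.log (65 / 64)) = Set.univ := by
    refine Set.eq_univ_of_forall fun p => ?_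
    obtain ⟨w, rfl⟩ := hπ.surjective p
    obtain ⟨j, γ, hj⟩ := hz w
    have hle' : BersSpace.hypEDist π (π (z j)) (π w) ≤ edist (γ • z j) w :=
      iInf₂_le_of_le (γ • z j) (BersSpace.map_deckGroup_smul γ (z j))
        (iInf₂_le (f := fun x (_ : π x = π w) => edist (γ • z j) x) w rfl)
    refine Set.mem_iUnion.2 ⟨j, hle'.trans_lt ?_⟩
    rw [edist_dist]
    exact (ENNReal.ofReal_lt_ofReal_iff hδ).2 (hj.trans_le (min_le_right _ _))
  have he := fun j => mem_chart_source ℂ (π (z j))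
  refine ⟨n, ?_, fun j => π (z j), fun j => ⟨_, chart_mem_atlas ℂ (π (z j))⟩, hcov, he,
    BersSpace.exists_isBiLipschitz hπ hcov he⟩
  have h1 : n ≤ a * (2 * g) := hn.trans (Nat.mul_le_mul_left a hle)
  calc (n : ℝ) ≤ ((a * (2 * g) : ℕ) : ℝ) := by exact_mod_cast h1
    _ = 2 * a * g := by push_cast; ring
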